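/- Let $S$ be a second countable locally compact Hausdorff group, $\Gamma$ a countable discrete group with a continuous action of $S$ by automorphisms, and $N=S\ltimes\Gamma$. Let $$1\to U(1)\to\Gamma^\tau\xrightarrow{\ p\ }\Gamma\to 1$$ be a central extension of topological groups, and suppose that the action of $S$ on $\Gamma$ lifts to a continuous action of $S$ on $\Gamma^\tau$ by automorphisms that fix $U(1)$ pointwise, so that $S\ltimes\Gamma^\tau$ is a $U(1)$-central extension of $S\ltimes\Gamma$. Write $s\hat\gamma s^{-1}$ for the action of $s\in S$ on $\hat\gamma\in\Gamma^\tau$. Let $d\hat\gamma$ be the left Haar measure on $\Gamma^\tau$ that gives $U(1)$ mass $1$. Let $A$ be a separable (ungraded) $S\ltimes\Gamma$-$C^*$-algebra, regarded as an $S\ltimes\Gamma^\tau$-$C^*$-algebra on which $U(1)$ acts trivially. The twisted crossed product $\Gamma\ltimes_\tau A$ is the norm closure, in the maximal crossed product $\Gamma^\tau\ltimes A$, of the $f\in C_c(\Gamma^\tau,A)$ that satisfy $f(z^{-1}\hat\gamma)=z f(\hat\gamma)$ for all $z\in U(1)$ (call such $f$ homogeneous). For a locally compact second countable group $G$ and a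 $G$-$C^*$-algebra $D$, a cycle for $KK_G(D,\mathbb C)$ is a tuple $(H,\pi,F,U)$, where $H$ is a separable $\mathbb Z/2$-graded Hilbert space, $U$ is a strongly continuous even unitary representation of $G$ on $H$, $\pi$ is an even $G$-equivariant $*$-representation of $D$ on $H$, and $F$ is an odd bounded operator on $H$ such that $[F,\pi(d)]$, $\pi(d)(F^2-1)$, $\pi(d)(F-F^*)$ and $\pi(d)(U(g)FU(g)^{-1}-F)$ are compact for all $d\in D$, $g\in G$, the last of these depending norm-continuously on $g$. Then $KK_G(D,\mathbb C)$ is the abelian group of homotopy classes of cycles under direct sum, homotopies being cycles for $(D,C([0,1]))$. Let $KK_{S\ltimes\Gamma^\tau}(A,\mathbb C)_{(1)}$ be the subgroup of $KK_{S\ltimes\Gamma^\tau}(A,\mathbb C)$ generated by the cycles on which the central circle acts with weight $1$, i.e. $z\in U(1)$ acts as the scalar $z$. **Proposition.** (1) There is an action of $S$ on $\Gamma\ltimes_\tau A$, making it an $S$-$C^*$-algebra, which on homogeneous $f$ is given by $$(s\cdot f)(\hat\gamma)=s.\bigl(f(s^{-1}\hat\gamma s)\bigr).$$ (2) There is an isomorphism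 of abelian groups $$\Phi\colon KK_{S\ltimes\Gamma^\tau}(A,\mathbb C)_{(1)}\ \xrightarrow{\ \cong\ }\ KK_S(\Gamma\ltimes_\tau A,\mathbb C),$$ which is given on cycles as follows. Say that a cycle $(H,\pi_A,F,\pi_{S\ltimes\Gamma^\tau})$ of weight $1$ for $KK_{S\ltimes\Gamma^\tau}(A,\mathbb C)$ and a cycle $(H,\pi,F,\pi_S)$ for $KK_S(\Gamma\ltimes_\tau A,\mathbb C)$ correspond to each other if, up to a unitary equivalence, they have the same graded Hilbert space and the same $F$, $\pi_S$ is the restriction of $\pi_{S\ltimes\Gamma^\tau}$ to $S$, and $\pi$ is the integrated form of the covariant pair $(\pi_A,\pi_{S\ltimes\Gamma^\tau}|_{\Gamma^\tau})$, i.e. $$\pi(f)v=\int_{\Gamma^\tau}\pi_A(f(\hat\gamma))\,\pi_{S\ltimes\Gamma^\tau}(\hat\gamma)\,v\,d\hat\gamma$$ for all homogeneous $f$ and all $v\in H$. Then every cycle of weight $1$ corresponds to some cycle for $KK_S(\Gamma\ltimes_\tau A,\mathbb C)$; every cycle for $KK_S(\Gamma\ltimes_\tau A,\mathbb C)$ with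 $\pi$ non-degenerate corresponds to some cycle of weight $1$; every class in $KK_S(\Gamma\ltimes_\tau A,\mathbb C)$ is represented by a cycle with $\pi$ non-degenerate; and whenever a cycle $x$ of weight $1$ and a cycle $y$ correspond to each other, $\Phi[x]=[y]$. -/

import Mathlib

open scoped ComplexOrder unitInterval ENNReal CompactlySupported
open MeasureTheory

set_option linter.unusedSectionVars false
set_option linter.overlappingInstances false
set_option linter.style.haveILetI false
set_option linter.unusedVariables false

noncomputable section

namespace GreenJulg

/-- A strongly continuous action of a topological group `G` on a `C*`-algebra `A` by
`*`-automorphisms. -/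
structure CStarAction (G A : Type*) [Group G] [TopologicalSpace G] [NonUnitalCStarAlgebra A] where
  toAut : G →* (A ≃⋆ₐ[ℂ] A)
  continuous_apply : ∀ a : A, Continuous fun g => toAut g a

section HilbertModules

variable (B E : Type*) [CommCStarAlgebra B] [PartialOrder B] [StarOrderedRing B]
  [NormedAddCommGroup E] [NormedSpace ℂ E] [SMul B E] [CStarModule B E]

/-- The rank one operators `z ↦ x ⟨y, z⟩` of a Hilbert module over a commutative `B`. -/
def rankOneOps : Set (E →L[ℂ] E) := {T | ∃ x y : E, ∀ z : E, T z = inner B y z • x}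

/-- The compact operators of a Hilbert module: the norm closure of the finite rank ones. -/
def compactOps : Submodule ℂ (E →L[ℂ] E) :=
  (Submodule.span ℂ (rankOneOps B E)).topologicalClosure

variable {B E}

lemma map_mem_compactOps {B' E' : Type*} [CommCStarAlgebra B'] [PartialOrder B']
    [StarOrderedRing B'] [NormedAddCommGroup E'] [NormedSpace ℂ E'] [SMul B' E'] [CStarModule B' E'] (L : (E →L[ℂ] E) →ₗ[ℂ] (E' →L[ℂ] E')) (hc : Continuous L)
    (hL : ∀ T ∈ rankOneOps B E, L T ∈ rankOneOps B' E') {T : E →L[ℂ] E}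
    (hT : T ∈ compactOps B E) : L T ∈ compactOps B' E' := by
  refine map_mem_closure (s := (Submodule.span ℂ (rankOneOps B E) : Set (E →L[ℂ] E)))
    hc hT ?_
  intro S hS
  have : Submodule.span ℂ (rankOneOps B E) ≤
      (Submodule.span ℂ (rankOneOps B' E')).comap L :=
    Submodule.span_le.2 fun S hS => Submodule.subset_span (hL S hS)
  exact this hS

variable {E' : Type*} [NormedAddCommGroup E'] [NormedSpace ℂ E'] [SMul B E'] [CStarModule B E']

lemma ext_inner {x y : E} (h : ∀ z : E, inner B z x = inner B z y) : x = y := by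
  have : inner B (x - y) (x - y) = 0 := by
    rw [CStarModule.inner_sub_right, h, sub_self]
  exact sub_eq_zero.1 (CStarModule.inner_self.1 this)

lemma inner_zero_left' (x : E) : inner B (0 : E) x = 0 := by
  simp

lemma mem_compactOps_of_subsingleton [Subsingleton E] (T : E →L[ℂ] E) : T ∈ compactOps B E := by
  have : T = 0 := ContinuousLinearMap.ext fun z => Subsingleton.elim _ _
  rw [this]
  exact zero_mem _

lemma mem_compactOps_of_eq_zero {T : E →L[ℂ] E} (h : ∀ u, T u = 0) : T ∈ compactOps B E := by
  have : T = 0 := ContinuousLinearMap.ext h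
  rw [this]
  exact zero_mem _

lemma bsmul_zero (b : B) : b • (0 : E) = 0 :=
  ext_inner (B := B) fun z => by simp

/-- The direct sum of two Hilbert modules is, as a topological vector space, the product. -/
def sumEquiv (B E E' : Type*) [CommCStarAlgebra B] [PartialOrder B] [StarOrderedRing B]
    [NormedAddCommGroup E] [NormedSpace ℂ E] [SMul B E] [CStarModule B E]
    [NormedAddCommGroup E'] [NormedSpace ℂ E'] [SMul B E'] [CStarModule B E'] :
    WithCStarModule B (E × E') ≃L[ℂ] E × E' where
  toLinearEquiv := WithCStarModule.linearEquiv ℂ B (E × E')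
  continuous_toFun := (WithCStarModule.uniformEquiv (A := B) (E := E × E')).continuous
  continuous_invFun := (WithCStarModule.uniformEquiv (A := B) (E := E × E')).symm.continuous

/-- The direct sum of two operators. -/
def sumMap (B : Type*) [CommCStarAlgebra B] [PartialOrder B] [StarOrderedRing B]
    {E E' : Type*}
    [NormedAddCommGroup E] [NormedSpace ℂ E] [SMul B E] [CStarModule B E]
    [NormedAddCommGroup E'] [NormedSpace ℂ E'] [SMul B E'] [CStarModule B E']
    (T : E →L[ℂ] E) (T' : E' →L[ℂ] E') :
    WithCStarModule B (E × E') →L[ℂ] WithCStarModule B (E × E') :=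
  (sumEquiv B E E').symm.toContinuousLinearMap ∘L (T.prodMap T') ∘L
    (sumEquiv B E E').toContinuousLinearMap

@[simp] lemma sumMap_fst (T : E →L[ℂ] E) (T' : E' →L[ℂ] E') (z : WithCStarModule B (E × E')) :
    (sumMap B T T' z).1 = T z.1 := rfl

@[simp] lemma sumMap_snd (T : E →L[ℂ] E) (T' : E' →L[ℂ] E') (z : WithCStarModule B (E × E')) :
    (sumMap B T T' z).2 = T' z.2 := rfl

lemma sum_ext {z w : WithCStarModule B (E × E')} (h1 : z.1 = w.1) (h2 : z.2 = w.2) : z = w :=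
  Prod.ext (x := z) (y := w) h1 h2

lemma sumMap_mul (S T : E →L[ℂ] E) (S' T' : E' →L[ℂ] E') :
    sumMap B (S * T) (S' * T') = sumMap B S S' * sumMap B T T' := rfl

lemma sumMap_sub (S T : E →L[ℂ] E) (S' T' : E' →L[ℂ] E') :
    sumMap B (S - T) (S' - T') = sumMap B S S' - sumMap B T T' := rfl

lemma sumMap_one : sumMap B (1 : E →L[ℂ] E) (1 : E' →L[ℂ] E') = 1 := rfl

lemma sumMap_continuous {Z : Type*} [TopologicalSpace Z] {T : Z → E →L[ℂ] E}
    {T' : Z → E' →L[ℂ] E'} (hT : Continuous T) (hT' : Continuous T') :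
    Continuous fun z => sumMap B (T z) (T' z) := by
  have h : Continuous fun z => (T z).prodMap (T' z) := hT.prod_mapL ℂ hT'
  exact continuous_const.clm_comp (h.clm_comp continuous_const)

lemma sumMap_mem_compactOps {T : E →L[ℂ] E} {T' : E' →L[ℂ] E'} (hT : T ∈ compactOps B E)
    (hT' : T' ∈ compactOps B E') : sumMap B T T' ∈ compactOps B (WithCStarModule B (E × E')) := by
  let e := sumEquiv B E E'
  let i1 : E →L[ℂ] WithCStarModule B (E × E') :=
    e.symm.toContinuousLinearMap ∘L ContinuousLinearMap.inl ℂ E E'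
  let p1 : WithCStarModule B (E × E') →L[ℂ] E :=
    ContinuousLinearMap.fst ℂ E E' ∘L e.toContinuousLinearMap
  let i2 : E' →L[ℂ] WithCStarModule B (E × E') :=
    e.symm.toContinuousLinearMap ∘L ContinuousLinearMap.inr ℂ E E'
  let p2 : WithCStarModule B (E × E') →L[ℂ] E' :=
    ContinuousLinearMap.snd ℂ E E' ∘L e.toContinuousLinearMap
  let L1 : (E →L[ℂ] E) →ₗ[ℂ] _ :=
    { toFun := fun T => i1 ∘L T ∘L p1
      map_add' := fun S T => by ext z; simp
      map_smul' := fun c T => by ext z; simp }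
  let L2 : (E' →L[ℂ] E') →ₗ[ℂ] _ :=
    { toFun := fun T => i2 ∘L T ∘L p2
      map_add' := fun S T => by ext z; simp
      map_smul' := fun c T => by ext z; simp }
  have c1 : Continuous L1 := by
    change Continuous fun T => i1 ∘L T ∘L p1
    fun_prop
  have c2 : Continuous L2 := by
    change Continuous fun T => i2 ∘L T ∘L p2
    fun_prop
  have h1 : L1 T ∈ compactOps B (WithCStarModule B (E × E')) := by
    refine map_mem_compactOps (B := B) (B' := B) L1 c1 ?_ hT
    rintro S ⟨x, y, hS⟩
    refine ⟨i1 x, i1 y, fun z => ?_⟩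
    have hz : inner B (i1 y) z = inner B y z.1 := by
      rw [WithCStarModule.prod_inner]
      change inner B y z.1 + inner B (0 : E') z.2 = _
      rw [inner_zero_left', add_zero]
    rw [hz]
    refine sum_ext ?_ ?_
    · exact hS z.1
    · exact (bsmul_zero _).symm
  have h2 : L2 T' ∈ compactOps B (WithCStarModule B (E × E')) := by
    refine map_mem_compactOps (B := B) (B' := B) L2 c2 ?_ hT'
    rintro S ⟨x, y, hS⟩
    refine ⟨i2 x, i2 y, fun z => ?_⟩
    have hz : inner B (i2 y) z = inner B y z.2 := by
      rw [WithCStarModule.prod_inner]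
      change inner B (0 : E) z.1 + inner B y z.2 = _
      rw [inner_zero_left', zero_add]
    rw [hz]
    refine sum_ext ?_ ?_
    · exact (bsmul_zero _).symm
    · exact hS z.2
  have : sumMap B T T' = L1 T + L2 T' := by
    ext z
    refine sum_ext ?_ ?_
    · change T z.1 = T z.1 + 0
      simp
    · change T' z.2 = 0 + T' z.2
      simp
  rw [this]
  exact add_mem h1 h2

end HilbertModules

section Cycles

/-- A separable `ℤ/2`-graded `G`-equivariant Hilbert `(A, B)`-bimodule, where `A` and `B` are
trivially graded and `G` acts trivially on the commutative unital algebra `B`: a Hilbert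
`B`-module `E` with grading `ε`, unitary strongly continuous even action `U` of `G`, and equivariant
even `*`-representation `π` of `A` by adjointable operators. -/
structure GradedBimodule {G A : Type*} [Group G] [TopologicalSpace G] [NonUnitalCStarAlgebra A]
    (α : CStarAction G A) (B : Type*) [CommCStarAlgebra B] [PartialOrder B]
    [StarOrderedRing B] where
  E : Type
  [instNormed : NormedAddCommGroup E]
  [instSpace : NormedSpace ℂ E]
  [instComplete : CompleteSpace E]
  [instSeparable : TopologicalSpace.SeparableSpace E]
  [instSMul : SMul B E]
  [instModule : CStarModule B E]
  ε : E →L[ℂ] E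
  U : G →* (E →L[ℂ] E)
  π : A →ₙₐ[ℂ] (E →L[ℂ] E)
  ε_sq : ∀ x, ε (ε x) = x
  ε_inner : ∀ x y, inner B (ε x) y = inner B x (ε y)
  U_inner : ∀ g x y, inner B (U g x) (U g y) = inner B x y
  U_continuous : ∀ x, Continuous fun g => U g x
  U_even : ∀ g x, ε (U g x) = U g (ε x)
  π_inner : ∀ a x y, inner B (π a x) y = inner B x (π (star a) y)
  π_even : ∀ a x, ε (π a x) = π a (ε x)
  π_equivariant : ∀ g a x, U g (π a x) = π (α.toAut g a) (U g x)

attribute [instance] GradedBimodule.instNormed GradedBimodule.instSpace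
  GradedBimodule.instComplete GradedBimodule.instSeparable GradedBimodule.instSMul
  GradedBimodule.instModule

/-- A (Kasparov) cycle for `KK_G(A, B)`: an odd adjointable operator `F`, with adjoint `Fadj`, such
that `[F, π a]`, `π a (F² - 1)`, `π a (F - F*)` and `π a (U g F U g⁻¹ - F)` are compact, the last of
these depending norm-continuously on `g`. -/
structure KasparovCycle {G A : Type*} [Group G] [TopologicalSpace G] [NonUnitalCStarAlgebra A]
    (α : CStarAction G A) (B : Type*) [CommCStarAlgebra B] [PartialOrder B]
    [StarOrderedRing B] extends GradedBimodule α B where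
  F : E →L[ℂ] E
  Fadj : E →L[ℂ] E
  F_inner : ∀ x y, inner B (F x) y = inner B x (Fadj y)
  F_odd : ∀ x, ε (F x) = -F (ε x)
  F_comm : ∀ a, F * π a - π a * F ∈ compactOps B E
  F_sq : ∀ a, π a * (F * F - 1) ∈ compactOps B E
  F_selfAdj : ∀ a, π a * (F - Fadj) ∈ compactOps B E
  F_equivariant : ∀ a g, π a * (U g * F * U g⁻¹ - F) ∈ compactOps B E
  F_continuous : ∀ a, Continuous fun g => π a * (U g * F * U g⁻¹ - F)

variable {G A B : Type*} [Group G] [TopologicalSpace G] [NonUnitalCStarAlgebra A]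
  {α : CStarAction G A} [CommCStarAlgebra B] [PartialOrder B] [StarOrderedRing B]

/-- Direct sum of bimodules. -/
def GradedBimodule.sum (X Y : GradedBimodule α B) : GradedBimodule α B where
  E := WithCStarModule B (X.E × Y.E)
  instSeparable := (sumEquiv B X.E Y.E).symm.surjective.denseRange.separableSpace
    (sumEquiv B X.E Y.E).symm.continuous
  ε := sumMap B X.ε Y.ε
  U :=
    { toFun := fun g => sumMap B (X.U g) (Y.U g)
      map_one' := by ext z; apply sum_ext <;> simp
      map_mul' := fun g h => by ext z; apply sum_ext <;> simp }
  π :=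
    { toFun := fun a => sumMap B (X.π a) (Y.π a)
      map_zero' := by ext z; apply sum_ext <;> simp
      map_add' := fun g h => by ext z; apply sum_ext <;> simp
      map_mul' := fun g h => by ext z; apply sum_ext <;> simp
      map_smul' := fun g h => by ext z; apply sum_ext <;> simp }
  ε_sq x := by apply sum_ext <;> simp [X.ε_sq, Y.ε_sq]
  ε_inner x y := by simp [WithCStarModule.prod_inner, X.ε_inner, Y.ε_inner]
  U_inner g x y := by simp [WithCStarModule.prod_inner, X.U_inner, Y.U_inner]
  U_continuous x := by
    refine (sumEquiv B X.E Y.E).symm.continuous.comp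
      (((X.U_continuous x.1).prodMk (Y.U_continuous x.2)))
  U_even g x := by apply sum_ext <;> simp [X.U_even, Y.U_even]
  π_inner a x y := by simp [WithCStarModule.prod_inner, X.π_inner, Y.π_inner]
  π_even a x := by apply sum_ext <;> simp [X.π_even, Y.π_even]
  π_equivariant g a x := by apply sum_ext <;> simp [X.π_equivariant, Y.π_equivariant]

/-- Direct sum of cycles. -/
def KasparovCycle.sum (x y : KasparovCycle α B) : KasparovCycle α B where
  toGradedBimodule := x.toGradedBimodule.sum y.toGradedBimodule
  F := sumMap B x.F y.F
  Fadj := sumMap B x.Fadj y.Fadj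
  F_inner u v := by
    refine Eq.trans (WithCStarModule.prod_inner _ _) (Eq.trans ?_
      (WithCStarModule.prod_inner _ _).symm)
    exact congrArg₂ (· + ·) (x.F_inner _ _) (y.F_inner _ _)
  F_odd u := sum_ext (B := B) (x.F_odd _) (y.F_odd _)
  F_comm a := by
    have h := sumMap_mem_compactOps (x.F_comm a) (y.F_comm a)
    rw [sumMap_sub, sumMap_mul, sumMap_mul] at h
    exact h
  F_sq a := by
    have h := sumMap_mem_compactOps (x.F_sq a) (y.F_sq a)
    rw [sumMap_mul, sumMap_sub, sumMap_mul, sumMap_one] at h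
    exact h
  F_selfAdj a := by
    have h := sumMap_mem_compactOps (x.F_selfAdj a) (y.F_selfAdj a)
    rw [sumMap_mul, sumMap_sub] at h
    exact h
  F_equivariant a g := by
    have h := sumMap_mem_compactOps (x.F_equivariant a g) (y.F_equivariant a g)
    rw [sumMap_mul, sumMap_sub, sumMap_mul, sumMap_mul] at h
    exact h
  F_continuous a := by
    refine (sumMap_continuous (B := B) (x.F_continuous a) (y.F_continuous a)).congr fun g => ?_
    rw [sumMap_mul, sumMap_sub, sumMap_mul, sumMap_mul]
    rfl

/-- The cycle with opposite grading and operator `-F`. -/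
def KasparovCycle.neg (x : KasparovCycle α B) : KasparovCycle α B where
  toGradedBimodule :=
    { x.toGradedBimodule with
      ε := -x.ε
      ε_sq := fun u => by simp [x.ε_sq]
      ε_inner := fun u v => by
        simp only [neg_apply, CStarModule.inner_neg_left, CStarModule.inner_neg_right, x.ε_inner]
      U_even := fun g u => by simp [x.U_even]
      π_even := fun a u => by simp [x.π_even] }
  F := -x.F
  Fadj := -x.Fadj
  F_inner u v := by
    simp only [neg_apply, CStarModule.inner_neg_left, CStarModule.inner_neg_right, x.F_inner]
  F_odd u := by simp [x.F_odd]
  F_comm a := by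
    convert neg_mem (x.F_comm a) using 1
    simp; abel
  F_sq a := by
    convert x.F_sq a using 1
    simp
  F_selfAdj a := by
    convert neg_mem (x.F_selfAdj a) using 1
    noncomm_ring
  F_equivariant a g := by
    convert neg_mem (x.F_equivariant a g) using 1
    noncomm_ring
  F_continuous a := by
    refine (x.F_continuous a).neg.congr fun g => ?_
    change -(x.π a * (x.U g * x.F * x.U g⁻¹ - x.F)) = _
    noncomm_ring

/-- The zero module. -/
@[reducible] def punitSMul (B : Type*) : SMul B PUnit.{1} := ⟨fun _ _ => PUnit.unit⟩

/-- The zero module as a Hilbert module. -/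
@[reducible] def punitModule (B : Type*) [CommCStarAlgebra B] [PartialOrder B]
    [StarOrderedRing B] : @CStarModule B PUnit.{1} _ _ _ _ _ _ (punitSMul B) _ _ :=
  letI : SMul B PUnit.{1} := punitSMul B
  { inner := fun _ _ => 0
    inner_add_right := (add_zero _).symm
    inner_self_nonneg := le_rfl
    inner_self := ⟨fun _ => rfl, fun _ => rfl⟩
    inner_op_smul_right := (mul_zero _).symm
    inner_smul_right_complex := (smul_zero _).symm
    star_inner := fun _ _ => star_zero _
    norm_eq_sqrt_norm_inner_self := fun _ => by simp }

/-- The zero cycle. -/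
def KasparovCycle.zero (α : CStarAction G A) (B : Type*) [CommCStarAlgebra B] [PartialOrder B]
    [StarOrderedRing B] : KasparovCycle α B where
  E := PUnit
  instSMul := punitSMul B
  instModule := punitModule B
  ε := 0
  U := 1
  π := 0
  ε_sq _ := rfl
  ε_inner _ _ := rfl
  U_inner _ _ _ := rfl
  U_continuous _ := continuous_const
  U_even _ _ := rfl
  π_inner _ _ _ := rfl
  π_even _ _ := rfl
  π_equivariant _ _ _ := rfl
  F := 0
  Fadj := 0
  F_inner _ _ := rfl
  F_odd _ := rfl
  F_comm _ :=
    @mem_compactOps_of_subsingleton B PUnit.{1} _ _ _ _ _ (punitSMul B) (punitModule B) _ _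
  F_sq _ :=
    @mem_compactOps_of_subsingleton B PUnit.{1} _ _ _ _ _ (punitSMul B) (punitModule B) _ _
  F_selfAdj _ :=
    @mem_compactOps_of_subsingleton B PUnit.{1} _ _ _ _ _ (punitSMul B) (punitModule B) _ _
  F_equivariant _ _ :=
    @mem_compactOps_of_subsingleton B PUnit.{1} _ _ _ _ _ (punitSMul B) (punitModule B) _ _
  F_continuous _ := continuous_const.congr fun _ =>
    ContinuousLinearMap.ext fun _ => (rfl : (0 : PUnit.{1} →L[ℂ] PUnit.{1}) _ = _)

/-- Unitary equivalence of cycles. -/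
def KasparovCycle.UnitaryEquiv (x y : KasparovCycle α B) : Prop :=
  ∃ e : x.E ≃ₗ[ℂ] y.E,
    (∀ u v, inner B (e u) (e v) = inner B u v) ∧
    (∀ u, e (x.ε u) = y.ε (e u)) ∧
    (∀ g u, e (x.U g u) = y.U g (e u)) ∧
    (∀ a u, e (x.π a u) = y.π a (e u)) ∧
    (∀ u, e (x.F u) = y.F (e u))

/-- `x` is (isomorphic to) the evaluation at `t` of the cycle `W` for `(A, C([0,1]))`, i.e. the
base change of `W` along `C([0,1]) → ℂ`, `h ↦ h t`: there is a map `q` with dense range from `W.E`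
to `x.E` that turns the inner product of `W.E`, evaluated at `t`, into that of `x.E`, and that
intertwines all the structure. -/
def KasparovCycle.IsEvaluation (t : I) (W : KasparovCycle α C(I, ℂ)) (x : KasparovCycle α ℂ) :
    Prop :=
  ∃ q : W.E →ₗ[ℂ] x.E, DenseRange q ∧
    (∀ u v, inner ℂ (q u) (q v) = (inner C(I, ℂ) u v) t) ∧
    (∀ u, q (W.ε u) = x.ε (q u)) ∧
    (∀ g u, q (W.U g u) = x.U g (q u)) ∧
    (∀ a u, q (W.π a u) = x.π a (q u)) ∧
    (∀ u, q (W.F u) = x.F (q u))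

/-- `x` and `y` are joined by a homotopy, i.e. by a cycle for `(A, C([0,1]))`. -/
def KasparovCycle.Homotopic (x y : KasparovCycle α ℂ) : Prop :=
  ∃ W : KasparovCycle α C(I, ℂ), W.IsEvaluation 0 x ∧ W.IsEvaluation 1 y

/-- `KK_G(A, ℂ)`: cycles modulo the equivalence relation generated by homotopy. -/
def KK (α : CStarAction G A) : Type _ :=
  Quot fun x y : KasparovCycle α ℂ => x.Homotopic y

/-- The class of a cycle. -/
def KK.mk (x : KasparovCycle α ℂ) : KK α := Quot.mk _ x

section Paths

variable {H : Type} [NormedAddCommGroup H] [NormedSpace ℂ H]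

variable (H) in
/-- Continuous paths in `H`, required to start at `0` if `b` holds. -/
def pathSubmodule (b : Prop) : Submodule ℂ C(I, H) where
  carrier := {f | b → f 0 = 0}
  add_mem' hf hg h := by simp [hf h, hg h]
  zero_mem' _ := rfl
  smul_mem' c f hf h := by simp [hf h]

variable (H) in
/-- Continuous paths in `H`, required to start at `0` if `b` holds. -/
def PathSpace (b : Prop) : Type := pathSubmodule H b

variable {b : Prop}

instance : NormedAddCommGroup (PathSpace H b) :=
  inferInstanceAs (NormedAddCommGroup (pathSubmodule H b))

instance : NormedSpace ℂ (PathSpace H b) :=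
  inferInstanceAs (NormedSpace ℂ (pathSubmodule H b))

/-- The underlying continuous map. -/
def PathSpace.toMap : PathSpace H b →ₗ[ℂ] C(I, H) := (pathSubmodule H b).subtype

instance : CoeFun (PathSpace H b) fun _ => I → H := ⟨fun f => f.toMap⟩

lemma pathSubmodule_isClosed : IsClosed (pathSubmodule H b : Set C(I, H)) := by
  by_cases hb : b
  · have : (pathSubmodule H b : Set C(I, H)) = {f | f 0 = 0} := by
      ext f; exact ⟨fun h => h hb, fun h _ => h⟩
    rw [this]
    exact isClosed_eq (ContinuousEvalConst.continuous_eval_const 0) continuous_const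
  · have : (pathSubmodule H b : Set C(I, H)) = Set.univ := by
      ext f; exact ⟨fun h => trivial, fun h h' => (hb h').elim⟩
    rw [this]
    exact isClosed_univ

instance [CompleteSpace H] : CompleteSpace (PathSpace H b) :=
  (pathSubmodule_isClosed (H := H) (b := b)).completeSpace_coe

instance [TopologicalSpace.SeparableSpace H] :
    TopologicalSpace.SeparableSpace (PathSpace H b) := by
  have : SecondCountableTopology H := UniformSpace.secondCountable_of_separable H
  have : SecondCountableTopology (pathSubmodule H b) := inferInstance
  exact (inferInstance : TopologicalSpace.SeparableSpace (pathSubmodule H b))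

lemma PathSpace.ext {f g : PathSpace H b} (h : ∀ t, f t = g t) : f = g :=
  Subtype.ext (ContinuousMap.ext h)

lemma PathSpace.norm_le {f : PathSpace H b} {r : ℝ} (hr : 0 ≤ r) : ‖f‖ ≤ r ↔ ∀ t, ‖f t‖ ≤ r :=
  ContinuousMap.norm_le f.toMap hr

lemma PathSpace.apply_le (f : PathSpace H b) (t : I) : ‖f t‖ ≤ ‖f‖ :=
  f.toMap.norm_coe_le_norm t

lemma PathSpace.map_zero (f : PathSpace H b) (h : b) : f 0 = 0 := f.2 h

/-- Constructor for paths. -/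
def PathSpace.mk (f : I → H) (hf : Continuous f) (h : b → f 0 = 0) : PathSpace H b :=
  ⟨⟨f, hf⟩, h⟩

@[simp] lemma PathSpace.mk_apply (f : I → H) (hf : Continuous f) (h : b → f 0 = 0) (t : I) :
    (PathSpace.mk f hf h) t = f t := rfl

lemma PathSpace.continuous (f : PathSpace H b) : Continuous f := f.toMap.continuous

/-- The operator `f ↦ (t ↦ φ t • T (f t))`. -/
def pathOp (φ : C(I, ℂ)) (T : H →L[ℂ] H) : PathSpace H b →L[ℂ] PathSpace H b :=
  LinearMap.mkContinuous
    { toFun := fun f => PathSpace.mk (fun t => φ t • T (f t))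
        (φ.continuous.smul (T.continuous.comp f.continuous)) fun h => by simp [f.map_zero h]
      map_add' := fun f g => PathSpace.ext fun t => by simp
      map_smul' := fun c f => PathSpace.ext fun t => by
        simp [smul_comm c] }
    (‖φ‖ * ‖T‖) fun f => (PathSpace.norm_le (by positivity)).2 fun t => by
      change ‖φ t • T (f t)‖ ≤ _
      rw [norm_smul, mul_assoc]
      exact mul_le_mul (φ.norm_coe_le_norm t)
        ((T.le_opNorm _).trans (mul_le_mul_of_nonneg_left (PathSpace.apply_le f t) (norm_nonneg _)))
        (norm_nonneg _) (norm_nonneg _)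

@[simp] lemma pathOp_apply (φ : C(I, ℂ)) (T : H →L[ℂ] H) (f : PathSpace H b) (t : I) :
    (pathOp φ T f) t = φ t • T (f t) := rfl

lemma pathOp_norm_le (φ : C(I, ℂ)) (T : H →L[ℂ] H) :
    ‖(pathOp φ T : PathSpace H b →L[ℂ] PathSpace H b)‖ ≤ ‖φ‖ * ‖T‖ :=
  LinearMap.mkContinuous_norm_le _ (by positivity) _

/-- Pointwise multiplication of paths by functions. -/
@[reducible] def pathSMul : SMul C(I, ℂ) (PathSpace H b) :=
  ⟨fun φ f => PathSpace.mk (fun t => φ t • f t)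
    (φ.continuous.smul f.continuous) fun h => by simp [f.map_zero h]⟩

/-- `pathOp φ` as a linear map. -/
def pathOpLinear (φ : C(I, ℂ)) :
    (H →L[ℂ] H) →ₗ[ℂ] (PathSpace H b →L[ℂ] PathSpace H b) where
  toFun := pathOp φ
  map_add' S T := ContinuousLinearMap.ext fun f => PathSpace.ext fun t => by simp
  map_smul' c T := ContinuousLinearMap.ext fun f => PathSpace.ext fun t => smul_comm _ _ _

lemma pathOpLinear_continuous (φ : C(I, ℂ)) :
    Continuous (pathOpLinear φ : (H →L[ℂ] H) →ₗ[ℂ] (PathSpace H b →L[ℂ] PathSpace H b)) :=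
  ((pathOpLinear φ).mkContinuous ‖φ‖ fun T => pathOp_norm_le φ T).continuous

/-- Scalar multiplication of the complex vector space `H`. -/
def scal (c : ℂ) (x : H) : H := c • x

lemma scal_continuous (φ : C(I, ℂ)) (x : H) : Continuous fun t => scal (φ t) x :=
  φ.continuous.smul continuous_const

lemma scal_zero (x : H) : scal 0 x = 0 := zero_smul ℂ x

lemma scal_one (x : H) : scal 1 x = x := one_smul ℂ x

/-- The operator-valued path `t ↦ c t • T + s t • J`. -/
def rotOp (c s : C(I, ℂ)) (T J : H →L[ℂ] H) : PathSpace H b →L[ℂ] PathSpace H b :=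
  pathOp c T + pathOp s J

lemma rotOp_apply (c s : C(I, ℂ)) (T J : H →L[ℂ] H) (f : PathSpace H b) (t : I) :
    rotOp c s T J f t = scal (c t) (T (f t)) + scal (s t) (J (f t)) := rfl

variable (b) in
/-- Pointwise application of `T`. -/
def constOp (T : H →L[ℂ] H) : PathSpace H b →L[ℂ] PathSpace H b :=
  LinearMap.mkContinuous
    { toFun := fun f => PathSpace.mk (fun t => T (f t)) (T.continuous.comp f.continuous)
        fun h => by simp [f.map_zero h]
      map_add' := fun f g => PathSpace.ext fun t => map_add T _ _
      map_smul' := fun c f => PathSpace.ext fun t => map_smul T _ _ }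
    ‖T‖ fun f => (PathSpace.norm_le (by positivity)).2 fun t =>
      (T.le_opNorm _).trans (mul_le_mul_of_nonneg_left (PathSpace.apply_le f t) (norm_nonneg _))

lemma constOp_eq (T : H →L[ℂ] H) : constOp b T = pathOp 1 T :=
  ContinuousLinearMap.ext fun f => PathSpace.ext fun t => (one_smul ℂ (T (f t))).symm

lemma constOp_continuous : Continuous (constOp b : (H →L[ℂ] H) → _) := by
  have h : (constOp b : (H →L[ℂ] H) → _) = pathOpLinear 1 := funext constOp_eq
  rw [h]
  exact pathOpLinear_continuous 1

lemma pathOp_congr {T S : PathSpace H b →L[ℂ] PathSpace H b} (h : ∀ f t, T f t = S f t) : T = S :=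
  ContinuousLinearMap.ext fun f => PathSpace.ext fun t => h f t

lemma rotOp_comm (c s : C(I, ℂ)) {T J P : H →L[ℂ] H} (hJ : ∀ v, J (P v) = P (J v)) :
    rotOp c s T J * constOp b P - constOp b P * rotOp c s T J = pathOp c (T * P - P * T) := by
  refine pathOp_congr fun f t => ?_
  change (c t • T (P (f t)) + s t • J (P (f t))) - P (c t • T (f t) + s t • J (f t)) =
    c t • (T (P (f t)) - P (T (f t)))
  rw [map_add, map_smul, map_smul, hJ]
  module

lemma rotOp_sq {c s : C(I, ℂ)} (hcs : ∀ t, c t * c t + s t * s t = 1) {T J P : H →L[ℂ] H}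
    (hJ : ∀ v, J (J v) = v) (hTJ : ∀ v, T (J v) + J (T v) = 0) :
    constOp b P * (rotOp c s T J * rotOp c s T J - 1) = pathOp (c * c) (P * (T * T - 1)) := by
  refine pathOp_congr fun f t => ?_
  change P ((c t • T (c t • T (f t) + s t • J (f t)) + s t • J (c t • T (f t) + s t • J (f t))) -
    f t) = (c t * c t) • P (T (T (f t)) - f t)
  refine Eq.trans (congrArg P ?_) (map_smul P _ _)
  have h1 : J (T (f t)) = -T (J (f t)) := by
    rw [eq_neg_iff_add_eq_zero, add_comm, hTJ]
  rw [map_add, map_smul, map_smul, map_add, map_smul, map_smul, hJ, h1]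
  have h2 : (c t * c t) • f t + (s t * s t) • f t = f t := by
    rw [← add_smul, hcs, one_smul]
  have h3 : c t • (c t • T (T (f t)) + s t • T (J (f t))) + s t • (c t • -T (J (f t)) + s t • f t)
      - f t = (c t * c t) • (T (T (f t)) - f t) +
        ((c t * c t) • f t + (s t * s t) • f t - f t) := by
    module
  rw [h3, h2, sub_self, add_zero]

lemma rotOp_sub (c s : C(I, ℂ)) (T T' J P : H →L[ℂ] H) :
    constOp b P * (rotOp c s T J - rotOp c s T' J) = pathOp c (P * (T - T')) := by
  refine pathOp_congr fun f t => ?_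
  change P ((c t • T (f t) + s t • J (f t)) - (c t • T' (f t) + s t • J (f t))) =
    c t • P (T (f t) - T' (f t))
  refine Eq.trans (congrArg P ?_) (map_smul P _ _)
  module

lemma rotOp_equivariant (c s : C(I, ℂ)) {T J P V V' : H →L[ℂ] H}
    (hJ : ∀ v, V (J (V' v)) = J v) :
    constOp b P * (constOp b V * rotOp c s T J * constOp b V' - rotOp c s T J) =
      pathOp c (P * (V * T * V' - T)) := by
  refine pathOp_congr fun f t => ?_
  change P (V (c t • T (V' (f t)) + s t • J (V' (f t))) - (c t • T (f t) + s t • J (f t))) =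
    c t • P (V (T (V' (f t))) - T (f t))
  refine Eq.trans (congrArg P ?_) (map_smul P _ _)
  rw [map_add, map_smul, map_smul, hJ]
  module

lemma rotOp_odd (c s : C(I, ℂ)) {T J P : H →L[ℂ] H} (hT : ∀ v, P (T v) = -T (P v))
    (hJ : ∀ v, P (J v) = -J (P v)) (f : PathSpace H b) :
    constOp b P (rotOp c s T J f) = -rotOp c s T J (constOp b P f) := by
  refine PathSpace.ext fun t => ?_
  change P (c t • T (f t) + s t • J (f t)) = -(c t • T (P (f t)) + s t • J (P (f t)))
  rw [map_add, map_smul, map_smul, hT, hJ]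
  module

lemma inner_scal_right [SMul ℂ H] [CStarModule ℂ H] (c : ℂ) (x y : H) :
    inner ℂ x (scal c y) = c * inner ℂ x y :=
  CStarModule.inner_smul_right_complex

lemma inner_scal_left [SMul ℂ H] [CStarModule ℂ H] (c : ℂ) (x y : H) :
    inner ℂ (scal c x) y = star c * inner ℂ x y :=
  CStarModule.inner_smul_left_complex

lemma rotOp_inner [SMul ℂ H] [CStarModule ℂ H] {c s : C(I, ℂ)} (hc : ∀ t, star (c t) = c t)
    (hs : ∀ t, star (s t) = s t) {T T' J : H →L[ℂ] H}
    (hT : ∀ u v, inner ℂ (T u) v = inner ℂ u (T' v))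
    (hJ : ∀ u v, inner ℂ (J u) v = inner ℂ u (J v)) (f g : PathSpace H b) (t : I) :
    inner ℂ (rotOp c s T J f t) (g t) = inner ℂ (f t) (rotOp c s T' J g t) := by
  rw [rotOp_apply, rotOp_apply, CStarModule.inner_add_left, CStarModule.inner_add_right,
    inner_scal_left, inner_scal_left, inner_scal_right, inner_scal_right, hc, hs, hT, hJ]

lemma complex_smul_eq [inst : SMul ℂ H] [CStarModule ℂ H] (c : ℂ) (x : H) :
    inst.smul c x = scal c x := by
  refine ext_inner (B := ℂ) fun z => ?_
  exact (CStarModule.inner_op_smul_right).trans (CStarModule.inner_smul_right_complex).symm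

/-- The Hilbert `C([0,1])`-module of paths. -/
@[reducible] def pathModule [SMul ℂ H] [CStarModule ℂ H] :
    @CStarModule C(I, ℂ) (PathSpace H b) _ _ _ _ _ _ pathSMul _ _ :=
  letI : SMul C(I, ℂ) (PathSpace H b) := pathSMul
  { inner := fun f g => ⟨fun t => inner ℂ (f t) (g t),
      CStarModule.continuous_inner.comp (f.continuous.prodMk g.continuous)⟩
    inner_add_right := ContinuousMap.ext fun t => CStarModule.inner_add_right
    inner_self_nonneg := fun t => CStarModule.inner_self_nonneg
    inner_self := fun {f} => by
      refine ⟨fun h => PathSpace.ext fun t => ?_, fun h => ?_⟩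
      · exact CStarModule.inner_self.1 (DFunLike.congr_fun h t)
      · subst h
        exact ContinuousMap.ext fun t => CStarModule.inner_self.2 rfl
    inner_op_smul_right := ContinuousMap.ext fun t => CStarModule.inner_smul_right_complex
    inner_smul_right_complex := ContinuousMap.ext fun t => CStarModule.inner_smul_right_complex
    star_inner := fun f g => ContinuousMap.ext fun t => CStarModule.star_inner _ _
    norm_eq_sqrt_norm_inner_self := fun f => by
      apply le_antisymm
      · refine (PathSpace.norm_le (Real.sqrt_nonneg _)).2 fun t => ?_
        rw [CStarModule.norm_eq_sqrt_norm_inner_self (A := ℂ) (f t)]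
        exact Real.sqrt_le_sqrt (ContinuousMap.norm_coe_le_norm
          (⟨fun t => inner ℂ (f t) (f t),
            CStarModule.continuous_inner.comp (f.continuous.prodMk f.continuous)⟩ : C(I, ℂ)) t)
      · refine Real.sqrt_le_iff.2 ⟨norm_nonneg _, (ContinuousMap.norm_le _ (by positivity)).2 fun t => ?_⟩
        change ‖inner ℂ (f t) (f t)‖ ≤ _
        rw [← CStarModule.norm_sq_eq ℂ]
        exact pow_le_pow_left₀ (norm_nonneg _) (PathSpace.apply_le f t) 2 }

lemma pathOp_mem_compactOps [SMul ℂ H] [CStarModule ℂ H] (φ : C(I, ℂ)) {T : H →L[ℂ] H}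
    (hT : T ∈ compactOps ℂ H) :
    pathOp φ T ∈ @compactOps C(I, ℂ) (PathSpace H False) _ _ _ _ pathSMul pathModule := by
  letI : SMul C(I, ℂ) (PathSpace H False) := pathSMul
  letI : CStarModule C(I, ℂ) (PathSpace H False) := pathModule
  refine map_mem_compactOps (B := ℂ) (B' := C(I, ℂ)) (pathOpLinear φ) (pathOpLinear_continuous φ) ?_ hT
  rintro S ⟨x, y, hS⟩
  refine ⟨PathSpace.mk (fun t => scal (φ t) x) (scal_continuous φ x) False.elim,
    PathSpace.mk (fun _ => y) continuous_const False.elim, fun f => PathSpace.ext fun t => ?_⟩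
  have h : S (f t) = scal (inner ℂ y (f t)) x := (hS (f t)).trans (complex_smul_eq _ _)
  change scal (φ t) (S (f t)) = scal (inner ℂ y (f t)) (scal (φ t) x)
  rw [h]
  exact smul_comm (M := ℂ) (N := ℂ) (α := H) _ _ _


lemma constOp_mem_compactOps [SMul ℂ H] [CStarModule ℂ H] {T : H →L[ℂ] H}
    (hT : T ∈ compactOps ℂ H) :
    constOp False T ∈ @compactOps C(I, ℂ) (PathSpace H False) _ _ _ _ pathSMul pathModule := by
  rw [constOp_eq]
  exact pathOp_mem_compactOps 1 hT

end Paths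

lemma GradedBimodule.U_norm (X : GradedBimodule α B) (g : G) (u : X.E) : ‖X.U g u‖ = ‖u‖ := by
  rw [CStarModule.norm_eq_sqrt_norm_inner_self (A := B), X.U_inner,
    ← CStarModule.norm_eq_sqrt_norm_inner_self (A := B)]

/-- The bimodule of paths in a bimodule. -/
def GradedBimodule.path (X : GradedBimodule α ℂ) (b : Prop) : GradedBimodule α C(I, ℂ) where
  E := PathSpace X.E b
  instSMul := pathSMul
  instModule := pathModule
  ε := constOp b X.ε
  U :=
    { toFun := fun g => constOp b (X.U g)
      map_one' := ContinuousLinearMap.ext fun f => PathSpace.ext fun t => by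
        change X.U 1 (f t) = f t
        rw [map_one]; rfl
      map_mul' := fun g h => ContinuousLinearMap.ext fun f => PathSpace.ext fun t => by
        change X.U (g * h) (f t) = X.U g (X.U h (f t))
        rw [map_mul]; rfl }
  π :=
    { toFun := fun a => constOp b (X.π a)
      map_zero' := ContinuousLinearMap.ext fun f => PathSpace.ext fun t => by
        change X.π 0 (f t) = 0
        rw [map_zero]; rfl
      map_add' := fun a a' => ContinuousLinearMap.ext fun f => PathSpace.ext fun t => by
        change X.π (a + a') (f t) = X.π a (f t) + X.π a' (f t)
        rw [map_add]; rfl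
      map_mul' := fun a a' => ContinuousLinearMap.ext fun f => PathSpace.ext fun t => by
        change X.π (a * a') (f t) = X.π a (X.π a' (f t))
        rw [map_mul]; rfl
      map_smul' := fun c a => ContinuousLinearMap.ext fun f => PathSpace.ext fun t => by
        change X.π (c • a) (f t) = scal c (X.π a (f t))
        rw [map_smul]; rfl }
  ε_sq f := PathSpace.ext fun t => X.ε_sq _
  ε_inner f g := ContinuousMap.ext fun t => X.ε_inner _ _
  U_inner g f f' := ContinuousMap.ext fun t => X.U_inner _ _ _
  U_continuous f := by
    have h : Continuous fun q : X.E × G => X.U q.2 q.1 := by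
      refine continuous_prod_of_continuous_lipschitzWith _ 1 X.U_continuous fun g => ?_
      refine LipschitzWith.of_dist_le_mul fun u v => ?_
      simp [dist_eq_norm, ← map_sub, X.U_norm]
    have h2 : Continuous fun g : G =>
        (⟨fun t => X.U g (f t), ((X.U g).continuous.comp f.continuous)⟩ : C(I, X.E)) :=
      ContinuousMap.continuous_of_continuous_uncurry _
        (h.comp ((f.continuous.comp continuous_snd).prodMk continuous_fst))
    exact Continuous.subtype_mk h2 _
  U_even g f := PathSpace.ext fun t => X.U_even _ _
  π_inner a f g := ContinuousMap.ext fun t => X.π_inner _ _ _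
  π_even a f := PathSpace.ext fun t => X.π_even _ _
  π_equivariant g a f := PathSpace.ext fun t => X.π_equivariant _ _ _

/-- The constant homotopy. -/
def KasparovCycle.const (x : KasparovCycle α ℂ) : KasparovCycle α C(I, ℂ) where
  toGradedBimodule := x.toGradedBimodule.path False
  F := constOp False x.F
  Fadj := constOp False x.Fadj
  F_inner f g := ContinuousMap.ext fun t => x.F_inner _ _
  F_odd f := PathSpace.ext fun t => x.F_odd _
  F_comm a := constOp_mem_compactOps (x.F_comm a)
  F_sq a := constOp_mem_compactOps (x.F_sq a)
  F_selfAdj a := constOp_mem_compactOps (x.F_selfAdj a)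
  F_equivariant a g := constOp_mem_compactOps (x.F_equivariant a g)
  F_continuous a := constOp_continuous.comp (x.F_continuous a)

lemma KasparovCycle.const_isEvaluation (x : KasparovCycle α ℂ) (t : I) :
    x.const.IsEvaluation t x :=
  ⟨{ toFun := fun f : PathSpace x.E False => f t
     map_add' := fun f g => rfl
     map_smul' := fun c f => rfl },
   (Function.Surjective.denseRange fun u =>
      ⟨PathSpace.mk (fun _ => u) continuous_const False.elim, rfl⟩),
   fun u v => rfl, fun u => rfl, fun g u => rfl, fun a u => rfl, fun u => rfl⟩

lemma KasparovCycle.Homotopic.of_unitaryEquiv {x y : KasparovCycle α ℂ} (h : x.UnitaryEquiv y) :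
    x.Homotopic y := by
  obtain ⟨e, h1, h2, h3, h4, h5⟩ := h
  obtain ⟨q, q0, q1, q2, q3, q4, q5⟩ := x.const_isEvaluation 1
  refine ⟨x.const, x.const_isEvaluation 0, e.toLinearMap ∘ₗ q, ?_, ?_, ?_, ?_, ?_, ?_⟩
  · exact e.surjective.denseRange.comp q0
      (AddMonoidHomClass.isometry_of_norm e fun u => by
        rw [CStarModule.norm_eq_sqrt_norm_inner_self (A := ℂ), h1,
          ← CStarModule.norm_eq_sqrt_norm_inner_self (A := ℂ)]).continuous
  · intro u v; exact (h1 _ _).trans (q1 u v)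
  · intro u; exact (congrArg e (q2 u)).trans (h2 _)
  · intro g u; exact (congrArg e (q3 g u)).trans (h3 _ _)
  · intro g u; exact (congrArg e (q4 g u)).trans (h4 _ _)
  · intro u; exact (congrArg e (q5 u)).trans (h5 _)

lemma KasparovCycle.IsEvaluation.sum {t : I} {W W' : KasparovCycle α C(I, ℂ)}
    {x x' : KasparovCycle α ℂ} (h : W.IsEvaluation t x) (h' : W'.IsEvaluation t x') :
    (W.sum W').IsEvaluation t (x.sum x') := by
  obtain ⟨q, q0, q1, q2, q3, q4, q5⟩ := h
  obtain ⟨r, r0, r1, r2, r3, r4, r5⟩ := h'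
  refine ⟨(sumEquiv ℂ x.E x'.E).symm.toLinearMap ∘ₗ (q.prodMap r) ∘ₗ
    (sumEquiv C(I, ℂ) W.E W'.E).toLinearMap, ?_, ?_, ?_, ?_, ?_, ?_⟩
  · have h1 : DenseRange (Prod.map q r) := q0.prodMap r0
    have h2 := (sumEquiv ℂ x.E x'.E).symm.surjective.denseRange.comp h1
      (sumEquiv ℂ x.E x'.E).symm.continuous
    intro v
    obtain h := h2 v
    rwa [← (sumEquiv C(I, ℂ) W.E W'.E).surjective.range_comp] at h
  · intro u v
    refine (WithCStarModule.prod_inner _ _).trans (Eq.trans ?_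
      (DFunLike.congr_fun (WithCStarModule.prod_inner (A := C(I, ℂ)) (E := W.E) (F := W'.E)
        u v) t).symm)
    exact congrArg₂ (· + ·) (q1 _ _) (r1 _ _)
  · intro u; exact sum_ext (B := ℂ) (q2 _) (r2 _)
  · intro g u; exact sum_ext (B := ℂ) (q3 _ _) (r3 _ _)
  · intro g u; exact sum_ext (B := ℂ) (q4 _ _) (r4 _ _)
  · intro u; exact sum_ext (B := ℂ) (q5 _) (r5 _)

lemma KasparovCycle.IsEvaluation.neg {t : I} {W : KasparovCycle α C(I, ℂ)}
    {x : KasparovCycle α ℂ} (h : W.IsEvaluation t x) : W.neg.IsEvaluation t x.neg := by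
  obtain ⟨q, q0, q1, q2, q3, q4, q5⟩ := h
  refine ⟨q, q0, q1, ?_, q3, q4, ?_⟩
  · intro u; exact (map_neg q _).trans (congrArg Neg.neg (q2 u))
  · intro u; exact (map_neg q _).trans (congrArg Neg.neg (q5 u))

lemma KasparovCycle.Homotopic.sum {x x' y y' : KasparovCycle α ℂ} (h : x.Homotopic x')
    (h' : y.Homotopic y') : (x.sum y).Homotopic (x'.sum y') := by
  obtain ⟨W, h0, h1⟩ := h
  obtain ⟨W', h0', h1'⟩ := h'
  exact ⟨W.sum W', h0.sum h0', h1.sum h1'⟩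

lemma KasparovCycle.Homotopic.neg {x x' : KasparovCycle α ℂ} (h : x.Homotopic x') :
    x.neg.Homotopic x'.neg := by
  obtain ⟨W, h0, h1⟩ := h
  exact ⟨W.neg, h0.neg, h1.neg⟩

lemma KasparovCycle.Homotopic.refl (x : KasparovCycle α ℂ) : x.Homotopic x :=
  ⟨x.const, x.const_isEvaluation 0, x.const_isEvaluation 1⟩

lemma sum_comm_equiv (x y : KasparovCycle α B) : (x.sum y).UnitaryEquiv (y.sum x) := by
  refine ⟨(sumEquiv B x.E y.E).toLinearEquiv.trans ((LinearEquiv.prodComm ℂ x.E y.E).trans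
    (sumEquiv B y.E x.E).symm.toLinearEquiv), fun u v => ?_, fun u => rfl, fun g u => rfl,
    fun a u => rfl, fun u => rfl⟩
  exact (WithCStarModule.prod_inner _ _).trans ((add_comm _ _).trans
    (WithCStarModule.prod_inner _ _).symm)

lemma sum_zero_equiv (x : KasparovCycle α B) :
    (x.sum (KasparovCycle.zero α B)).UnitaryEquiv x := by
  refine ⟨(sumEquiv B x.E _).toLinearEquiv.trans
    { toFun := fun z => z.1
      invFun := fun u => (u, PUnit.unit)
      left_inv := fun z => rfl
      right_inv := fun z => rfl
      map_add' := fun _ _ => rfl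
      map_smul' := fun _ _ => rfl }, fun u v => ?_, fun u => rfl, fun g u => rfl,
    fun a u => rfl, fun u => rfl⟩
  exact ((WithCStarModule.prod_inner _ _).trans (add_zero _)).symm

lemma sum_assoc_equiv (x y z : KasparovCycle α B) :
    ((x.sum y).sum z).UnitaryEquiv (x.sum (y.sum z)) := by
  refine ⟨
    { toFun := fun w => (sumEquiv B x.E (WithCStarModule B (y.E × z.E))).symm
        (w.1.1, (sumEquiv B y.E z.E).symm (w.1.2, w.2))
      invFun := fun w => (sumEquiv B (WithCStarModule B (x.E × y.E)) z.E).symm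
        ((sumEquiv B x.E y.E).symm (w.1, w.2.1), w.2.2)
      left_inv := fun z => rfl
      right_inv := fun z => rfl
      map_add' := fun _ _ => rfl
      map_smul' := fun _ _ => rfl }, fun u v => ?_, fun u => rfl, fun g u => rfl,
    fun a u => rfl, fun u => rfl⟩
  have e1 := WithCStarModule.prod_inner (A := B) (E := WithCStarModule B (x.E × y.E)) (F := z.E) u v
  have e2 := WithCStarModule.prod_inner (A := B) (E := x.E) (F := y.E) u.1 v.1
  refine (WithCStarModule.prod_inner _ _).trans (Eq.trans ?_ e1.symm)
  refine Eq.trans ?_ (congrArg (· + inner B u.2 v.2) e2.symm)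
  exact (congrArg (inner B u.1.1 v.1.1 + ·) (WithCStarModule.prod_inner _ _)).trans
    (add_assoc _ _ _).symm

section Inverse

lemma continuous_of_eq_zero {Y Z : Type*} [TopologicalSpace Y] [TopologicalSpace Z] [Zero Z]
    {f : Y → Z} (h : ∀ y, f y = 0) : Continuous f := by
  rw [funext h]
  exact continuous_const

variable (x : KasparovCycle α ℂ)

/-- The flip `(u, v) ↦ (v, u)` on the module of `x.sum x.neg`. -/
def flipOp : (x.sum x.neg).E →L[ℂ] (x.sum x.neg).E :=
  (sumEquiv ℂ x.E x.E).symm.toContinuousLinearMap ∘L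
    ((ContinuousLinearMap.snd ℂ x.E x.E).prod (ContinuousLinearMap.fst ℂ x.E x.E)) ∘L
      (sumEquiv ℂ x.E x.E).toContinuousLinearMap

lemma flipOp_flipOp (u : (x.sum x.neg).E) : flipOp x (flipOp x u) = u := rfl

lemma flipOp_inner (u v : (x.sum x.neg).E) :
    inner ℂ (flipOp x u) v = inner ℂ u (flipOp x v) := by
  have h1 := WithCStarModule.prod_inner (A := ℂ) (E := x.E) (F := x.E) (flipOp x u) v
  have h2 := WithCStarModule.prod_inner (A := ℂ) (E := x.E) (F := x.E) u (flipOp x v)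
  exact h1.trans ((add_comm _ _).trans h2.symm)

lemma flipOp_π (a : A) (u : (x.sum x.neg).E) :
    flipOp x ((x.sum x.neg).π a u) = (x.sum x.neg).π a (flipOp x u) := rfl

lemma flipOp_U (g : G) (u : (x.sum x.neg).E) :
    flipOp x ((x.sum x.neg).U g u) = (x.sum x.neg).U g (flipOp x u) := rfl

lemma flipOp_odd (u : (x.sum x.neg).E) :
    (x.sum x.neg).ε (flipOp x u) = -flipOp x ((x.sum x.neg).ε u) :=
  sum_ext (B := ℂ) (neg_neg _).symm rfl

lemma flipOp_F (u : (x.sum x.neg).E) :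
    (x.sum x.neg).F (flipOp x u) + flipOp x ((x.sum x.neg).F u) = 0 :=
  sum_ext (B := ℂ) (add_neg_cancel _) (neg_add_cancel _)

lemma GradedBimodule.U_inv (X : GradedBimodule α B) (g : G) (u : X.E) :
    X.U g (X.U g⁻¹ u) = u := by
  have : X.U g * X.U g⁻¹ = 1 := by rw [← map_mul, mul_inv_cancel, map_one]
  exact DFunLike.congr_fun this u

lemma flipOp_conj (g : G) (u : (x.sum x.neg).E) :
    (x.sum x.neg).U g (flipOp x ((x.sum x.neg).U g⁻¹ u)) = flipOp x u :=
  (flipOp_U x g _).symm.trans (congrArg (flipOp x) ((x.sum x.neg).U_inv g u))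

/-- The degenerate cycle with operator `flipOp x`. -/
def flipCycle : KasparovCycle α ℂ where
  toGradedBimodule := (x.sum x.neg).toGradedBimodule
  F := flipOp x
  Fadj := flipOp x
  F_inner := flipOp_inner x
  F_odd := flipOp_odd x
  F_comm a := mem_compactOps_of_eq_zero fun u => sub_eq_zero.2 (flipOp_π x a u)
  F_sq a := mem_compactOps_of_eq_zero fun u =>
    (congrArg ((x.sum x.neg).π a) (sub_eq_zero.2 (flipOp_flipOp x u))).trans (map_zero _)
  F_selfAdj a := mem_compactOps_of_eq_zero fun u =>
    (congrArg ((x.sum x.neg).π a) (sub_eq_zero.2 rfl)).trans (map_zero _)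
  F_equivariant a g := mem_compactOps_of_eq_zero fun u =>
    (congrArg ((x.sum x.neg).π a) (sub_eq_zero.2 (flipOp_conj x g u))).trans (map_zero _)
  F_continuous a := continuous_of_eq_zero fun g => ContinuousLinearMap.ext fun u =>
    (congrArg ((x.sum x.neg).π a) (sub_eq_zero.2 (flipOp_conj x g u))).trans (map_zero _)

/-- The homotopy from the zero cycle to `flipCycle x`. -/
def flipNull : KasparovCycle α C(I, ℂ) where
  toGradedBimodule := (x.sum x.neg).toGradedBimodule.path True
  F := constOp True (flipOp x)
  Fadj := constOp True (flipOp x)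
  F_inner f g := ContinuousMap.ext fun t => flipOp_inner x _ _
  F_odd f := PathSpace.ext fun t => flipOp_odd x _
  F_comm a := mem_compactOps_of_eq_zero fun f =>
    sub_eq_zero.2 (PathSpace.ext fun t => flipOp_π x a _)
  F_sq a := mem_compactOps_of_eq_zero fun f =>
    PathSpace.ext fun t => (congrArg ((x.sum x.neg).π a)
      (sub_eq_zero.2 (flipOp_flipOp x _))).trans (map_zero _)
  F_selfAdj a := mem_compactOps_of_eq_zero fun f =>
    PathSpace.ext fun t => (congrArg ((x.sum x.neg).π a) (sub_eq_zero.2 rfl)).trans (map_zero _)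
  F_equivariant a g := mem_compactOps_of_eq_zero fun f =>
    PathSpace.ext fun t => (congrArg ((x.sum x.neg).π a)
      (sub_eq_zero.2 (flipOp_conj x g _))).trans (map_zero _)
  F_continuous a := continuous_of_eq_zero fun g => ContinuousLinearMap.ext fun f =>
    PathSpace.ext fun t => (congrArg ((x.sum x.neg).π a)
      (sub_eq_zero.2 (flipOp_conj x g _))).trans (map_zero _)

lemma flipCycle_null : (KasparovCycle.zero α ℂ).Homotopic (flipCycle x) := by
  refine ⟨flipNull x, ⟨0, ?_, fun f g => ?_, fun _ => rfl, fun _ _ => rfl, fun _ _ => rfl,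
      fun _ => rfl⟩,
    ⟨{ toFun := fun f : PathSpace (x.sum x.neg).E True => f 1
       map_add' := fun f g => rfl
       map_smul' := fun c f => rfl }, ?_,
      fun u v => rfl, fun u => rfl, fun g u => rfl, fun a u => rfl, fun u => rfl⟩⟩
  · exact Function.Surjective.denseRange fun u => ⟨0, rfl⟩
  · have hf : PathSpace.toMap (H := (x.sum x.neg).E) (b := True) f 0 = 0 :=
      PathSpace.map_zero (H := (x.sum x.neg).E) (b := True) f trivial
    change (0 : ℂ) = inner ℂ (PathSpace.toMap (H := (x.sum x.neg).E) (b := True) f 0)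
      (PathSpace.toMap (H := (x.sum x.neg).E) (b := True) g 0)
    rw [hf]
    exact (inner_zero_left' _).symm
  · refine Function.Surjective.denseRange fun u => ⟨PathSpace.mk (fun t => scal (t : ℂ) u)
      (scal_continuous ⟨fun t : I => ((t : ℝ) : ℂ), by fun_prop⟩ u) fun _ => ?_, ?_⟩
    · exact (congrArg (fun c => scal c u) Complex.ofReal_zero).trans (scal_zero u)
    · exact (congrArg (fun c => scal c u) Complex.ofReal_one).trans (scal_one u)

/-- The path `t ↦ cos (π t / 2)`. -/
def cosPath : C(I, ℂ) := ⟨fun t => ((Real.cos (Real.pi / 2 * t) : ℝ) : ℂ), by fun_prop⟩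

/-- The path `t ↦ sin (π t / 2)`. -/
def sinPath : C(I, ℂ) := ⟨fun t => ((Real.sin (Real.pi / 2 * t) : ℝ) : ℂ), by fun_prop⟩

lemma cos_sin_path (t : I) : cosPath t * cosPath t + sinPath t * sinPath t = 1 := by
  simp only [cosPath, sinPath, ContinuousMap.coe_mk]
  rw [← Complex.ofReal_mul, ← Complex.ofReal_mul, ← Complex.ofReal_add]
  norm_cast
  nlinarith [Real.cos_sq_add_sin_sq (Real.pi / 2 * t)]

/-- The homotopy from `x.sum x.neg` to `flipCycle x`. -/
def rotation : KasparovCycle α C(I, ℂ) where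
  toGradedBimodule := (x.sum x.neg).toGradedBimodule.path False
  F := rotOp cosPath sinPath (x.sum x.neg).F (flipOp x)
  Fadj := rotOp cosPath sinPath (x.sum x.neg).Fadj (flipOp x)
  F_inner f g := ContinuousMap.ext fun t =>
    rotOp_inner (fun t => Complex.conj_ofReal _) (fun t => Complex.conj_ofReal _)
      (x.sum x.neg).F_inner (flipOp_inner x) f g t
  F_odd f := rotOp_odd cosPath sinPath (x.sum x.neg).F_odd (flipOp_odd x) f
  F_comm a := by
    have h := pathOp_mem_compactOps cosPath ((x.sum x.neg).F_comm a)
    rw [← rotOp_comm cosPath sinPath (flipOp_π x a)] at h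
    exact h
  F_sq a := by
    have h := pathOp_mem_compactOps (cosPath * cosPath) ((x.sum x.neg).F_sq a)
    rw [← rotOp_sq cos_sin_path (flipOp_flipOp x) (flipOp_F x)] at h
    exact h
  F_selfAdj a := by
    have h := pathOp_mem_compactOps cosPath ((x.sum x.neg).F_selfAdj a)
    rw [← rotOp_sub cosPath sinPath _ _ (flipOp x)] at h
    exact h
  F_equivariant a g := by
    have h := pathOp_mem_compactOps cosPath ((x.sum x.neg).F_equivariant a g)
    rw [← rotOp_equivariant cosPath sinPath (flipOp_conj x g)] at h
    exact h
  F_continuous a := by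
    refine Continuous.congr ((pathOpLinear_continuous cosPath).comp
      ((x.sum x.neg).F_continuous a)) fun g => ?_
    exact (rotOp_equivariant cosPath sinPath (flipOp_conj x g)).symm

lemma cosPath_zero : cosPath 0 = 1 := by simp [cosPath]

lemma sinPath_zero : sinPath 0 = 0 := by simp [sinPath]

lemma cosPath_one : cosPath 1 = 0 := by simp [cosPath]

lemma sinPath_one : sinPath 1 = 1 := by simp [sinPath]

lemma sum_neg_homotopic : (x.sum x.neg).Homotopic (flipCycle x) := by
  refine ⟨rotation x,
    ⟨{ toFun := fun f : PathSpace (x.sum x.neg).E False => f 0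
       map_add' := fun f g => rfl
       map_smul' := fun c f => rfl }, ?_,
      fun u v => rfl, fun u => rfl, fun g u => rfl, fun a u => rfl, fun f => ?_⟩,
    ⟨{ toFun := fun f : PathSpace (x.sum x.neg).E False => f 1
       map_add' := fun f g => rfl
       map_smul' := fun c f => rfl }, ?_,
      fun u v => rfl, fun u => rfl, fun g u => rfl, fun a u => rfl, fun f => ?_⟩⟩
  · exact Function.Surjective.denseRange fun u =>
      ⟨PathSpace.mk (fun _ => u) continuous_const False.elim, rfl⟩
  · refine (rotOp_apply cosPath sinPath (x.sum x.neg).F (flipOp x) f 0).trans ?_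
    rw [cosPath_zero, sinPath_zero, scal_one, scal_zero, add_zero]
    rfl
  · exact Function.Surjective.denseRange fun u =>
      ⟨PathSpace.mk (fun _ => u) continuous_const False.elim, rfl⟩
  · refine (rotOp_apply cosPath sinPath (x.sum x.neg).F (flipOp x) f 1).trans ?_
    rw [cosPath_one, sinPath_one, scal_one, scal_zero, zero_add]
    rfl

end Inverse

lemma KK.sound {x y : KasparovCycle α ℂ} (h : x.Homotopic y) : KK.mk x = KK.mk y := Quot.sound h

instance : Add (KK α) :=
  ⟨Quot.map₂ KasparovCycle.sum (fun x _ _ h => (KasparovCycle.Homotopic.refl x).sum h)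
    (fun _ _ y h => h.sum (KasparovCycle.Homotopic.refl y))⟩

instance : Zero (KK α) := ⟨KK.mk (KasparovCycle.zero α ℂ)⟩

instance : Neg (KK α) := ⟨Quot.map KasparovCycle.neg fun _ _ h => h.neg⟩

lemma KK.mk_add (x y : KasparovCycle α ℂ) : KK.mk x + KK.mk y = KK.mk (x.sum y) := rfl

/-- `KK_G(A, ℂ)` is an abelian group under direct sum. -/
instance : AddCommGroup (KK α) where
  add_assoc := by
    rintro ⟨x⟩ ⟨y⟩ ⟨z⟩
    exact KK.sound (.of_unitaryEquiv (sum_assoc_equiv x y z))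
  add_comm := by
    rintro ⟨x⟩ ⟨y⟩
    exact KK.sound (.of_unitaryEquiv (sum_comm_equiv x y))
  add_zero := by
    rintro ⟨x⟩
    exact KK.sound (.of_unitaryEquiv (sum_zero_equiv x))
  zero_add := by
    rintro ⟨x⟩
    exact (KK.sound (.of_unitaryEquiv (sum_comm_equiv _ x))).trans
      (KK.sound (.of_unitaryEquiv (sum_zero_equiv x)))
  neg_add_cancel := by
    rintro ⟨x⟩
    exact (KK.sound (.of_unitaryEquiv (sum_comm_equiv _ x))).trans
      ((KK.sound (sum_neg_homotopic x)).trans (KK.sound (flipCycle_null x)).symm)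
  nsmul := nsmulRec
  zsmul := zsmulRec

/-- The circle `j : U(1) → G` acts with weight `n` on the cycle `x`. -/
def KasparovCycle.HasWeight (j : Circle →* G) (n : ℤ) (x : KasparovCycle α ℂ) : Prop :=
  ∀ z : Circle, x.U (j z) = ((z : ℂ) ^ n) • (1 : x.E →L[ℂ] x.E)

/-- The subgroup of `KK_G(A, ℂ)` generated by the cycles on which the circle `j` acts with
weight `n`. -/
def KKweight (α : CStarAction G A) (j : Circle →* G) (n : ℤ) : AddSubgroup (KK α) :=
  AddSubgroup.closure {ξ | ∃ x : KasparovCycle α ℂ, x.HasWeight j n ∧ KK.mk x = ξ}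

/-- The class of a cycle of weight `n`. -/
def KKweight.mk {j : Circle →* G} {n : ℤ} (x : KasparovCycle α ℂ) (hx : x.HasWeight j n) :
    KKweight α j n :=
  ⟨KK.mk x, AddSubgroup.subset_closure ⟨x, hx, rfl⟩⟩

/-- The representation `π` of the cycle is non-degenerate. -/
def KasparovCycle.IsNondegenerate (x : KasparovCycle α ℂ) : Prop :=
  Dense (Submodule.span ℂ {v : x.E | ∃ a u, v = x.π a u} : Set x.E)

end Cycles

/-- Restriction of an action along a continuous group homomorphism. -/
def CStarAction.comap {G G' A : Type*} [Group G] [TopologicalSpace G] [Group G']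
    [TopologicalSpace G'] [NonUnitalCStarAlgebra A] (α : CStarAction G A) (f : G' →* G)
    (hf : Continuous f) : CStarAction G' A where
  toAut := α.toAut.comp f
  continuous_apply a := (α.continuous_apply a).comp hf

section CrossedProducts

variable {G A : Type*} [Group G] [TopologicalSpace G] [NonUnitalCStarAlgebra A]

/-- A covariant representation of the `G`-algebra `A` on a Hilbert space. -/
structure CovariantRep (α : CStarAction G A) where
  H : Type
  [instNormed : NormedAddCommGroup H]
  [instInner : InnerProductSpace ℂ H]
  [instComplete : CompleteSpace H]
  rep : A →⋆ₙₐ[ℂ] (H →L[ℂ] H)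
  U : G →* unitary (H →L[ℂ] H)
  U_continuous : ∀ ξ : H, Continuous fun g => (U g : H →L[ℂ] H) ξ
  covariant : ∀ g a, (U g : H →L[ℂ] H) * rep a * star (U g : H →L[ℂ] H) = rep (α.toAut g a)

attribute [instance] CovariantRep.instNormed CovariantRep.instInner CovariantRep.instComplete

variable {α : CStarAction G A}

lemma CovariantRep.norm_U (ρ : CovariantRep α) (g : G) (ξ : ρ.H) :
    ‖(ρ.U g : ρ.H →L[ℂ] ρ.H) ξ‖ = ‖ξ‖ := by
  have h : inner ℂ ((ρ.U g : ρ.H →L[ℂ] ρ.H) ξ) ((ρ.U g : ρ.H →L[ℂ] ρ.H) ξ) = inner ℂ ξ ξ := by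
    rw [← ContinuousLinearMap.adjoint_inner_right, ← ContinuousLinearMap.star_eq_adjoint,
      ← mul_apply_eq_comp, Unitary.coe_star_mul_self]
    rfl
  rw [inner_self_eq_norm_sq_to_K, inner_self_eq_norm_sq_to_K] at h
  have h2 : ‖(ρ.U g : ρ.H →L[ℂ] ρ.H) ξ‖ ^ 2 = ‖ξ‖ ^ 2 := by exact_mod_cast h
  exact (pow_left_inj₀ (norm_nonneg _) (norm_nonneg _) two_ne_zero).1 h2

lemma CovariantRep.norm_rep_le (ρ : CovariantRep α) (a : A) (ξ : ρ.H) :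
    ‖ρ.rep a ξ‖ ≤ ‖a‖ * ‖ξ‖ :=
  ((ρ.rep a).le_opNorm ξ).trans (mul_le_mul_of_nonneg_right
    (NonUnitalStarAlgHom.norm_apply_le ρ.rep a) (norm_nonneg _))

variable [MeasurableSpace G] [BorelSpace G] (μ : Measure G)
  [IsFiniteMeasureOnCompacts μ]

lemma CovariantRep.integrand_continuous (ρ : CovariantRep α) (f : C_c(G, A)) (ξ : ρ.H) :
    Continuous fun g => ρ.rep (f g) ((ρ.U g : ρ.H →L[ℂ] ρ.H) ξ) := by
  have h : Continuous ρ.rep := AddMonoidHomClass.continuous_of_bound ρ.rep 1 fun a => by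
    rw [one_mul]
    exact NonUnitalStarAlgHom.norm_apply_le ρ.rep a
  exact (h.comp f.continuous).clm_apply (ρ.U_continuous ξ)

lemma CovariantRep.integrand_integrable (ρ : CovariantRep α) (f : C_c(G, A)) (ξ : ρ.H) :
    Integrable (fun g => ρ.rep (f g) ((ρ.U g : ρ.H →L[ℂ] ρ.H) ξ)) μ := by
  refine (ρ.integrand_continuous f ξ).integrable_of_hasCompactSupport ?_
  refine f.hasCompactSupport.mono fun g hg hf => hg ?_
  change ρ.rep (f g) _ = 0
  rw [hf, map_zero]
  rfl

lemma norm_integrable (f : C_c(G, A)) : Integrable (fun g => ‖f g‖) μ :=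
  (f.continuous.integrable_of_hasCompactSupport f.hasCompactSupport).norm

/-- The integrated form `ξ ↦ ∫ rep (f g) (U g ξ) dμ(g)` of a covariant representation. -/
def CovariantRep.integratedForm (ρ : CovariantRep α) (f : C_c(G, A)) : ρ.H →L[ℂ] ρ.H :=
  LinearMap.mkContinuous
    { toFun := fun ξ => ∫ g, ρ.rep (f g) ((ρ.U g : ρ.H →L[ℂ] ρ.H) ξ) ∂μ
      map_add' := fun ξ η => by
        simp only [map_add]
        exact integral_add (ρ.integrand_integrable μ f ξ) (ρ.integrand_integrable μ f η)
      map_smul' := fun c ξ => by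
        simp only [map_smul]
        exact integral_smul c _ }
    (∫ g, ‖f g‖ ∂μ) fun ξ => by
      refine (norm_integral_le_of_norm_le ((norm_integrable μ f).mul_const ‖ξ‖)
        (Filter.Eventually.of_forall fun g => ?_)).trans (integral_mul_const _ _).le
      exact (ρ.norm_rep_le _ _).trans_eq (by rw [ρ.norm_U])

variable (α) in
/-- The `C*`-algebra of bounded families of operators indexed by all covariant
representations. -/
abbrev UniversalAlgebra : Type _ := lp (fun ρ : CovariantRep α => ρ.H →L[ℂ] ρ.H) ∞

variable (α) in
/-- The image of `f ∈ C_c(G, A)` in the universal representation; its norm is the supremum of the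
norms of the integrated forms of `f`, i.e. the maximal crossed product norm. -/
def universalRep (f : C_c(G, A)) : UniversalAlgebra α :=
  ⟨fun ρ => ρ.integratedForm μ f, memℓp_infty ⟨∫ g, ‖f g‖ ∂μ, by
    rintro _ ⟨ρ, rfl⟩
    exact LinearMap.mkContinuous_norm_le _ (integral_nonneg fun g => norm_nonneg _) _⟩⟩

variable (α) in
/-- The maximal crossed product `G ⋉ A`, as an algebra of operators in the universal
representation. -/
def maximalCrossedProduct : NonUnitalStarSubalgebra ℂ (UniversalAlgebra α) :=
  (NonUnitalStarAlgebra.adjoin ℂ (Set.range (universalRep α μ))).topologicalClosure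

end CrossedProducts

section Extensions

/-- A `U(1)`-central extension `1 → U(1) → Γτ → Γ → 1` of topological groups. -/
structure CircleExtension (Γ Γτ : Type*) [Group Γ] [TopologicalSpace Γ] [Group Γτ]
    [TopologicalSpace Γτ] where
  incl : Circle →* Γτ
  proj : Γτ →* Γ
  isSES : TopologicalGroup.IsSES incl proj
  central : ∀ z g, incl z * g = g * incl z

variable {Γ Γτ S A : Type*} [Group Γ] [TopologicalSpace Γ] [Group Γτ] [TopologicalSpace Γτ]
  [Group S] [TopologicalSpace S] [NonUnitalCStarAlgebra A]

/-- A continuous lift to `Γτ` of the action `φ` of `S` on `Γ`, fixing the central circle, so that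
`S ⋉ Γτ` is a `U(1)`-central extension of `S ⋉ Γ`. -/
structure LiftedAction (φ : S →* MulAut Γ) (e : CircleExtension Γ Γτ) where
  act : S →* MulAut Γτ
  continuous : Continuous fun p : S × Γτ => act p.1 p.2
  proj_apply : ∀ s g, e.proj (act s g) = φ s (e.proj g)
  incl_apply : ∀ s z, act s (e.incl z) = e.incl z

/-- The semidirect product carries the product topology. -/
instance {N G : Type*} [Group N] [Group G] [TopologicalSpace N] [TopologicalSpace G]
    (φ : G →* MulAut N) : TopologicalSpace (N ⋊[φ] G) :=
  TopologicalSpace.induced SemidirectProduct.equivProd inferInstance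

lemma continuous_inl (φ : S →* MulAut Γ) :
    Continuous (SemidirectProduct.inl : Γ →* Γ ⋊[φ] S) :=
  continuous_induced_rng.2 (continuous_id.prodMk continuous_const)

variable {φ : S →* MulAut Γ} {e : CircleExtension Γ Γτ}

/-- The homomorphism `S ⋉ Γτ → S ⋉ Γ`. -/
def LiftedAction.projHom (ℓ : LiftedAction φ e) : Γτ ⋊[ℓ.act] S →* Γ ⋊[φ] S :=
  SemidirectProduct.map e.proj (MonoidHom.id S) fun s =>
    MonoidHom.ext fun g => ℓ.proj_apply s g

lemma LiftedAction.projHom_continuous (ℓ : LiftedAction φ e) : Continuous ℓ.projHom := by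
  have h : Continuous fun g : Γτ ⋊[ℓ.act] S => SemidirectProduct.equivProd g :=
    continuous_induced_dom
  refine continuous_induced_rng.2 ?_
  exact (e.isSES.isOpenQuotientMap.continuous.comp (continuous_fst.comp h)).prodMk
    (continuous_snd.comp h)

/-- The central circle of `S ⋉ Γτ`. -/
def LiftedAction.circle (ℓ : LiftedAction φ e) : Circle →* Γτ ⋊[ℓ.act] S :=
  SemidirectProduct.inl.comp e.incl

/-- An `S ⋉ Γ`-algebra as an `S ⋉ Γτ`-algebra. -/
abbrev LiftedAction.pullback (ℓ : LiftedAction φ e) (α : CStarAction (Γ ⋊[φ] S) A) :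
    CStarAction (Γτ ⋊[ℓ.act] S) A :=
  α.comap ℓ.projHom ℓ.projHom_continuous

/-- An `S ⋉ Γ`-algebra as a `Γ`-algebra. -/
abbrev CStarAction.restrict (α : CStarAction (Γ ⋊[φ] S) A) : CStarAction Γ A :=
  α.comap SemidirectProduct.inl (continuous_inl φ)

/-- A `Γ`-algebra as a `Γτ`-algebra. -/
abbrev CircleExtension.pullback (e : CircleExtension Γ Γτ) (α : CStarAction Γ A) :
    CStarAction Γτ A :=
  α.comap e.proj e.isSES.isOpenQuotientMap.continuous

/-- The condition `f (z⁻¹ γ) = zⁿ f γ` on functions on `Γτ`. -/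
def CircleExtension.IsHomogeneous (e : CircleExtension Γ Γτ) (n : ℤ) (f : Γτ → A) : Prop :=
  ∀ (z : Circle) (γ : Γτ), f (e.incl z⁻¹ * γ) = ((z : ℂ) ^ n) • f γ

variable (A) in
/-- The homogeneous functions of degree `1` in `C_c(Γτ, A)`. -/
def CircleExtension.Functions (e : CircleExtension Γ Γτ) : Type _ :=
  {f : C_c(Γτ, A) // e.IsHomogeneous 1 f}

/-- The action `(s · f) γ = s · f (s⁻¹ γ s)` of `S` on the homogeneous functions, the conjugation
being that of `S ⋉ Γτ`. -/
def LiftedAction.translate (ℓ : LiftedAction φ e) (α : CStarAction (Γ ⋊[φ] S) A) (s : S)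
    (f : e.Functions A) : e.Functions A :=
  ⟨{ toFun := fun γ => α.toAut (SemidirectProduct.inr s) (f.1 (ℓ.act s⁻¹ γ))
     continuous_toFun := by
      have h1 : Continuous fun γ => ℓ.act s⁻¹ γ :=
        ℓ.continuous.comp (continuous_const.prodMk continuous_id)
      have h2 : Continuous (α.toAut (SemidirectProduct.inr s)) :=
        AddMonoidHomClass.continuous_of_bound (α.toAut (SemidirectProduct.inr s)) 1 fun a => by
          rw [one_mul]
          exact NonUnitalStarAlgHom.norm_apply_le _ a
      exact h2.comp (f.1.continuous.comp h1)
     hasCompactSupport' := by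
      have h1 : ∀ s, Continuous fun γ => ℓ.act s γ := fun s =>
        ℓ.continuous.comp (continuous_const.prodMk continuous_id)
      let h : Γτ ≃ₜ Γτ :=
        { (ℓ.act s⁻¹).toEquiv with
          continuous_toFun := h1 s⁻¹
          continuous_invFun := by
            have h2 : ∀ γ, (ℓ.act s⁻¹).symm γ = ℓ.act s γ := fun γ => by
              rw [map_inv, MulAut.inv_def, MulEquiv.symm_symm]
            exact (h1 s).congr fun γ => (h2 γ).symm }
      exact (f.1.hasCompactSupport.comp_homeomorph h).comp_left (map_zero _) },
    fun z γ => by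
      change α.toAut _ (f.1 (ℓ.act s⁻¹ (e.incl z⁻¹ * γ))) = _ • α.toAut _ (f.1 (ℓ.act s⁻¹ γ))
      rw [map_mul, ℓ.incl_apply, f.2, map_smul]⟩

variable [MeasurableSpace Γτ] [BorelSpace Γτ] (μ : Measure Γτ) [IsFiniteMeasureOnCompacts μ]

/-- The twisted crossed product `Γ ⋉_τ A`: the closure, in the maximal crossed product `Γτ ⋉ A`,
of the homogeneous functions of degree `1`. (These already form a `*`-algebra under convolution,
so that `adjoin` adds nothing.) -/
def twistedSubalgebra (e : CircleExtension Γ Γτ) (α : CStarAction Γ A) :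
    NonUnitalStarSubalgebra ℂ (UniversalAlgebra (e.pullback α)) :=
  (NonUnitalStarAlgebra.adjoin ℂ
    {b | ∃ f : e.Functions A, b = universalRep (e.pullback α) μ f.1}).topologicalClosure

lemma twistedSubalgebra_le (e : CircleExtension Γ Γτ) (α : CStarAction Γ A) :
    twistedSubalgebra μ e α ≤ maximalCrossedProduct (e.pullback α) μ := by
  refine NonUnitalStarSubalgebra.topologicalClosure_mono (NonUnitalStarAlgebra.adjoin_mono ?_)
  rintro _ ⟨f, rfl⟩
  exact ⟨f.1, rfl⟩

/-- The twisted crossed product as a `C*`-algebra. -/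
def TwistedCrossedProduct (e : CircleExtension Γ Γτ) (α : CStarAction Γ A) : Type _ :=
  twistedSubalgebra μ e α

instance (e : CircleExtension Γ Γτ) (α : CStarAction Γ A) :
    NonUnitalCStarAlgebra (TwistedCrossedProduct μ e α) :=
  NonUnitalStarSubalgebra.nonUnitalCStarAlgebra (twistedSubalgebra μ e α)
    (h_closed := NonUnitalStarSubalgebra.isClosed_topologicalClosure _)

/-- The element of the twisted crossed product given by a homogeneous function. -/
def TwistedCrossedProduct.of (e : CircleExtension Γ Γτ) (α : CStarAction Γ A)
    (f : e.Functions A) : TwistedCrossedProduct μ e α :=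
  ⟨universalRep (e.pullback α) μ f.1, NonUnitalStarSubalgebra.le_topologicalClosure _
    (NonUnitalStarAlgebra.subset_adjoin ℂ _ ⟨f, rfl⟩)⟩

/-- The cycle `x = (H, π_A, F, π_{S ⋉ Γτ})` and the cycle `y = (H, π, F, π_S)` correspond to each
other (up to unitary equivalence): `π` is the integrated form of the covariant pair formed by `π_A`
and the restriction of `π_{S ⋉ Γτ}` to `Γτ`, and `π_S` is the restriction of `π_{S ⋉ Γτ}`
to `S`. -/
def Corresponds (ℓ : LiftedAction φ e) (α : CStarAction (Γ ⋊[φ] S) A)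
    {β : CStarAction S (TwistedCrossedProduct μ e α.restrict)}
    (x : KasparovCycle (ℓ.pullback α) ℂ) (y : KasparovCycle β ℂ) : Prop :=
  ∃ w : x.E ≃ₗ[ℂ] y.E,
    (∀ u v, inner ℂ (w u) (w v) = inner ℂ u v) ∧
    (∀ u, w (x.ε u) = y.ε (w u)) ∧
    (∀ u, w (x.F u) = y.F (w u)) ∧
    (∀ (s : S) u, w (x.U (SemidirectProduct.inr s) u) = y.U s (w u)) ∧
    (∀ (f : e.Functions A) u,
      w (∫ γ, x.π (f.1 γ) (x.U (SemidirectProduct.inl γ) u) ∂μ) =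
        y.π (TwistedCrossedProduct.of μ e α.restrict f) (w u))

end Extensions

end GreenJulg

end

open GreenJulg

/-! A representation of `Γ ⋉_τ A` that is non-degenerate is the same thing as a covariant pair of
`A` and `Γτ` in which `A` acts non-degenerately and the circle acts with weight one. The theorem
holds because this dictionary respects the `S`-action, the conditions on `F` and homotopies, and
because every cycle is homotopic to a non-degenerate one.

Since `Γ` is discrete, the central circle is compact and open in `Γτ`, and a homogeneous function is
a finite sum of functions supported on one coset of the circle. So the elements `delta γ a` span a
dense subspace of `Γ ⋉_τ A` (`dense_span_deltaSet`). They satisfy `δ_γ(a) δ_γ'(b) = δ_{γγ'}(a γ(b))`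
and `δ_{zγ}(a) = z δ_γ(a)`, and `s ∈ S` sends `δ_γ(a)` to `δ_{sγ}(s a)`. Precomposition with `s`
permutes the covariant representations, which gives the action of `S` on the maximal completion
(`twistedAction`).

Integration sends `δ_γ(a)` to `π(a) U(γ) P`, where `P` is the projection onto the vectors of weight
one. It is defined for cycles of every weight, so it applies to homotopies without any condition on
the weight of the path. The commutator `[F, π(a) U(γ) P]` is compact since `π(a) [F, U(γ)]` is the
equivariance defect of `F`, up to sign and a unitary factor, and since `π(a) [F, P]` is a norm
integral of such terms (`KasparovCycle.deltaOp_comm_mem`). The norm on `Γ ⋉_τ A` is a supremum over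
Hilbert spaces, whereas a homotopy is a Hilbert `C([0,1])`-module; the gap is bridged by localizing
the module at the characters of the coefficient algebra (`GradedBimodule.exists_represents`).

Conversely, on a non-degenerate module `U(γ)` is recovered as the strong limit of `π(δ_γ(u_N))`
along an approximate unit `u_N` of `A` (`GradedBimodule.NonDegenerate.exists_implements`). Its
failure to commute with `F` is expressed through commutators of `F` with `π(δ_γ(a))` and through the
`S`-equivariance defect (`KasparovCycle.dis_equivariant_eq`).

It remains to make cycles non-degenerate in a way that also works for homotopies, where the
essential submodule need not be complemented. Instead of a projection one takes `F' = ∑ d_n F d_n`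
on the essential submodule, with self-adjoint `d_n`, `∑ d_n² = 1` strictly and `∑ ‖d_n b‖ < ∞` for a
dense set of `b` (`exists_strictPartition`). Then `F' π(cd)` and `π(cd) F'` agree with `π(c) F π(d)`
up to compact operators (`compress_mul_sub_mem`, `mul_compress_sub_mem`), and this yields all cycle
conditions for `F'`. The sum is compatible with evaluation, so homotopies go to homotopies. Over `ℂ`
a projection does exist and connects a cycle with its compression (`KasparovCycle.homotopic_ndeg`).

Consequently "compress, then disintegrate" is well defined on `KK`-classes. It is a left inverse of
integration on classes of weight one (`disMap_intHom`), and integration is onto because a cycle over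
`Γ ⋉_τ A` is homotopic to its compression, which is an integrated form. -/

noncomputable section

namespace GreenJulg

/-! ### Adjointable and compact operators on Hilbert modules over a commutative algebra. -/

section HilbertModuleOperators

variable {B E E' : Type*} [CommCStarAlgebra B] [PartialOrder B] [StarOrderedRing B]
  [NormedAddCommGroup E] [NormedSpace ℂ E] [SMul B E] [CStarModule B E]
  [NormedAddCommGroup E'] [NormedSpace ℂ E'] [SMul B E'] [CStarModule B E']

variable (B) in
/-- `T'` is an adjoint of the operator `T` between Hilbert `B`-modules. -/
def IsAdjoint (T : E → E') (T' : E' → E) : Prop := ∀ x y, inner B (T x) y = inner B x (T' y)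

lemma IsAdjoint.symm {T : E → E'} {T' : E' → E} (h : IsAdjoint B T T') : IsAdjoint B T' T :=
  fun x y => by rw [← CStarModule.star_inner, ← h, CStarModule.star_inner]

/-- Moving `T` to the other side of the inner product takes it off `b • x`, and inner products
separate vectors. Hence adjointability already forces `B`-linearity. -/
lemma IsAdjoint.map_bsmul {T : E → E'} {T' : E' → E} (h : IsAdjoint B T T') (b : B) (x : E) :
    T (b • x) = b • T x :=
  ext_inner (B := B) fun z => by
    rw [← h.symm, CStarModule.inner_op_smul_right, CStarModule.inner_op_smul_right, h.symm]

variable (B) in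
lemma norm_sq_inner (x : E) : ‖x‖ ^ 2 = ‖inner B x x‖ := CStarModule.norm_sq_eq B

lemma norm_bsmul_le (b : B) (x : E) : ‖b • x‖ ≤ ‖b‖ * ‖x‖ := by
  refine le_of_sq_le_sq ?_ (by positivity)
  rw [norm_sq_inner B, CStarModule.inner_op_smul_right, CStarModule.inner_op_smul_left, mul_pow,
    norm_sq_inner B x]
  calc _ ≤ ‖b‖ * (‖inner B x x‖ * ‖star b‖) :=
        (norm_mul_le _ _).trans (mul_le_mul_of_nonneg_left (norm_mul_le _ _) (norm_nonneg _))
    _ = _ := by rw [norm_star]; ring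

/-- The instance `SMul B E` carries no module axioms, so additivity has to be read off from inner
products. -/
lemma bsmul_add (b : B) (x y : E) : b • (x + y) = b • x + b • y :=
  ext_inner (B := B) fun z => by simp [mul_add]

lemma bsmul_smul (b : B) (c : ℂ) (x : E) : b • c • x = c • b • x :=
  ext_inner (B := B) fun z => by simp

/-- Multiplication by `b` as a bounded operator. -/
def bsmulCLM (E : Type*) [NormedAddCommGroup E] [NormedSpace ℂ E] [SMul B E] [CStarModule B E]
    (b : B) : E →L[ℂ] E :=
  LinearMap.mkContinuous
    { toFun := fun x => b • x
      map_add' := bsmul_add b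
      map_smul' := fun c x => bsmul_smul b c x } ‖b‖ (norm_bsmul_le b)

lemma bsmulCLM_apply (b : B) (x : E) : bsmulCLM E b x = b • x := rfl

variable (B) in
lemma norm_le_of_inner_le {x : E} {C : ℝ} (hC : 0 ≤ C)
    (h : ∀ y : E, ‖inner B y x‖ ≤ C * ‖y‖) : ‖x‖ ≤ C := by
  have h1 := h x
  rw [← norm_sq_inner B, sq] at h1
  rcases (norm_nonneg x).eq_or_lt with h0 | h0
  · rw [← h0]; exact hC
  · exact le_of_mul_le_mul_right h1 h0

/-- An adjointable operator is bounded with the same bound as its adjoint. -/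
lemma IsAdjoint.norm_le {T : E → E'} {T' : E' → E} (h : IsAdjoint B T T') {C : ℝ} (hC : 0 ≤ C)
    (hT : ∀ x, ‖T x‖ ≤ C * ‖x‖) (y : E') : ‖T' y‖ ≤ C * ‖y‖ := by
  refine norm_le_of_inner_le B (by positivity) fun x => ?_
  rw [← h]
  calc _ ≤ ‖T x‖ * ‖y‖ := CStarModule.norm_inner_le _
    _ ≤ C * ‖x‖ * ‖y‖ := mul_le_mul_of_nonneg_right (hT x) (norm_nonneg _)
    _ = _ := by ring

/-- The rank one operator `z ↦ x ⟨y, z⟩`. -/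
def rankOne (B : Type*) {E : Type*} [CommCStarAlgebra B] [PartialOrder B] [StarOrderedRing B]
    [NormedAddCommGroup E] [NormedSpace ℂ E] [SMul B E] [CStarModule B E] (x y : E) : E →L[ℂ] E :=
  LinearMap.mkContinuous
    { toFun := fun z => inner B y z • x
      map_add' := fun z w => ext_inner (B := B) fun v => by simp [add_mul]
      map_smul' := fun c z => ext_inner (B := B) fun v => by simp }
    (‖x‖ * ‖y‖) fun z => by
      refine (norm_bsmul_le _ _).trans ?_
      calc _ ≤ ‖y‖ * ‖z‖ * ‖x‖ :=
            mul_le_mul_of_nonneg_right (CStarModule.norm_inner_le _) (norm_nonneg _)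
        _ = _ := by ring

lemma rankOne_apply (x y z : E) : rankOne B x y z = inner B y z • x := rfl

lemma norm_rankOne_le (x y : E) : ‖rankOne B x y‖ ≤ ‖x‖ * ‖y‖ :=
  LinearMap.mkContinuous_norm_le _ (by positivity) _

lemma rankOne_sub_left (x x' y : E) : rankOne B x y - rankOne B x' y = rankOne B (x - x') y :=
  ContinuousLinearMap.ext fun z => ext_inner (B := B) fun v => by
    simp [rankOne_apply, mul_sub]

lemma rankOne_sub_right (x y y' : E) : rankOne B x y - rankOne B x y' = rankOne B x (y - y') :=
  ContinuousLinearMap.ext fun z => ext_inner (B := B) fun v => by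
    simp [rankOne_apply, sub_mul]

lemma continuous_rankOne_left (y : E) : Continuous fun x : E => rankOne B x y := by
  refine (LipschitzWith.of_dist_le_mul (K := ‖y‖₊) fun x x' => ?_).continuous
  rw [dist_eq_norm, dist_eq_norm, rankOne_sub_left, mul_comm]
  exact norm_rankOne_le _ _

lemma continuous_rankOne_right (x : E) : Continuous fun y : E => rankOne B x y := by
  refine (LipschitzWith.of_dist_le_mul (K := ‖x‖₊) fun y y' => ?_).continuous
  rw [dist_eq_norm, dist_eq_norm, rankOne_sub_right]
  exact norm_rankOne_le _ _

/-- Sandwiching turns the rank one operator `x ⟨y, ·⟩` into `j x ⟨i' y, ·⟩`. Only `i` needs an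
adjoint; for `j` it suffices that it is `B`-linear, which matters for maps into submodules that are
not complemented. -/
lemma comp_mem_compactOps {j : E →L[ℂ] E'} {i : E' →L[ℂ] E} {i' : E → E'}
    (hj : ∀ (b : B) x, j (b • x) = b • j x) (hi : IsAdjoint B i i') {T : E →L[ℂ] E}
    (hT : T ∈ compactOps B E) : j ∘L T ∘L i ∈ compactOps B E' := by
  let L : (E →L[ℂ] E) →ₗ[ℂ] (E' →L[ℂ] E') :=
    { toFun := fun T => j ∘L T ∘L i
      map_add' := fun S T => by ext z; simp
      map_smul' := fun c T => by ext z; simp }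
  have hL : Continuous L := by
    change Continuous fun T => j ∘L T ∘L i
    fun_prop
  refine map_mem_compactOps (B := B) (B' := B) L hL ?_ hT
  rintro S ⟨x, y, hS⟩
  refine ⟨j x, i' y, fun z => ?_⟩
  change j (S (i z)) = _
  rw [hS, hj, hi.symm]

lemma mul_mem_compactOps_left {T : E →L[ℂ] E} {T' : E → E} (h : IsAdjoint B T T')
    {K : E →L[ℂ] E} (hK : K ∈ compactOps B E) : T * K ∈ compactOps B E :=
  comp_mem_compactOps (j := T) (i := 1) (i' := id) h.map_bsmul (fun _ _ => rfl) hK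

lemma mul_mem_compactOps_right {T : E →L[ℂ] E} {T' : E → E} (h : IsAdjoint B T T')
    {K : E →L[ℂ] E} (hK : K ∈ compactOps B E) : K * T ∈ compactOps B E :=
  comp_mem_compactOps (j := 1) (i := T) (fun _ _ => rfl) h hK

lemma isClosed_compactOps : IsClosed (compactOps B E : Set (E →L[ℂ] E)) :=
  Submodule.isClosed_topologicalClosure _

/-- The parameters for which a uniformly Lipschitz family of functions is continuous form a closed
set. -/
lemma isClosed_setOf_continuous {X Y Z : Type*} [PseudoMetricSpace X] [PseudoMetricSpace Y]
    [TopologicalSpace Z] (f : X → Z → Y) (C : ℝ) (hf : ∀ x x' z, dist (f x z) (f x' z) ≤ C * dist x x') :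
    IsClosed {x | Continuous (f x)} := by
  refine isClosed_of_closure_subset fun x hx => ?_
  refine continuous_of_uniform_approx_of_continuous fun u hu => ?_
  obtain ⟨ε, hε, hu⟩ := Metric.mem_uniformity_dist.1 hu
  -- The denominator `|C| + 1` avoids division by zero and any assumption on the sign of `C`.
  obtain ⟨x', hx', h⟩ := Metric.mem_closure_iff.1 hx (ε / (|C| + 1)) (by positivity)
  refine ⟨f x', hx', fun z => hu ?_⟩
  calc _ ≤ C * dist x x' := hf _ _ _
    _ ≤ |C| * dist x x' := mul_le_mul_of_nonneg_right (le_abs_self _) dist_nonneg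
    _ ≤ (|C| + 1) * dist x x' := mul_le_mul_of_nonneg_right (by linarith) dist_nonneg
    _ < (|C| + 1) * (ε / (|C| + 1)) := mul_lt_mul_of_pos_left h (by positivity)
    _ = ε := by field_simp

variable {Z : Type*} [TopologicalSpace Z]

/-- The property cuts out a closed subspace that contains the rank one operators. -/
lemma compactOps_induction {p : (E →L[ℂ] E) → Prop} (hp : IsClosed {K | p K}) (h0 : p 0)
    (hadd : ∀ S T, p S → p T → p (S + T)) (hsmul : ∀ (c : ℂ) T, p T → p (c • T))
    (hr : ∀ x y, p (rankOne B x y)) {K : E →L[ℂ] E} (hK : K ∈ compactOps B E) : p K := by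
  let P : Submodule ℂ (E →L[ℂ] E) :=
    { carrier := {K | p K}
      add_mem' := fun hS hT => hadd _ _ hS hT
      zero_mem' := h0
      smul_mem' := fun c T hT => hsmul c T hT }
  have : compactOps B E ≤ P := by
    refine Submodule.topologicalClosure_minimal _ (Submodule.span_le.2 ?_) hp
    rintro S ⟨x, y, hS⟩
    have : S = rankOne B x y := ContinuousLinearMap.ext hS
    rw [this]
    exact hr x y
  exact this hK

/-- A compact factor upgrades strong continuity to norm continuity: on rank ones, `x ⟨y, ·⟩ V_z = x
⟨V_z* y, ·⟩` depends on `z` only through the vector `V_z* y`. With the compact factor on the left it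
is therefore the adjoints that must be strongly continuous. -/
lemma continuous_compact_mul {V V' : Z → E →L[ℂ] E} {C : ℝ} (hC : ∀ z, ‖V z‖ ≤ C)
    (hV : ∀ z, IsAdjoint B (V z) (V' z)) (hV' : ∀ v, Continuous fun z => V' z v) {K : E →L[ℂ] E}
    (hK : K ∈ compactOps B E) : Continuous fun z => K * V z := by
  refine compactOps_induction (B := B) (p := fun K => Continuous fun z => K * V z) ?_ ?_ ?_ ?_ ?_ hK
  · refine isClosed_setOf_continuous (fun (K : E →L[ℂ] E) z => K * V z) C fun S T z => ?_
    rw [dist_eq_norm, dist_eq_norm, ← sub_mul, mul_comm]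
    exact (norm_mul_le _ _).trans (mul_le_mul_of_nonneg_left (hC z) (norm_nonneg _))
  · simpa using continuous_const
  · intro S T hS hT
    simp only [add_mul]
    exact hS.add hT
  · intro c T hT
    simp only [smul_mul_assoc]
    exact hT.const_smul c
  · intro x y
    refine ((continuous_rankOne_right (B := B) x).comp (hV' y)).congr fun z => ?_
    refine ContinuousLinearMap.ext fun v => ?_
    change inner B (V' z y) v • x = inner B y (V z v) • x
    rw [(hV z).symm]

/-- Here `V_z x ⟨y, ·⟩` depends on `z` only through the vector `V_z x`. -/
lemma continuous_mul_compact {V V' : Z → E →L[ℂ] E} {C : ℝ} (hC : ∀ z, ‖V z‖ ≤ C)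
    (hV : ∀ z, IsAdjoint B (V z) (V' z)) (hVc : ∀ v, Continuous fun z => V z v) {K : E →L[ℂ] E}
    (hK : K ∈ compactOps B E) : Continuous fun z => V z * K := by
  refine compactOps_induction (B := B) (p := fun K => Continuous fun z => V z * K) ?_ ?_ ?_ ?_ ?_ hK
  · refine isClosed_setOf_continuous (fun (K : E →L[ℂ] E) z => V z * K) C fun S T z => ?_
    rw [dist_eq_norm, dist_eq_norm, ← mul_sub]
    exact (norm_mul_le _ _).trans (mul_le_mul_of_nonneg_right (hC z) (norm_nonneg _))
  · simpa using continuous_const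
  · intro S T hS hT
    simp only [mul_add]
    exact hS.add hT
  · intro c T hT
    simp only [mul_smul_comm]
    exact hT.const_smul c
  · intro x y
    refine ((continuous_rankOne_left (B := B) y).comp (hVc x)).congr fun z => ?_
    refine ContinuousLinearMap.ext fun v => ?_
    exact ((hV z).map_bsmul _ _).symm

/-- Multiplication by `V_z` is Lipschitz in the compact operator with a constant independent of `z`,
so the version with a fixed compact operator gives joint continuity. -/
lemma continuous_compact_mul' {V V' : Z → E →L[ℂ] E} {C : ℝ} (hC : ∀ z, ‖V z‖ ≤ C)
    (hV : ∀ z, IsAdjoint B (V z) (V' z)) (hV' : ∀ v, Continuous fun z => V' z v)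
    {K : Z → E →L[ℂ] E} (hK : ∀ z, K z ∈ compactOps B E) (hKc : Continuous K) :
    Continuous fun z => K z * V z := by
  have h : Continuous fun q : compactOps B E × Z => (q.1 : E →L[ℂ] E) * V q.2 := by
    refine continuous_prod_of_continuous_lipschitzWith _ C.toNNReal
      (fun K => continuous_compact_mul hC hV hV' K.2) fun z => ?_
    refine LipschitzWith.of_dist_le_mul fun S T => ?_
    rw [Subtype.dist_eq, dist_eq_norm, dist_eq_norm, ← sub_mul, mul_comm]
    exact (norm_mul_le _ _).trans
      (mul_le_mul_of_nonneg_left ((hC z).trans (Real.le_coe_toNNReal C)) (norm_nonneg _))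
  exact h.comp ((hKc.subtype_mk hK).prodMk continuous_id)

lemma continuous_mul_compact' {V V' : Z → E →L[ℂ] E} {C : ℝ} (hC : ∀ z, ‖V z‖ ≤ C)
    (hV : ∀ z, IsAdjoint B (V z) (V' z)) (hVc : ∀ v, Continuous fun z => V z v)
    {K : Z → E →L[ℂ] E} (hK : ∀ z, K z ∈ compactOps B E) (hKc : Continuous K) :
    Continuous fun z => V z * K z := by
  have h : Continuous fun q : compactOps B E × Z => V q.2 * (q.1 : E →L[ℂ] E) := by
    refine continuous_prod_of_continuous_lipschitzWith _ C.toNNReal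
      (fun K => continuous_mul_compact hC hV hVc K.2) fun z => ?_
    refine LipschitzWith.of_dist_le_mul fun S T => ?_
    rw [Subtype.dist_eq, dist_eq_norm, dist_eq_norm, ← mul_sub]
    exact (norm_mul_le _ _).trans
      (mul_le_mul_of_nonneg_right ((hC z).trans (Real.le_coe_toNNReal C)) (norm_nonneg _))
  exact h.comp ((hKc.subtype_mk hK).prodMk continuous_id)

/-- Paschke's inequality `⟨T x, T x⟩ ≤ ‖T‖² ⟨x, x⟩`, evaluated at a character. -/
lemma IsAdjoint.character_inner_le {T : E → E'} {T' : E' → E} (h : IsAdjoint B T T') {C : ℝ}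
    (hC : 0 ≤ C) (hT : ∀ x, ‖T x‖ ≤ C * ‖x‖) (χ : B →⋆ₐ[ℂ] ℂ) (x : E) :
    ‖χ (inner B (T x) (T x))‖ ≤ C ^ 2 * ‖χ (inner B x x)‖ := by
  set a : B := inner B x x with ha
  have ha0 : 0 ≤ a := CStarModule.inner_self_nonneg
  refine le_of_forall_pos_le_add fun ε hε => ?_
  obtain ⟨δ, hδ, hδε⟩ : ∃ δ : ℝ, 0 < δ ∧ C ^ 2 * δ ≤ ε :=
    ⟨ε / (C ^ 2 + 1), by positivity, by
      rw [mul_div_assoc', div_le_iff₀ (by positivity)]; nlinarith⟩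
  -- The idea is to normalize `x` by `b = (⟨x, x⟩ + δ)^(-1/2)`, so that `‖b x‖ ≤ 1`. The spectrum of
  -- `⟨x, x⟩` is non-negative, so `max t 0` is there only to make `f` continuous on all of `ℝ`.
  let f : ℝ → ℝ := fun t => (√(max t 0 + δ))⁻¹
  have hf : Continuous f := by
    refine Continuous.inv₀ (by fun_prop) fun t => ?_
    exact (Real.sqrt_pos.2 (by positivity)).ne'
  let b : B := cfc f a
  have hbs : star b = b := (cfc_predicate (R := ℝ) f a : IsSelfAdjoint _)
  have hspec : ∀ t ∈ spectrum ℝ a, 0 ≤ t := fun t ht => spectrum_nonneg_of_nonneg ha0 ht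
  have hsa : IsSelfAdjoint a := ha0.isSelfAdjoint
  have hba : b * (b * a) = cfc (fun t => f t * (f t * t)) a := by
    rw [cfc_mul f _ a hf.continuousOn (by fun_prop), cfc_mul f _ a hf.continuousOn (by fun_prop),
      cfc_id' ℝ a]
  have hb1 : b * (b * (a + algebraMap ℝ B δ)) = 1 := by
    have h1 : cfc (fun t => f t * (f t * (t + δ))) a = b * (b * (a + algebraMap ℝ B δ)) := by
      rw [cfc_mul f _ a hf.continuousOn (by fun_prop),
        cfc_mul f _ a hf.continuousOn (by fun_prop), cfc_add_const δ _ a, cfc_id' ℝ a]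
    rw [← h1, ← cfc_one ℝ a]
    refine cfc_congr fun t ht => ?_
    have h2 : (0 : ℝ) < max t 0 + δ := by positivity
    have h3 : max t 0 = t := max_eq_left (hspec t ht)
    change (√(max t 0 + δ))⁻¹ * ((√(max t 0 + δ))⁻¹ * (t + δ)) = 1
    rw [h3] at h2 ⊢
    rw [← mul_assoc, ← mul_inv, Real.mul_self_sqrt h2.le, inv_mul_cancel₀ h2.ne']
  have hnorm : ‖b * (b * a)‖ ≤ 1 := by
    rw [hba]
    refine norm_cfc_le zero_le_one fun t ht => ?_
    have h2 : (0 : ℝ) < max t 0 + δ := by positivity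
    have h3 : max t 0 = t := max_eq_left (hspec t ht)
    change ‖(√(max t 0 + δ))⁻¹ * ((√(max t 0 + δ))⁻¹ * t)‖ ≤ 1
    rw [h3] at h2 ⊢
    rw [← mul_assoc, ← mul_inv, Real.mul_self_sqrt h2.le, Real.norm_of_nonneg
      (mul_nonneg (inv_nonneg.2 h2.le) (hspec t ht)), inv_mul_le_iff₀ h2]
    linarith
  have hbx : ‖b • x‖ ≤ 1 := by
    refine le_of_sq_le_sq ?_ zero_le_one
    rw [norm_sq_inner B, CStarModule.inner_op_smul_right, CStarModule.inner_op_smul_left, hbs,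
      mul_comm a b, one_pow]
    exact hnorm
  -- By `B`-linearity of `T` this element is `⟨T (b x), T (b x)⟩`, whose norm is controlled by `‖b
  -- x‖ ≤ 1`.
  have h4 : ‖χ (b * (b * inner B (T x) (T x)))‖ ≤ C ^ 2 := by
    have h5 : b * (b * inner B (T x) (T x)) = inner B (T (b • x)) (T (b • x)) := by
      rw [h.map_bsmul, CStarModule.inner_op_smul_right, CStarModule.inner_op_smul_left, hbs,
        mul_comm b (inner B (T x) (T x))]
    rw [h5]
    refine (NonUnitalStarAlgHom.norm_apply_le χ _).trans ?_
    rw [← norm_sq_inner B]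
    refine pow_le_pow_left₀ (norm_nonneg _) ((hT _).trans ?_) 2
    exact (mul_le_mul_of_nonneg_left hbx hC).trans_eq (mul_one C)
  -- A character is multiplicative, so the normalization can be undone after evaluation: `χ(b)²` is
  -- the inverse of `χ(a) + δ`.
  have h6 : χ b * (χ b * (χ a + δ)) = 1 := by
    have := congrArg χ hb1
    rw [map_mul, map_mul, map_add, map_one] at this
    rw [← this]
    congr 3
    rw [Algebra.algebraMap_eq_smul_one, ← Complex.coe_smul, map_smul, map_one, smul_eq_mul, mul_one]
  have h7 : ‖χ b‖ * (‖χ b‖ * ‖χ a + δ‖) = 1 := by rw [← norm_mul, ← norm_mul, h6, norm_one]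
  rw [map_mul, map_mul, norm_mul, norm_mul] at h4
  have h8 : ‖χ a + δ‖ ≤ ‖χ a‖ + δ :=
    (norm_add_le _ _).trans (by rw [Complex.norm_real, Real.norm_of_nonneg hδ.le])
  have hpos : 0 < ‖χ b‖ := by
    rcases (norm_nonneg (χ b)).eq_or_lt with h0 | h0
    · rw [← h0, zero_mul] at h7; exact absurd h7 zero_ne_one
    · exact h0
  calc ‖χ (inner B (T x) (T x))‖
      = (‖χ b‖ * (‖χ b‖ * ‖χ (inner B (T x) (T x))‖)) * ‖χ a + δ‖ := by
        linear_combination (-‖χ (inner B (T x) (T x))‖) * h7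
    _ ≤ C ^ 2 * (‖χ a‖ + δ) := mul_le_mul h4 h8 (norm_nonneg _) (by positivity)
    _ ≤ _ := by linarith

variable (B) in
/-- The norm of a Hilbert module is determined by the characters of `B`. -/
lemma norm_le_of_character {x : E} {C : ℝ} (hC : 0 ≤ C)
    (h : ∀ χ : B →⋆ₐ[ℂ] ℂ, ‖χ (inner B x x)‖ ≤ C ^ 2) : ‖x‖ ≤ C := by
  refine le_of_sq_le_sq ?_ hC
  rw [norm_sq_inner B]
  have h1 : ‖WeakDual.gelfandTransform ℂ B (inner B x x)‖ = ‖inner B x x‖ :=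
    (AddMonoidHomClass.isometry_iff_norm (WeakDual.gelfandTransform ℂ B)).1
      (gelfandTransform_isometry B) _
  rw [← h1]
  refine (ContinuousMap.norm_le _ (by positivity)).2 fun φ => ?_
  refine h ⟨WeakDual.CharacterSpace.toAlgHom φ, fun b => ?_⟩
  exact map_star φ b

end HilbertModuleOperators

/-! ### Base change of Hilbert modules along characters, and the resulting Hilbert space
representations. -/

section Localization

variable {B : Type*} [CommCStarAlgebra B] [PartialOrder B] [StarOrderedRing B]

/-- The Hilbert `B`-module `E` with the semi-inner product `χ ⟨x, y⟩`. -/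
def PreLocalization (χ : B →⋆ₐ[ℂ] ℂ) (E : Type) : Type := E

variable (χ : B →⋆ₐ[ℂ] ℂ) {E : Type} [NormedAddCommGroup E] [NormedSpace ℂ E] [SMul B E]
  [CStarModule B E]

instance : AddCommGroup (PreLocalization χ E) := inferInstanceAs (AddCommGroup E)

instance : Module ℂ (PreLocalization χ E) := inferInstanceAs (Module ℂ E)

lemma character_inner_nonneg (x : E) : 0 ≤ χ (inner B x x) := by
  obtain ⟨b, hb⟩ := CStarAlgebra.nonneg_iff_eq_star_mul_self.1
    (CStarModule.inner_self_nonneg (A := B) (x := x))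
  rw [hb, map_mul, map_star]
  exact star_mul_self_nonneg _

/-- The semi-inner product `χ ⟨x, y⟩`. -/
abbrev PreLocalization.core : PreInnerProductSpace.Core ℂ (PreLocalization χ E) where
  inner x y := χ (inner B (show E from x) (show E from y))
  conj_inner_symm x y := by
    change star (χ _) = χ _
    rw [← map_star, CStarModule.star_inner]
  re_inner_nonneg x := (RCLike.nonneg_iff.1 (character_inner_nonneg χ (show E from x))).1
  add_left x y z := (congrArg χ (CStarModule.inner_add_left (A := B) (E := E))).trans (map_add χ _ _)
  smul_left x y c := by
    refine (congrArg χ (CStarModule.inner_smul_left_complex (A := B) (E := E))).trans ?_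
    exact (map_smul χ _ _)

instance : SeminormedAddCommGroup (PreLocalization χ E) :=
  InnerProductSpace.Core.toSeminormedAddCommGroup (c := PreLocalization.core χ)

instance : InnerProductSpace ℂ (PreLocalization χ E) :=
  InnerProductSpace.ofCore (PreLocalization.core χ)

lemma PreLocalization.inner_def (x y : PreLocalization χ E) :
    inner ℂ x y = χ (inner B (show E from x) (show E from y)) := rfl

lemma PreLocalization.norm_sq (x : PreLocalization χ E) :
    ‖x‖ ^ 2 = ‖χ (inner B (show E from x) (show E from x))‖ := by
  rw [← PreLocalization.inner_def, inner_self_eq_norm_sq_to_K]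
  simp

/-- The Hilbert space obtained from the Hilbert `B`-module `E` by base change along the character
`χ` of `B`. -/
abbrev Localization (χ : B →⋆ₐ[ℂ] ℂ) (E : Type) [NormedAddCommGroup E] [NormedSpace ℂ E] [SMul B E]
    [CStarModule B E] : Type := UniformSpace.Completion (PreLocalization χ E)

/-- An adjointable operator on the semi-inner product space. -/
def IsAdjoint.preLocalize {T : E →L[ℂ] E} {T' : E → E} (h : IsAdjoint B T T') :
    PreLocalization χ E →L[ℂ] PreLocalization χ E :=
  LinearMap.mkContinuous (T.toLinearMap : E →ₗ[ℂ] E) ‖T‖ fun x => by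
    refine le_of_sq_le_sq ?_ (by positivity)
    rw [mul_pow, PreLocalization.norm_sq, PreLocalization.norm_sq]
    -- Boundedness for the localized seminorm does not follow from the operator norm alone; it is
    -- Paschke's inequality at the character.
    exact h.character_inner_le (norm_nonneg T) T.le_opNorm χ _

/-- The identity, from a Hilbert module to the semi-inner product space. -/
def preLocalizationMap : E →L[ℂ] PreLocalization χ E :=
  LinearMap.mkContinuous (LinearMap.id : E →ₗ[ℂ] E) 1 fun x => by
    refine le_of_sq_le_sq ?_ (by positivity)
    rw [PreLocalization.norm_sq, one_mul, norm_sq_inner B]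
    exact NonUnitalStarAlgHom.norm_apply_le χ _

/-- The canonical map from a Hilbert module to its localization. -/
def localizationMap : E →L[ℂ] Localization χ E :=
  UniformSpace.Completion.toComplL ∘L preLocalizationMap χ

lemma localizationMap_inner (x y : E) :
    inner ℂ (localizationMap χ x) (localizationMap χ y) = χ (inner B x y) :=
  UniformSpace.Completion.inner_coe _ _

lemma localizationMap_denseRange : DenseRange (localizationMap χ : E → Localization χ E) :=
  UniformSpace.Completion.denseRange_coe (α := PreLocalization χ E)

lemma localizationMap_norm_sq (x : E) : ‖localizationMap χ x‖ ^ 2 = ‖χ (inner B x x)‖ := by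
  rw [← localizationMap_inner, inner_self_eq_norm_sq_to_K]
  simp

/-- The Gelfand transform of a commutative `C*`-algebra is isometric, so norm estimates in a Hilbert
module may be proved in all its localizations, where Hilbert space arguments and the maximal crossed
product norm are available. -/
lemma exists_localization_norm (x : E) {C : ℝ} (hC : 0 ≤ C)
    (h : ∀ χ : B →⋆ₐ[ℂ] ℂ, ‖localizationMap χ x‖ ≤ C) : ‖x‖ ≤ C :=
  norm_le_of_character B hC fun χ => by
    rw [← localizationMap_norm_sq]
    exact pow_le_pow_left₀ (norm_nonneg _) (h χ) 2

/-- An adjointable operator on the localization. -/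
def IsAdjoint.localize {T : E →L[ℂ] E} {T' : E → E} (h : IsAdjoint B T T') :
    Localization χ E →L[ℂ] Localization χ E := (h.preLocalize χ).completion

lemma IsAdjoint.localize_apply {T : E →L[ℂ] E} {T' : E → E} (h : IsAdjoint B T T') (x : E) :
    h.localize χ (localizationMap χ x) = localizationMap χ (T x) :=
  (h.preLocalize χ).completion_apply_coe _

lemma localization_ext {S T : Localization χ E →L[ℂ] Localization χ E}
    (h : ∀ x : E, S (localizationMap χ x) = T (localizationMap χ x)) : S = T := by
  refine ContinuousLinearMap.ext fun v => ?_
  refine (localizationMap_denseRange χ (E := E)).induction_on (p := fun v => S v = T v) v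
    (isClosed_eq S.continuous T.continuous) h

lemma IsAdjoint.adjoint_localize {T T' : E →L[ℂ] E} (h : IsAdjoint B T T')
    (h' : IsAdjoint B T' T) : star (h.localize χ) = h'.localize χ := by
  refine (ContinuousLinearMap.eq_adjoint_iff _ _).2 (fun x y => ?_) |>.symm
  refine (localizationMap_denseRange χ (E := E)).induction_on₂
    (p := fun x y => inner ℂ (h'.localize χ x) y = inner ℂ x (h.localize χ y))
    (isClosed_eq (by fun_prop) (by fun_prop)) (fun x y => ?_) x y
  rw [h.localize_apply, h'.localize_apply, localizationMap_inner, localizationMap_inner, h']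

variable {G A : Type*} [Group G] [TopologicalSpace G] [NonUnitalCStarAlgebra A]
  {α : CStarAction G A}

lemma GradedBimodule.π_isAdjoint (X : GradedBimodule α B) (a : A) :
    IsAdjoint B (X.π a) (X.π (star a)) := X.π_inner a

lemma GradedBimodule.U_inv' (X : GradedBimodule α B) (g : G) (u : X.E) :
    X.U g⁻¹ (X.U g u) = u := by
  simpa using X.U_inv g⁻¹ u

lemma GradedBimodule.U_isAdjoint (X : GradedBimodule α B) (g : G) :
    IsAdjoint B (X.U g) (X.U g⁻¹) := fun x y => by
  rw [← X.U_inner g x, X.U_inv]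

lemma KasparovCycle.F_isAdjoint (x : KasparovCycle α B) : IsAdjoint B x.F x.Fadj := x.F_inner

/-- The covariant representation on the localization of an equivariant bimodule. -/
def GradedBimodule.localization (X : GradedBimodule α B) : CovariantRep α where
  H := Localization χ X.E
  rep :=
    { toFun := fun a => (X.π_isAdjoint a).localize χ
      map_smul' := fun c a => localization_ext χ fun x => by
        simp only [IsAdjoint.localize_apply, map_smul, FunLike.coe_smul, Pi.smul_apply,
          MonoidHom.id_apply]
      map_zero' := localization_ext χ fun x => by
        simp only [IsAdjoint.localize_apply, map_zero, zero_apply]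
      map_add' := fun a b => localization_ext χ fun x => by
        simp only [IsAdjoint.localize_apply, map_add, add_apply]
      map_mul' := fun a b => localization_ext χ fun x => by
        simp only [IsAdjoint.localize_apply, map_mul, mul_apply_eq_comp]
      map_star' := fun a => (IsAdjoint.adjoint_localize χ (X.π_isAdjoint a) fun x y => by
        rw [X.π_inner, star_star]).symm }
  U :=
    MonoidHom.mk' (fun g => ⟨(X.U_isAdjoint g).localize χ, by
      have h : star ((X.U_isAdjoint g).localize χ) = (X.U_isAdjoint g).symm.localize χ :=
        IsAdjoint.adjoint_localize χ _ _
      rw [Unitary.mem_iff, h]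
      refine ⟨localization_ext χ fun x => ?_, localization_ext χ fun x => ?_⟩ <;>
      simp only [mul_apply_eq_comp, IsAdjoint.localize_apply, X.U_inv, X.U_inv', one_apply_eq_self]⟩)
      fun g h => Subtype.ext (localization_ext χ fun x => by
        change _ = (X.U_isAdjoint g).localize χ ((X.U_isAdjoint h).localize χ _)
        simp only [IsAdjoint.localize_apply, map_mul, mul_apply_eq_comp])
  U_continuous ξ := by
    -- Unitarity gives a Lipschitz bound that is uniform in `g`, and so strong continuity spreads
    -- from the dense image of `E`.
    have hU : ∀ (g : G) (ξ : Localization χ X.E), ‖(X.U_isAdjoint g).localize χ ξ‖ = ‖ξ‖ := by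
      intro g ξ
      refine (localizationMap_denseRange χ (E := X.E)).induction_on
        (p := fun ξ => ‖(X.U_isAdjoint g).localize χ ξ‖ = ‖ξ‖) ξ
        (isClosed_eq (by fun_prop) (by fun_prop)) fun x => ?_
      refine (pow_left_inj₀ (norm_nonneg _) (norm_nonneg _) two_ne_zero).1 ?_
      rw [IsAdjoint.localize_apply, localizationMap_norm_sq, localizationMap_norm_sq, X.U_inner]
    refine (localizationMap_denseRange χ (E := X.E)).induction_on
        (p := fun ξ => Continuous fun g => (X.U_isAdjoint g).localize χ ξ) ξ
        (isClosed_setOf_continuous (fun ξ g => (X.U_isAdjoint g).localize χ ξ) 1 fun ξ η g => ?_)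
        fun x => ?_
    · rw [dist_eq_norm, dist_eq_norm, ← map_sub, hU, one_mul]
    · simp only [IsAdjoint.localize_apply]
      exact (localizationMap χ).continuous.comp (X.U_continuous x)
  covariant g a := by
    have h : star ((X.U_isAdjoint g).localize χ) = (X.U_isAdjoint g).symm.localize χ :=
        IsAdjoint.adjoint_localize χ _ _
    change (X.U_isAdjoint g).localize χ * (X.π_isAdjoint a).localize χ *
      star ((X.U_isAdjoint g).localize χ) = (X.π_isAdjoint _).localize χ
    rw [h]
    refine localization_ext χ fun x => ?_
    simp only [mul_apply_eq_comp, IsAdjoint.localize_apply, X.π_equivariant, X.U_inv]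

lemma GradedBimodule.localization_rep (X : GradedBimodule α B) (a : A) (u : X.E) :
    (X.localization χ).rep a (localizationMap χ u) = localizationMap χ (X.π a u) :=
  IsAdjoint.localize_apply _ _ _

lemma GradedBimodule.localization_U (X : GradedBimodule α B) (g : G) (u : X.E) :
    ((X.localization χ).U g : (X.localization χ).H →L[ℂ] (X.localization χ).H)
      (localizationMap χ u) = localizationMap χ (X.U g u) :=
  IsAdjoint.localize_apply _ _ _

/-- Contractivity is not among the axioms of a bimodule. It holds because each localization is a
`*`-representation of a `C*`-algebra on a Hilbert space. -/
lemma GradedBimodule.norm_π_apply_le (X : GradedBimodule α B) (a : A) (u : X.E) :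
    ‖X.π a u‖ ≤ ‖a‖ * ‖u‖ := by
  refine exists_localization_norm (B := B) _ (by positivity) fun χ => ?_
  rw [← X.localization_rep]
  refine ((X.localization χ).norm_rep_le a _).trans
    (mul_le_mul_of_nonneg_left ?_ (norm_nonneg _))
  refine le_of_sq_le_sq ?_ (norm_nonneg _)
  refine (localizationMap_norm_sq χ u).trans_le ?_
  rw [norm_sq_inner B]
  exact NonUnitalStarAlgHom.norm_apply_le χ _

lemma GradedBimodule.norm_π_le (X : GradedBimodule α B) (a : A) : ‖X.π a‖ ≤ ‖a‖ :=
  ContinuousLinearMap.opNorm_le_bound _ (norm_nonneg _) (X.norm_π_apply_le a)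

lemma GradedBimodule.continuous_π (X : GradedBimodule α B) : Continuous X.π :=
  AddMonoidHomClass.continuous_of_bound X.π 1 fun a => by
    rw [one_mul]
    exact X.norm_π_le a

lemma GradedBimodule.norm_U_le (X : GradedBimodule α B) (g : G) : ‖X.U g‖ ≤ 1 :=
  ContinuousLinearMap.opNorm_le_bound _ zero_le_one fun u => by rw [X.U_norm, one_mul]

end Localization

/-! ### Restriction to invariant submodules, and checking cycle conditions on a dense set of
coefficients. -/

section Restriction

variable {B : Type*} [CommCStarAlgebra B] [PartialOrder B] [StarOrderedRing B]
  {E : Type} [NormedAddCommGroup E] [NormedSpace ℂ E] [SMul B E] [CStarModule B E]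

/-- The action of `B` on a `B`-invariant subspace. -/
@[reducible] def submoduleSMul (M : Submodule ℂ E) (hB : ∀ (b : B), ∀ u ∈ M, b • u ∈ M) :
    SMul B M := ⟨fun b u => ⟨b • u.1, hB b u.1 u.2⟩⟩

/-- A `B`-invariant subspace of a Hilbert `B`-module is a Hilbert module. -/
@[reducible] def submoduleModule (M : Submodule ℂ E) (hB : ∀ (b : B), ∀ u ∈ M, b • u ∈ M) :
    @CStarModule B M _ _ _ _ _ _ (submoduleSMul M hB) _ _ :=
  letI : SMul B M := submoduleSMul M hB
  { inner := fun x y => inner B x.1 y.1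
    inner_add_right := CStarModule.inner_add_right
    inner_self_nonneg := CStarModule.inner_self_nonneg
    inner_self := CStarModule.inner_self.trans Submodule.coe_eq_zero
    inner_op_smul_right := CStarModule.inner_op_smul_right
    inner_smul_right_complex := CStarModule.inner_smul_right_complex
    star_inner := fun _ _ => CStarModule.star_inner _ _
    norm_eq_sqrt_norm_inner_self := fun x => CStarModule.norm_eq_sqrt_norm_inner_self (A := B) x.1 }

/-- The restriction of an operator to an invariant subspace. -/
def restrictOp (M : Submodule ℂ E) (T : E →L[ℂ] E) (h : ∀ u ∈ M, T u ∈ M) : M →L[ℂ] M :=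
  (T ∘L M.subtypeL).codRestrict M fun u => h u.1 u.2

@[simp] lemma coe_restrictOp (M : Submodule ℂ E) (T : E →L[ℂ] E) (h : ∀ u ∈ M, T u ∈ M) (u : M) :
    (restrictOp M T h u : E) = T u := rfl

variable {G A : Type*} [Group G] [TopologicalSpace G] [NonUnitalCStarAlgebra A]
  {α : CStarAction G A}

/-- The restriction of a bimodule to a closed invariant subspace. -/
def GradedBimodule.restrict (X : GradedBimodule α B) (M : Submodule ℂ X.E)
    (hM : IsClosed (M : Set X.E)) (hB : ∀ (b : B), ∀ u ∈ M, b • u ∈ M) (hε : ∀ u ∈ M, X.ε u ∈ M)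
    (hU : ∀ g, ∀ u ∈ M, X.U g u ∈ M) (hπ : ∀ a, ∀ u ∈ M, X.π a u ∈ M) : GradedBimodule α B where
  E := M
  instComplete := hM.completeSpace_coe
  instSeparable := by
    have : SecondCountableTopology X.E := UniformSpace.secondCountable_of_separable X.E
    have : SecondCountableTopology M := inferInstance
    infer_instance
  instSMul := submoduleSMul M hB
  instModule := submoduleModule M hB
  ε := restrictOp M X.ε hε
  U :=
    { toFun := fun g => restrictOp M (X.U g) (hU g)
      map_one' := ContinuousLinearMap.ext fun u => Subtype.ext <| by simp
      map_mul' := fun g h => ContinuousLinearMap.ext fun u => Subtype.ext <| by simp }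
  π :=
    { toFun := fun a => restrictOp M (X.π a) (hπ a)
      map_zero' := ContinuousLinearMap.ext fun u => Subtype.ext <| by simp
      map_add' := fun g h => ContinuousLinearMap.ext fun u => Subtype.ext <| by simp
      map_mul' := fun g h => ContinuousLinearMap.ext fun u => Subtype.ext <| by simp
      map_smul' := fun g h => ContinuousLinearMap.ext fun u => Subtype.ext <| by simp }
  ε_sq u := Subtype.ext <| X.ε_sq _
  ε_inner u v := X.ε_inner _ _
  U_inner g u v := X.U_inner _ _ _
  U_continuous u := (X.U_continuous u.1).subtype_mk _
  U_even g u := Subtype.ext <| X.U_even _ _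
  π_inner a u v := X.π_inner _ _ _
  π_even a u := Subtype.ext <| X.π_even _ _
  π_equivariant g a u := Subtype.ext <| X.π_equivariant _ _ _

/-- This is the form in which density is used below: a property that defines a closed subspace holds
everywhere as soon as it holds for generators. -/
lemma mem_of_dense_span {A : Type*} [SeminormedAddCommGroup A] [NormedSpace ℂ A]
    {S : Set A} (hS : Dense (Submodule.span ℂ S : Set A)) {P : Submodule ℂ A}
    (hP : IsClosed (P : Set A)) (h : ∀ a ∈ S, a ∈ P) (a : A) : a ∈ P := by
  have h1 : closure (Submodule.span ℂ S : Set A) ⊆ P :=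
    closure_minimal (Submodule.span_le.2 h) hP
  exact h1 (hS a)

lemma clm_mem_of_dense_span {A Y : Type*} [SeminormedAddCommGroup A] [NormedSpace ℂ A]
    [SeminormedAddCommGroup Y] [NormedSpace ℂ Y]
    {S : Set A} (hS : Dense (Submodule.span ℂ S : Set A)) {P : Submodule ℂ Y}
    (hP : IsClosed (P : Set Y)) (L : A →L[ℂ] Y) (h : ∀ a ∈ S, L a ∈ P) (a : A) : L a ∈ P :=
  mem_of_dense_span hS (P := P.comap L.toLinearMap) (hP.preimage L.continuous) h a

/-- The representation as a bounded operator. -/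
def GradedBimodule.πL (X : GradedBimodule α B) : A →L[ℂ] (X.E →L[ℂ] X.E) :=
  LinearMap.mkContinuous
    { toFun := X.π
      map_add' := map_add X.π
      map_smul' := map_smul X.π } 1 fun a => by rw [one_mul]; exact X.norm_π_le a

@[simp] lemma GradedBimodule.πL_apply (X : GradedBimodule α B) (a : A) : X.πL a = X.π a := rfl

lemma GradedBimodule.mul_mem_compactOps_of_dense (X : GradedBimodule α B) {S : Set A}
    (hS : Dense (Submodule.span ℂ S : Set A)) {T : X.E →L[ℂ] X.E}
    (h : ∀ a ∈ S, X.π a * T ∈ compactOps B X.E) (a : A) : X.π a * T ∈ compactOps B X.E := by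
  let L : A →L[ℂ] (X.E →L[ℂ] X.E) := (ContinuousLinearMap.mul ℂ (X.E →L[ℂ] X.E)).flip T ∘L X.πL
  have hL : ∀ a, X.π a * T = L a := fun a => by simp [L]
  rw [hL]
  exact clm_mem_of_dense_span hS isClosed_compactOps L (fun a ha => hL a ▸ h a ha) a

/-- The conditions on a cycle need only be checked on a set that spans a dense subspace of `A`. -/
def KasparovCycle.ofDense (X : GradedBimodule α B) (F Fadj : X.E →L[ℂ] X.E)
    (F_inner : ∀ x y, inner B (F x) y = inner B x (Fadj y))
    (F_odd : ∀ x, X.ε (F x) = -F (X.ε x)) {S : Set A} (hS : Dense (Submodule.span ℂ S : Set A))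
    (F_comm : ∀ a ∈ S, F * X.π a - X.π a * F ∈ compactOps B X.E)
    (F_sq : ∀ a ∈ S, X.π a * (F * F - 1) ∈ compactOps B X.E)
    (F_selfAdj : ∀ a ∈ S, X.π a * (F - Fadj) ∈ compactOps B X.E)
    (F_equivariant : ∀ a ∈ S, ∀ g, X.π a * (X.U g * F * X.U g⁻¹ - F) ∈ compactOps B X.E)
    (F_continuous : ∀ a ∈ S, Continuous fun g => X.π a * (X.U g * F * X.U g⁻¹ - F)) :
    KasparovCycle α B where
  toGradedBimodule := X
  F := F
  Fadj := Fadj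
  F_inner := F_inner
  F_odd := F_odd
  F_comm a := by
    let L : A →L[ℂ] (X.E →L[ℂ] X.E) := ContinuousLinearMap.mul ℂ (X.E →L[ℂ] X.E) F ∘L X.πL -
      (ContinuousLinearMap.mul ℂ (X.E →L[ℂ] X.E)).flip F ∘L X.πL
    have hL : ∀ a, F * X.π a - X.π a * F = L a := fun a => by simp [L]
    rw [hL]
    exact clm_mem_of_dense_span hS isClosed_compactOps L (fun a ha => hL a ▸ F_comm a ha) a
  F_sq a := X.mul_mem_compactOps_of_dense hS F_sq a
  F_selfAdj a := X.mul_mem_compactOps_of_dense hS F_selfAdj a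
  F_equivariant a g := X.mul_mem_compactOps_of_dense hS (fun a ha => F_equivariant a ha g) a
  F_continuous := by
    let P : Submodule ℂ A :=
      { carrier := {a | Continuous fun g => X.π a * (X.U g * F * X.U g⁻¹ - F)}
        add_mem' := fun {a b} ha hb => by
          simp only [Set.mem_ofPred_eq, map_add, add_mul] at ha hb ⊢
          exact ha.add hb
        zero_mem' := by
          simp only [Set.mem_ofPred_eq, map_zero, zero_mul]
          exact continuous_const
        smul_mem' := fun c a ha => by
          simp only [Set.mem_ofPred_eq, map_smul, smul_mul_assoc] at ha ⊢
          exact ha.const_smul c }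
    refine fun a => mem_of_dense_span hS (P := P) ?_ F_continuous a
    -- The constant bounds `U g F U g⁻¹ - F` uniformly in `g`.
    refine isClosed_setOf_continuous (fun a g => X.π a * (X.U g * F * X.U g⁻¹ - F))
      (1 * ‖F‖ * 1 + ‖F‖) fun a b g => ?_
    rw [dist_eq_norm, dist_eq_norm, ← sub_mul, ← map_sub, mul_comm]
    refine (norm_mul_le _ _).trans (mul_le_mul (X.norm_π_le _) ?_ (norm_nonneg _) (norm_nonneg _))
    refine (norm_sub_le _ _).trans (add_le_add_left ?_ _)
    refine (norm_mul_le _ _).trans (mul_le_mul ?_ (X.norm_U_le _) (norm_nonneg _) (by positivity))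
    exact (norm_mul_le _ _).trans (mul_le_mul_of_nonneg_right (X.norm_U_le _) (norm_nonneg _))

end Restriction

/-! ### Strong limits of uniformly bounded sequences of operators. -/

section StrongLimits

variable {V W : Type*} [NormedAddCommGroup V] [NormedSpace ℂ V] [NormedAddCommGroup W]
  [NormedSpace ℂ W]

/-- A uniformly bounded sequence of operators converges on a closed set. -/
lemma isClosed_setOf_tendsto {T : ℕ → V →L[ℂ] W} {S : V →L[ℂ] W} {C : ℝ}
    (hT : ∀ n v, ‖T n v‖ ≤ C * ‖v‖) :
    IsClosed {v | Filter.Tendsto (fun n => T n v) Filter.atTop (nhds (S v))} := by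
  refine isClosed_of_closure_subset fun v hv => Metric.tendsto_atTop.2 fun ε hε => ?_
  obtain ⟨w, hw, h⟩ := Metric.mem_closure_iff.1 hv (ε / (2 * (|C| + ‖S‖ + 1))) (by positivity)
  obtain ⟨N, hN⟩ := Metric.tendsto_atTop.1 hw (ε / 2) (by positivity)
  refine ⟨N, fun n hn => ?_⟩
  have h1 := hN n hn
  rw [dist_eq_norm] at h1 h ⊢
  have h2 : T n v - S v = T n (v - w) + (T n w - S w) - S (v - w) := by
    simp only [map_sub]; abel
  rw [h2]
  have h3 : (|C| + ‖S‖ + 1) * ‖v - w‖ < ε / 2 := by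
    rw [lt_div_iff₀ (by positivity)] at h
    linarith
  have h4 : ‖T n (v - w)‖ ≤ |C| * ‖v - w‖ :=
    (hT n _).trans (mul_le_mul_of_nonneg_right (le_abs_self C) (norm_nonneg _))
  have h5 := S.le_opNorm (v - w)
  have h6 := norm_nonneg (v - w)
  calc _ ≤ ‖T n (v - w)‖ + ‖T n w - S w‖ + ‖S (v - w)‖ := 
        (norm_sub_le _ _).trans (add_le_add (norm_add_le _ _) le_rfl)
    _ < ε := by nlinarith

/-- A uniformly bounded sequence of operators that converges on a dense subspace converges
strongly. -/
lemma exists_strong_limit [CompleteSpace W] {T : ℕ → V →L[ℂ] W} {C : ℝ} (hC : 0 ≤ C)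
    (hT : ∀ n v, ‖T n v‖ ≤ C * ‖v‖) {D : Set V} (hD : Dense (Submodule.span ℂ D : Set V))
    (h : ∀ v ∈ D, ∃ w, Filter.Tendsto (fun n => T n v) Filter.atTop (nhds w)) :
    ∃ S : V →L[ℂ] W, (∀ v, Filter.Tendsto (fun n => T n v) Filter.atTop (nhds (S v))) ∧
      ∀ v, ‖S v‖ ≤ C * ‖v‖ := by
  -- The vectors on which the sequence is Cauchy form a closed subspace thanks to the uniform bound,
  -- and this subspace contains the generators.
  let P : Submodule ℂ V :=
    { carrier := {v | CauchySeq fun n => T n v}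
      add_mem' := fun {a b} ha hb => by
        simp only [Set.mem_ofPred_eq, map_add] at ha hb ⊢
        exact ha.add hb
      zero_mem' := by
        simp only [Set.mem_ofPred_eq, map_zero]
        exact cauchySeq_const _
      smul_mem' := fun c a ha => by
        simp only [Set.mem_ofPred_eq, map_smul] at ha ⊢
        exact (uniformContinuous_const_smul c).comp_cauchySeq ha }
  have hP : IsClosed (P : Set V) := by
    refine isClosed_of_closure_subset fun v hv => Metric.cauchySeq_iff'.2 fun ε hε => ?_
    obtain ⟨w, hw, h⟩ := Metric.mem_closure_iff.1 hv (ε / (4 * (C + 1))) (by positivity)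
    obtain ⟨N, hN⟩ := Metric.cauchySeq_iff'.1 hw (ε / 2) (by positivity)
    refine ⟨N, fun n hn => ?_⟩
    have h1 := hN n hn
    rw [dist_eq_norm] at h1 h ⊢
    have h2 : T n v - T N v = T n (v - w) + (T n w - T N w) - T N (v - w) := by
      simp only [map_sub]; abel
    rw [h2]
    have h3 : (C + 1) * ‖v - w‖ < ε / 4 := by
      rw [lt_div_iff₀ (by positivity)] at h
      linarith
    have h4 := hT n (v - w)
    have h5 := hT N (v - w)
    have h6 := norm_nonneg (v - w)
    calc _ ≤ ‖T n (v - w)‖ + ‖T n w - T N w‖ + ‖T N (v - w)‖ := 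
        (norm_sub_le _ _).trans (add_le_add (norm_add_le _ _) le_rfl)
      _ < ε := by nlinarith
  have hall : ∀ v, CauchySeq fun n => T n v := fun v =>
    mem_of_dense_span hD hP (fun v hv => (h v hv).choose_spec.cauchySeq) v
  choose S hS using fun v => cauchySeq_tendsto_of_complete (hall v)
  have hb : ∀ v, ‖S v‖ ≤ C * ‖v‖ := fun v => le_of_tendsto (hS v).norm (.of_forall fun n => hT n v)
  refine ⟨LinearMap.mkContinuous
    { toFun := S
      map_add' := fun v w => tendsto_nhds_unique (hS (v + w)) <| by
        simp only [map_add]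
        exact (hS v).add (hS w)
      map_smul' := fun c v => tendsto_nhds_unique (hS (c • v)) <| by
        simp only [map_smul]
        exact (hS v).const_smul c } C hb, hS, hb⟩

end StrongLimits

/-! ### Strict partitions of unity and the compression of an operator to the essential submodule. -/

section Compression

/-- A sequence of self-adjoint elements `d n` whose squares sum up to `1` strictly. -/
structure StrictPartition (A : Type*) [NonUnitalCStarAlgebra A] where
  d : ℕ → A
  star_d : ∀ n, star (d n) = d n
  norm_sum_le : ∀ N, ‖∑ n ∈ Finset.range N, d n * d n‖ ≤ 1
  tendsto : ∀ b, Filter.Tendsto (fun N => (∑ n ∈ Finset.range N, d n * d n) * b) Filter.atTop (nhds b)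
  dense : Dense {b : A | Summable fun n => ‖d n * b‖}

variable {A : Type*} [NonUnitalCStarAlgebra A] (p : StrictPartition A)

/-- The partial sums of the squares. -/
def StrictPartition.u (N : ℕ) : A := ∑ n ∈ Finset.range N, p.d n * p.d n

/-- The square `d_n²` is the difference of two consecutive partial sums, both contractions, so the
`C*`-identity gives `‖d_n‖² ≤ 2`; the bound `2` is merely convenient. -/
lemma StrictPartition.norm_d_le (n : ℕ) : ‖p.d n‖ ≤ 2 := by
  have h : p.d n * p.d n = p.u (n + 1) - p.u n := by simp [StrictPartition.u, Finset.sum_range_succ]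
  have h1 : ‖p.d n‖ * ‖p.d n‖ ≤ 2 := by
    rw [← CStarRing.norm_star_mul_self, p.star_d, h]
    refine (norm_sub_le _ _).trans ?_
    linarith [p.norm_sum_le (n + 1), p.norm_sum_le n, show ‖p.u (n+1)‖ ≤ 1 from p.norm_sum_le _,
      show ‖p.u n‖ ≤ 1 from p.norm_sum_le _]
  nlinarith [norm_nonneg (p.d n)]

lemma StrictPartition.star_u (N : ℕ) : star (p.u N) = p.u N := by
  simp [StrictPartition.u, p.star_d]

lemma StrictPartition.tendsto_right (b : A) :
    Filter.Tendsto (fun N => b * p.u N) Filter.atTop (nhds b) := by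
  have h := (p.tendsto (star b)).star
  rw [star_star] at h
  refine h.congr fun N => ?_
  change star (p.u N * star b) = _
  rw [star_mul, star_star, p.star_u]

/-- The elements on which the partition is absolutely summable. -/
def StrictPartition.good : Submodule ℂ A where
  carrier := {b | Summable fun n => ‖p.d n * b‖}
  add_mem' {b c} hb hc := by
    refine Summable.of_nonneg_of_le (fun n => norm_nonneg _) (fun n => ?_) (hb.add hc)
    rw [mul_add]
    exact norm_add_le _ _
  zero_mem' := by simp
  smul_mem' c b hb := by
    simp only [Set.mem_ofPred_eq, mul_smul_comm, norm_smul] at hb ⊢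
    exact hb.mul_left _

lemma StrictPartition.dense_span_mul (p : StrictPartition A) :
    Dense (Submodule.span ℂ {a : A | ∃ c d, a = c * d} : Set A) := by
  refine fun a => mem_closure_of_tendsto (p.tendsto_right a) (.of_forall fun N => ?_)
  exact Submodule.subset_span ⟨a, p.u N, rfl⟩

/-- The conditions on the compressed operator are checked on triple products: the middle factor
supplies the corresponding compactness condition for the original operator, the outer ones absorb
the passage between `F` and its compression. -/
lemma StrictPartition.dense_span_mul_mul (p : StrictPartition A) :
    Dense (Submodule.span ℂ {a : A | ∃ c d e, a = c * (d * e)} : Set A) := by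
  intro a
  rw [← closure_closure]
  refine mem_closure_of_tendsto (p.tendsto_right a) (.of_forall fun N => ?_)
  refine mem_closure_of_tendsto ((p.tendsto_right (p.u N)).const_mul a) (.of_forall fun M => ?_)
  exact Submodule.subset_span ⟨a, p.u N, p.u M, rfl⟩

variable {B : Type*} [CommCStarAlgebra B] [PartialOrder B] [StarOrderedRing B]
  {G : Type*} [Group G] [TopologicalSpace G] {α : CStarAction G A} (X : GradedBimodule α B)

/-- The essential subspace of the representation. -/
def GradedBimodule.essential : Submodule ℂ X.E :=
  (Submodule.span ℂ {v : X.E | ∃ a u, v = X.π a u}).topologicalClosure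

lemma GradedBimodule.isClosed_essential : IsClosed (X.essential : Set X.E) :=
  Submodule.isClosed_topologicalClosure _

lemma GradedBimodule.π_mem_essential (a : A) (u : X.E) : X.π a u ∈ X.essential :=
  Submodule.le_topologicalClosure _ (Submodule.subset_span ⟨a, u, rfl⟩)

lemma GradedBimodule.map_mem_essential {T : X.E →L[ℂ] X.E}
    (hT : ∀ a u, T (X.π a u) ∈ X.essential) : ∀ v ∈ X.essential, T v ∈ X.essential := by
  intro v hv
  have h : X.essential ≤ X.essential.comap T.toLinearMap := by
    refine Submodule.topologicalClosure_minimal _ (Submodule.span_le.2 ?_)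
      (X.isClosed_essential.preimage T.continuous)
    rintro _ ⟨a, u, rfl⟩
    exact hT a u
  exact h hv

/-- The restriction of a bimodule to its essential subspace. -/
def GradedBimodule.ess : GradedBimodule α B :=
  X.restrict X.essential X.isClosed_essential
    (fun b => X.map_mem_essential (T := bsmulCLM X.E b) fun a u => by
      rw [bsmulCLM_apply, ← (X.π_isAdjoint a).map_bsmul]
      exact X.π_mem_essential a _)
    (X.map_mem_essential fun a u => by rw [X.π_even]; exact X.π_mem_essential a _)
    (fun g => X.map_mem_essential fun a u => by
      rw [X.π_equivariant]; exact X.π_mem_essential _ _)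
    (fun a v _ => X.π_mem_essential a v)

/-- The inclusion of the essential subspace. -/
def GradedBimodule.essIncl : X.ess.E →L[ℂ] X.E := X.essential.subtypeL

/-- The representation as operators into the essential subspace. -/
def GradedBimodule.π₀ (a : A) : X.E →L[ℂ] X.ess.E :=
  (X.π a).codRestrict X.essential (X.π_mem_essential a)

lemma GradedBimodule.essIncl_injective : Function.Injective X.essIncl := Subtype.val_injective

lemma GradedBimodule.essIncl_norm (v : X.ess.E) : ‖X.essIncl v‖ = ‖v‖ := rfl

lemma GradedBimodule.essIncl_inner (v w : X.ess.E) :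
    inner B (X.essIncl v) (X.essIncl w) = inner B v w := rfl

@[simp] lemma GradedBimodule.essIncl_π₀ (a : A) (u : X.E) : X.essIncl (X.π₀ a u) = X.π a u := rfl

@[simp] lemma GradedBimodule.essIncl_π (a : A) (u : X.ess.E) :
    X.essIncl (X.ess.π a u) = X.π a (X.essIncl u) := rfl

@[simp] lemma GradedBimodule.essIncl_U (g : G) (u : X.ess.E) :
    X.essIncl (X.ess.U g u) = X.U g (X.essIncl u) := rfl

@[simp] lemma GradedBimodule.essIncl_ε (u : X.ess.E) :
    X.essIncl (X.ess.ε u) = X.ε (X.essIncl u) := rfl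

lemma GradedBimodule.essIncl_bsmul (b : B) (u : X.ess.E) :
    X.essIncl (b • u) = b • X.essIncl u := rfl

lemma GradedBimodule.norm_π₀_le (a : A) : ‖X.π₀ a‖ ≤ ‖a‖ :=
  ContinuousLinearMap.opNorm_le_bound _ (norm_nonneg _) (X.norm_π_apply_le a)

/-- `X.π₀` as a linear map. -/
def GradedBimodule.π₀L : A →L[ℂ] (X.E →L[ℂ] X.ess.E) :=
  LinearMap.mkContinuous
    { toFun := X.π₀
      map_add' := fun a b => ContinuousLinearMap.ext fun u => X.essIncl_injective <| by simp
      map_smul' := fun c b => ContinuousLinearMap.ext fun u => X.essIncl_injective <| by simp }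
    1 fun a => by rw [one_mul]; exact X.norm_π₀_le a

/-- The inclusion of the essential submodule need not be adjointable by itself, but it becomes so
after multiplication by `π a`, because `π (a*)` already takes values in that submodule. -/
lemma GradedBimodule.π_essIncl_isAdjoint (a : A) :
    IsAdjoint B (X.π a ∘L X.essIncl) (X.π₀ (star a)) := fun v u => X.π_inner a _ _

lemma GradedBimodule.π₀_bsmul (a : A) (b : B) (u : X.E) : X.π₀ a (b • u) = b • X.π₀ a u :=
  X.essIncl_injective ((X.π_isAdjoint a).map_bsmul b u)

/-- The operator `π c T π d` on the essential subspace. -/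
def GradedBimodule.corner (c : A) (T : X.E →L[ℂ] X.E) (d : A) : X.ess.E →L[ℂ] X.ess.E :=
  X.π₀ c ∘L T ∘L X.π d ∘L X.essIncl

@[simp] lemma GradedBimodule.essIncl_corner (c : A) (T : X.E →L[ℂ] X.E) (d : A) (v : X.ess.E) :
    X.essIncl (X.corner c T d v) = X.π c (T (X.π d (X.essIncl v))) := rfl

lemma GradedBimodule.norm_corner_le (c : A) (T : X.E →L[ℂ] X.E) (d : A) :
    ‖X.corner c T d‖ ≤ ‖c‖ * ‖T‖ * ‖d‖ := by
  refine ContinuousLinearMap.opNorm_le_bound _ (by positivity) fun v => ?_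
  rw [← X.essIncl_norm, X.essIncl_corner, mul_assoc, mul_assoc]
  refine (X.norm_π_apply_le _ _).trans (mul_le_mul_of_nonneg_left ?_ (norm_nonneg _))
  refine (T.le_opNorm _).trans (mul_le_mul_of_nonneg_left ?_ (norm_nonneg _))
  exact X.norm_π_apply_le _ _

lemma GradedBimodule.corner_mem_compactOps (c d : A) {T : X.E →L[ℂ] X.E}
    (hT : T ∈ compactOps B X.E) : X.corner c T d ∈ compactOps B X.ess.E :=
  comp_mem_compactOps (j := X.π₀ c) (i := X.π d ∘L X.essIncl) (X.π₀_bsmul c)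
    (X.π_essIncl_isAdjoint d) hT

/-- The partial sums act as contractions and converge to the identity on the vectors `π a u`, which
span a dense subspace of the essential submodule. -/
lemma GradedBimodule.tendsto_u (v : X.ess.E) :
    Filter.Tendsto (fun N => X.π (p.u N) (X.essIncl v)) Filter.atTop (nhds (X.essIncl v)) := by
  have h : X.essential ≤ (LinearMap.id : X.E →ₗ[ℂ] X.E).range := by simp
  let P : Submodule ℂ X.E :=
    { carrier := {v | Filter.Tendsto (fun N => X.π (p.u N) v) Filter.atTop
        (nhds (ContinuousLinearMap.id ℂ X.E v))}
      add_mem' := fun {a b} ha hb => by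
        simp only [Set.mem_ofPred_eq, map_add] at ha hb ⊢
        exact ha.add hb
      zero_mem' := by simp
      smul_mem' := fun c a ha => by
        simp only [Set.mem_ofPred_eq, map_smul] at ha ⊢
        exact ha.const_smul c }
  have hP : IsClosed (P : Set X.E) := isClosed_setOf_tendsto (C := 1) fun N v =>
    (X.norm_π_apply_le _ _).trans (mul_le_mul_of_nonneg_right (p.norm_sum_le N) (norm_nonneg _))
  have h1 : X.essential ≤ P := by
    refine Submodule.topologicalClosure_minimal _ (Submodule.span_le.2 ?_) hP
    rintro _ ⟨a, u, rfl⟩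
    have h2 := ((X.continuous_π.tendsto a).comp (p.tendsto a))
    refine (((ContinuousLinearMap.apply ℂ X.E u).continuous.tendsto _).comp h2).congr fun N => ?_
    change X.π (p.u N * a) u = X.π (p.u N) (X.π a u)
    rw [map_mul]; rfl
  exact h1 v.2

/-- The partial sums of the compression of `T` to the essential subspace. -/
def GradedBimodule.compressSum (T : X.E →L[ℂ] X.E) (N : ℕ) : X.ess.E →L[ℂ] X.ess.E :=
  ∑ n ∈ Finset.range N, X.corner (p.d n) T (p.d n)

lemma GradedBimodule.essIncl_compressSum (T : X.E →L[ℂ] X.E) (N : ℕ) (v : X.ess.E) :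
    X.essIncl (X.compressSum p T N v) =
      ∑ n ∈ Finset.range N, X.π (p.d n) (T (X.π (p.d n) (X.essIncl v))) := by
  simp [GradedBimodule.compressSum, map_sum]

/-- The left-hand side equals `⟨x, π(u_N) x⟩` in the localization, and `u_N` is a contraction. -/
lemma GradedBimodule.sum_localization_le (χ : B →⋆ₐ[ℂ] ℂ) (N : ℕ) (x : X.E) :
    ∑ n ∈ Finset.range N, ‖localizationMap χ (X.π (p.d n) x)‖ ^ 2 ≤ ‖localizationMap χ x‖ ^ 2 := by
  have h1 : ∀ n, ((‖localizationMap χ (X.π (p.d n) x)‖ ^ 2 : ℝ) : ℂ) =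
      inner ℂ (localizationMap χ x) (localizationMap χ (X.π (p.d n * p.d n) x)) := fun n => by
    rw [Complex.ofReal_pow]
    have := inner_self_eq_norm_sq_to_K (𝕜 := ℂ) (localizationMap χ (X.π (p.d n) x))
    refine Eq.trans this.symm ?_
    rw [localizationMap_inner, localizationMap_inner, X.π_inner, p.star_d, map_mul]
    rfl
  have h2 : ((∑ n ∈ Finset.range N, ‖localizationMap χ (X.π (p.d n) x)‖ ^ 2 : ℝ) : ℂ) =
      inner ℂ (localizationMap χ x) (localizationMap χ (X.π (p.u N) x)) := by
    rw [Complex.ofReal_sum, Finset.sum_congr rfl fun n _ => h1 n, StrictPartition.u, map_sum X.π,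
      sum_apply, map_sum, inner_sum]
  have h3 : ‖localizationMap χ (X.π (p.u N) x)‖ ≤ ‖localizationMap χ x‖ := by
    rw [← X.localization_rep]
    refine ((X.localization χ).norm_rep_le _ _).trans ?_
    exact (mul_le_mul_of_nonneg_right (p.norm_sum_le N) (norm_nonneg _)).trans_eq (one_mul _)
  have h4 := norm_inner_le_norm (𝕜 := ℂ) (localizationMap χ x) (localizationMap χ (X.π (p.u N) x))
  rw [← h2, Complex.norm_real, Real.norm_of_nonneg (Finset.sum_nonneg fun n _ => sq_nonneg _)] at h4
  refine h4.trans ?_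
  rw [sq]
  exact mul_le_mul_of_nonneg_left h3 (norm_nonneg _)

/-- Pair `w = ∑ d_n T d_n y` with itself: `‖w‖² = ∑ ⟨d_n w, T d_n y⟩ ≤ ‖T‖ (∑ ‖d_n w‖²)^(1/2) (∑
‖d_n y‖²)^(1/2)`, and both square sums are bounded by `sum_localization_le`. The Cauchy-Schwarz
inequality is applied in a localization, where the terms are scalars. The bound does not depend on
`N`. -/
lemma GradedBimodule.norm_compressSum_le {T T' : X.E →L[ℂ] X.E} (hT : IsAdjoint B T T') (N : ℕ)
    (v : X.ess.E) : ‖X.compressSum p T N v‖ ≤ ‖T‖ * ‖v‖ := by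
  rw [← X.essIncl_norm, ← X.essIncl_norm]
  refine exists_localization_norm (B := B) _ (by positivity) fun χ => ?_
  set y := X.essIncl v
  have hw := X.essIncl_compressSum p T N v
  set w := X.essIncl (X.compressSum p T N v)
  have hy : ‖localizationMap χ y‖ ≤ ‖y‖ := by
    refine le_of_sq_le_sq ?_ (norm_nonneg _)
    rw [localizationMap_norm_sq, norm_sq_inner B]
    exact NonUnitalStarAlgHom.norm_apply_le χ _
  refine le_trans ?_ (mul_le_mul_of_nonneg_left hy (norm_nonneg T))
  have h1 : ‖localizationMap χ w‖ ^ 2 ≤ ∑ n ∈ Finset.range N, ‖localizationMap χ (X.π (p.d n) w)‖ *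
      (‖T‖ * ‖localizationMap χ (X.π (p.d n) y)‖) := by
    have h2 : inner ℂ (localizationMap χ w) (localizationMap χ w) = ∑ n ∈ Finset.range N,
        inner ℂ (localizationMap χ (X.π (p.d n) w)) (localizationMap χ (T (X.π (p.d n) y))) := by
      conv_lhs => rhs; rw [hw, map_sum]
      rw [inner_sum]
      refine Finset.sum_congr rfl fun n _ => ?_
      rw [localizationMap_inner, localizationMap_inner, X.π_inner, p.star_d]
    have h3 : ‖localizationMap χ w‖ ^ 2 = ‖inner ℂ (localizationMap χ w) (localizationMap χ w)‖ := by
      rw [inner_self_eq_norm_sq_to_K]; simp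
    rw [h3, h2]
    refine (norm_sum_le _ _).trans (Finset.sum_le_sum fun n _ => ?_)
    refine (norm_inner_le_norm _ _).trans (mul_le_mul_of_nonneg_left ?_ (norm_nonneg _))
    refine le_of_sq_le_sq ?_ (by positivity)
    rw [mul_pow, localizationMap_norm_sq, localizationMap_norm_sq]
    exact hT.character_inner_le (norm_nonneg T) T.le_opNorm χ _
  have h5 : ‖localizationMap χ w‖ ^ 2 ≤ ‖T‖ * (‖localizationMap χ w‖ * ‖localizationMap χ y‖) := by
    refine h1.trans ?_
    have h6 := Real.sum_mul_le_sqrt_mul_sqrt (Finset.range N)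
      (fun n => ‖localizationMap χ (X.π (p.d n) w)‖) (fun n => ‖localizationMap χ (X.π (p.d n) y)‖)
    have h7 := Real.sqrt_le_sqrt (X.sum_localization_le p χ N w)
    have h8 := Real.sqrt_le_sqrt (X.sum_localization_le p χ N y)
    rw [Real.sqrt_sq (norm_nonneg _)] at h7 h8
    calc _ = ‖T‖ * ∑ n ∈ Finset.range N, ‖localizationMap χ (X.π (p.d n) w)‖ *
          ‖localizationMap χ (X.π (p.d n) y)‖ := by
          rw [Finset.mul_sum]
          exact Finset.sum_congr rfl fun n _ => by ring
      _ ≤ _ := mul_le_mul_of_nonneg_left (h6.trans (mul_le_mul h7 h8 (Real.sqrt_nonneg _)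
        (norm_nonneg _))) (norm_nonneg _)
  -- The quadratic estimate gives the linear one after cancelling `‖w‖`.
  rcases (norm_nonneg (localizationMap χ w)).eq_or_lt with h0 | h0
  · rw [← h0]; positivity
  · refine le_of_mul_le_mul_left ?_ h0
    calc _ = ‖localizationMap χ w‖ ^ 2 := (sq _).symm
      _ ≤ _ := h5
      _ = _ := by ring

lemma GradedBimodule.dense_span_good :
    Dense (Submodule.span ℂ {v : X.ess.E | ∃ b ∈ p.good, ∃ u, v = X.π₀ b u} : Set X.ess.E) := by
  have h1 : ∀ (a : A) (u : X.E), X.π₀ a u ∈ (Submodule.span ℂ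
      {v : X.ess.E | ∃ b ∈ p.good, ∃ u, v = X.π₀ b u}).topologicalClosure := fun a u =>
    mem_of_dense_span (S := p.good) (p.dense.mono Submodule.subset_span)
      (P := (Submodule.span ℂ {v : X.ess.E | ∃ b ∈ p.good, ∃ u, v = X.π₀ b u}).topologicalClosure.comap
        ((ContinuousLinearMap.apply ℂ X.ess.E u) ∘L X.π₀L).toLinearMap)
      ((Submodule.isClosed_topologicalClosure _).preimage (ContinuousLinearMap.continuous _))
      (fun b hb => Submodule.le_topologicalClosure _ (Submodule.subset_span ⟨b, hb, u, rfl⟩)) a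
  have h2 : ∀ v : X.ess.E, v ∈ (Submodule.span ℂ
      {v : X.ess.E | ∃ b ∈ p.good, ∃ u, v = X.π₀ b u}).topologicalClosure := fun v => by
    have h3 : Filter.Tendsto (fun N => X.π₀ (p.u N) (X.essIncl v)) Filter.atTop (nhds v) :=
      tendsto_subtype_rng.2 (X.tendsto_u p v)
    exact (Submodule.isClosed_topologicalClosure _).mem_of_tendsto h3 (.of_forall fun N => h1 _ _)
  exact h2

/-- On a vector `π(b) u` with `∑ ‖d_n b‖ < ∞` the series converges absolutely; the uniform bound on
the partial sums does the rest. -/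
lemma GradedBimodule.exists_compress {T T' : X.E →L[ℂ] X.E} (hT : IsAdjoint B T T') :
    ∃ S : X.ess.E →L[ℂ] X.ess.E,
      ∀ v, Filter.Tendsto (fun N => X.compressSum p T N v) Filter.atTop (nhds (S v)) := by
  suffices h : ∀ v ∈ {v : X.ess.E | ∃ b ∈ p.good, ∃ u, v = X.π₀ b u},
      ∃ w, Filter.Tendsto (fun N => X.compressSum p T N v) Filter.atTop (nhds w) by
    obtain ⟨S, hS, -⟩ := exists_strong_limit (norm_nonneg T) (X.norm_compressSum_le p hT)
      (X.dense_span_good p) h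
    exact ⟨S, hS⟩
  · rintro v ⟨b, hb, u, rfl⟩
    have h : Summable fun n => X.corner (p.d n) T (p.d n) (X.π₀ b u) := by
      have hb : Summable fun n => ‖p.d n * b‖ := hb
      refine Summable.of_norm_bounded (hb.mul_right (2 * ‖T‖ * ‖u‖)) fun n => ?_
      rw [← X.essIncl_norm, X.essIncl_corner, X.essIncl_π₀, ← mul_apply_eq_comp (X.π _) (X.π b),
        ← map_mul]
      calc _ ≤ ‖p.d n‖ * (‖T‖ * (‖p.d n * b‖ * ‖u‖)) := by
            refine (X.norm_π_apply_le _ _).trans (mul_le_mul_of_nonneg_left ?_ (norm_nonneg _))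
            refine (T.le_opNorm _).trans (mul_le_mul_of_nonneg_left ?_ (norm_nonneg _))
            exact X.norm_π_apply_le _ _
        _ ≤ 2 * (‖T‖ * (‖p.d n * b‖ * ‖u‖)) :=
            mul_le_mul_of_nonneg_right (p.norm_d_le n) (by positivity)
        _ = _ := by ring
    refine ⟨_, h.hasSum.tendsto_sum_nat.congr fun N => ?_⟩
    simp [GradedBimodule.compressSum]

open Classical in
/-- The compression `∑ d T d` of an adjointable operator to the essential subspace. -/
def GradedBimodule.compress (T : X.E →L[ℂ] X.E) : X.ess.E →L[ℂ] X.ess.E :=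
  -- The value `0` is used only if the partial sums have no strong limit, which does not happen for
  -- an adjointable `T`.
  if h : ∃ S : X.ess.E →L[ℂ] X.ess.E,
      ∀ v, Filter.Tendsto (fun N => X.compressSum p T N v) Filter.atTop (nhds (S v))
  then h.choose else 0

lemma GradedBimodule.tendsto_compress {T T' : X.E →L[ℂ] X.E} (hT : IsAdjoint B T T') (v : X.ess.E) :
    Filter.Tendsto (fun N => X.compressSum p T N v) Filter.atTop (nhds (X.compress p T v)) := by
  rw [GradedBimodule.compress, dif_pos (X.exists_compress p hT)]
  exact (X.exists_compress p hT).choose_spec v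

end Compression

/-! ### Comparison of the compression with the original operator modulo compact operators. -/

section CompressedCycle

variable {A : Type*} [NonUnitalCStarAlgebra A] (p : StrictPartition A)
  {B : Type*} [CommCStarAlgebra B] [PartialOrder B] [StarOrderedRing B]
  {G : Type*} [Group G] [TopologicalSpace G] {α : CStarAction G A} (X : GradedBimodule α B)

/-- An absolutely summable series of compact operators converges in norm, and its norm limit has to
coincide with the given strong limit. -/
lemma mem_compactOps_of_summable {E : Type*} [NormedAddCommGroup E] [NormedSpace ℂ E] [SMul B E]
    [CStarModule B E] [CompleteSpace E] {t : ℕ → E →L[ℂ] E} (hs : Summable fun n => ‖t n‖)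
    (ht : ∀ n, t n ∈ compactOps B E) {S : E →L[ℂ] E}
    (hS : ∀ v, Filter.Tendsto (fun N => ∑ n ∈ Finset.range N, t n v) Filter.atTop (nhds (S v))) :
    S ∈ compactOps B E := by
  have h := hs.of_norm.hasSum.tendsto_sum_nat
  have h1 : S = ∑' n, t n := ContinuousLinearMap.ext fun v => by
    refine tendsto_nhds_unique (hS v) ?_
    refine (((ContinuousLinearMap.apply ℂ E v).continuous.tendsto _).comp h).congr fun N => ?_
    simp
  rw [h1]
  exact isClosed_compactOps.mem_of_tendsto h
    (.of_forall fun N => Submodule.sum_mem _ fun n _ => ht n)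

variable {X}

lemma tendsto_ess_iff {ι : Type*} {l : Filter ι} {f : ι → X.ess.E} {v : X.ess.E} :
    Filter.Tendsto f l (nhds v) ↔
      Filter.Tendsto (fun i => X.essIncl (f i)) l (nhds (X.essIncl v)) :=
  tendsto_subtype_rng

lemma ess_ext {S T : X.ess.E →L[ℂ] X.ess.E}
    (h : ∀ v, X.essIncl (S v) = X.essIncl (T v)) : S = T :=
  ContinuousLinearMap.ext fun v => X.essIncl_injective (h v)

variable (X)

lemma GradedBimodule.continuous_corner_left (T : X.E →L[ℂ] X.E) (d : A) :
    Continuous fun c => X.corner c T d :=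
  X.π₀L.continuous.clm_comp continuous_const

lemma GradedBimodule.continuous_corner_right (T : X.E →L[ℂ] X.E) (c : A) :
    Continuous fun d => X.corner c T d := by
  have h := X.continuous_π
  unfold GradedBimodule.corner
  fun_prop

lemma GradedBimodule.continuous_corner (c d : A) : Continuous fun T => X.corner c T d := by
  unfold GradedBimodule.corner
  fun_prop

lemma GradedBimodule.π_mul_apply (a b : A) (u : X.E) : X.π (a * b) u = X.π a (X.π b u) := by
  rw [map_mul]; rfl

variable {X} {T T' : X.E →L[ℂ] X.E}

/-- Inserting `c = ∑ d_n² c` shows that the difference is `∑ π(d_n) [T, π(d_n c)] π(d)`. Each term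
is compact, and the sum converges in norm when `∑ ‖d_n c‖ < ∞`; such `c` are dense. The factor `d`
remains on the right since `π(d)` restricted to the essential submodule is adjointable. -/
lemma compress_mul_sub_mem (hT : IsAdjoint B T T')
    (hc : ∀ a, T * X.π a - X.π a * T ∈ compactOps B X.E) (c d : A) :
    X.compress p T * X.ess.π (c * d) - X.corner c T d ∈ compactOps B X.ess.E := by
  have hcl : IsClosed {c | X.compress p T * X.ess.π (c * d) - X.corner c T d ∈
      compactOps B X.ess.E} := by
    refine isClosed_compactOps.preimage (Continuous.sub ?_ (X.continuous_corner_left T d))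
    exact continuous_const.mul (X.ess.continuous_π.comp (by fun_prop))
  refine (hcl.closure_subset_iff.2 fun c (hcg : Summable fun n => ‖p.d n * c‖) => ?_) (p.dense c)
  refine mem_compactOps_of_summable
    (t := fun n => X.corner (p.d n) (T * X.π (p.d n * c) - X.π (p.d n * c) * T) d) ?_
    (fun n => X.corner_mem_compactOps _ _ (hc _)) fun v => ?_
  · refine Summable.of_nonneg_of_le (fun n => norm_nonneg _) (fun n => ?_)
      (hcg.mul_left (2 * (2 * ‖T‖) * ‖d‖))
    refine (X.norm_corner_le _ _ _).trans ?_
    have h1 : ‖T * X.π (p.d n * c) - X.π (p.d n * c) * T‖ ≤ 2 * ‖T‖ * ‖p.d n * c‖ := by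
      refine (norm_sub_le _ _).trans ?_
      have h2 := (norm_mul_le T (X.π (p.d n * c))).trans
        (mul_le_mul_of_nonneg_left (X.norm_π_le _) (norm_nonneg T))
      have h3 := (norm_mul_le (X.π (p.d n * c)) T).trans
        (mul_le_mul_of_nonneg_right (X.norm_π_le _) (norm_nonneg T))
      linarith
    calc _ ≤ 2 * (2 * ‖T‖ * ‖p.d n * c‖) * ‖d‖ := mul_le_mul_of_nonneg_right
          (mul_le_mul (p.norm_d_le n) h1 (norm_nonneg _) zero_le_two) (norm_nonneg _)
      _ = _ := by ring
  · have h1 := X.tendsto_compress p hT (X.ess.π (c * d) v)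
    have h2 : Filter.Tendsto (fun N => X.corner (p.u N * c) T d v) Filter.atTop
        (nhds (X.corner c T d v)) :=
      (((ContinuousLinearMap.apply ℂ X.ess.E v).continuous.comp
        (X.continuous_corner_left T d)).tendsto c).comp (p.tendsto c)
    refine (h1.sub h2).congr fun N => X.essIncl_injective ?_
    simp only [map_sub, X.essIncl_compressSum, X.essIncl_corner, X.essIncl_π, map_sum,
      StrictPartition.u, Finset.sum_mul, sum_apply, sub_apply, mul_apply_eq_comp, X.π_mul_apply,
      Finset.sum_sub_distrib]

/-- The mirror image: the difference is `∑ π(c) [π(d d_n), T] π(d_n)`. The summability condition of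
the partition concerns `d_n b`, hence the detour through `star d` when density is invoked. -/
lemma mul_compress_sub_mem (hT : IsAdjoint B T T')
    (hc : ∀ a, T * X.π a - X.π a * T ∈ compactOps B X.E) (c d : A) :
    X.ess.π (c * d) * X.compress p T - X.corner c T d ∈ compactOps B X.ess.E := by
  have hcl : IsClosed {d | X.ess.π (c * star d) * X.compress p T - X.corner c T (star d) ∈
      compactOps B X.ess.E} := by
    refine isClosed_compactOps.preimage (Continuous.sub ?_
      ((X.continuous_corner_right T c).comp continuous_star))
    exact (X.ess.continuous_π.comp (by fun_prop)).mul continuous_const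
  rw [← star_star d]
  refine (hcl.closure_subset_iff.2 fun d (hcg : Summable fun n => ‖p.d n * d‖) => ?_)
    (p.dense (star d))
  have hn : ∀ n, ‖star d * p.d n‖ = ‖p.d n * d‖ := fun n => by
    rw [← norm_star, star_mul, star_star, p.star_d]
  refine mem_compactOps_of_summable
    (t := fun n => X.corner c (X.π (star d * p.d n) * T - T * X.π (star d * p.d n)) (p.d n)) ?_
    (fun n => X.corner_mem_compactOps _ _ ?_) fun v => ?_
  · refine Summable.of_nonneg_of_le (fun n => norm_nonneg _) (fun n => ?_)
      (hcg.mul_left (‖c‖ * (2 * ‖T‖) * 2))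
    refine (X.norm_corner_le _ _ _).trans ?_
    have h1 : ‖X.π (star d * p.d n) * T - T * X.π (star d * p.d n)‖ ≤ 2 * ‖T‖ * ‖p.d n * d‖ := by
      rw [← hn]
      refine (norm_sub_le _ _).trans ?_
      have h2 := (norm_mul_le T (X.π (star d * p.d n))).trans
        (mul_le_mul_of_nonneg_left (X.norm_π_le _) (norm_nonneg T))
      have h3 := (norm_mul_le (X.π (star d * p.d n)) T).trans
        (mul_le_mul_of_nonneg_right (X.norm_π_le _) (norm_nonneg T))
      linarith
    calc _ ≤ ‖c‖ * (2 * ‖T‖ * ‖p.d n * d‖) * 2 :=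
          mul_le_mul (mul_le_mul_of_nonneg_left h1 (norm_nonneg _)) (p.norm_d_le n) (norm_nonneg _)
            (by positivity)
      _ = _ := by ring
  · rw [← neg_sub]
    exact neg_mem (hc _)
  · have h1 := ((X.ess.π (c * star d)).continuous.tendsto _).comp (X.tendsto_compress p hT v)
    have h2 : Filter.Tendsto (fun N => X.π₀ c (T (X.π (star d) (X.π (p.u N) (X.essIncl v)))))
        Filter.atTop (nhds (X.corner c T (star d) v)) :=
      (((X.π₀ c).continuous.comp (T.continuous.comp (X.π (star d)).continuous)).tendsto _).comp
        (X.tendsto_u p v)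
    refine (h1.sub h2).congr fun N => X.essIncl_injective ?_
    simp only [map_sub, Function.comp_apply, X.essIncl_compressSum, X.essIncl_corner, X.essIncl_π,
      X.essIncl_π₀, map_sum,
      StrictPartition.u, sum_apply, sub_apply, mul_apply_eq_comp, X.π_mul_apply,
      Finset.sum_sub_distrib]

lemma compress_isAdjoint (hT : IsAdjoint B T T') :
    IsAdjoint B (X.compress p T) (X.compress p T') := by
  intro v w
  have h1 : Filter.Tendsto (fun N => inner B (X.compressSum p T N v) w) Filter.atTop
      (nhds (inner B (X.compress p T v) w)) :=
    ((CStarModule.continuous_inner (A := B) (E := X.ess.E)).tendsto _).comp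
      ((X.tendsto_compress p hT v).prodMk_nhds tendsto_const_nhds)
  have h2 : Filter.Tendsto (fun N => inner B v (X.compressSum p T' N w)) Filter.atTop
      (nhds (inner B v (X.compress p T' w))) :=
    ((CStarModule.continuous_inner (A := B) (E := X.ess.E)).tendsto _).comp
      (tendsto_const_nhds.prodMk_nhds (X.tendsto_compress p hT.symm w))
  refine tendsto_nhds_unique h1 (h2.congr fun N => ?_)
  rw [← X.essIncl_inner, ← X.essIncl_inner, X.essIncl_compressSum, X.essIncl_compressSum,
    CStarModule.inner_sum_right, CStarModule.inner_sum_left]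
  refine Finset.sum_congr rfl fun n _ => ?_
  rw [X.π_inner, p.star_d, hT, X.π_inner, p.star_d]

lemma compress_odd (hT : IsAdjoint B T T') (hodd : ∀ u, X.ε (T u) = -T (X.ε u)) (v : X.ess.E) :
    X.ess.ε (X.compress p T v) = -X.compress p T (X.ess.ε v) := by
  refine tendsto_nhds_unique (((X.ess.ε.continuous.tendsto _).comp (X.tendsto_compress p hT v)))
    ((X.tendsto_compress p hT (X.ess.ε v)).neg.congr fun N => X.essIncl_injective ?_)
  simp only [map_neg, Function.comp_apply, X.essIncl_compressSum, X.essIncl_ε, map_sum, X.π_even,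
    hodd, Finset.sum_neg_distrib]

end CompressedCycle

/-! ### The compressed operator defines a non-degenerate cycle. -/

section NondegenerateCycle

variable {A : Type*} [NonUnitalCStarAlgebra A]
  {B : Type*} [CommCStarAlgebra B] [PartialOrder B] [StarOrderedRing B]
  {G : Type*} [Group G] [TopologicalSpace G] {α : CStarAction G A}

lemma CStarAction.apply_inv (α : CStarAction G A) (g : G) (a : A) :
    α.toAut g (α.toAut g⁻¹ a) = a := by
  have : α.toAut g * α.toAut g⁻¹ = 1 := by rw [← map_mul, mul_inv_cancel, map_one]
  exact DFunLike.congr_fun this a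

lemma CStarAction.apply_mul (α : CStarAction G A) (g h : G) (a : A) :
    α.toAut (g * h) a = α.toAut g (α.toAut h a) := by
  rw [map_mul]; rfl

/-- The adjoint of `x ⟨y, ·⟩` is `y ⟨x, ·⟩`, and passing to adjoints does not increase the norm, so
approximation by finite rank operators is inherited. -/
lemma mem_compactOps_of_isAdjoint {E : Type*} [NormedAddCommGroup E] [NormedSpace ℂ E] [SMul B E]
    [CStarModule B E] {K K' : E →L[ℂ] E} (h : IsAdjoint B K K') (hK : K ∈ compactOps B E) :
    K' ∈ compactOps B E := by
  have h1 : ∀ S ∈ Submodule.span ℂ (rankOneOps B E), ∃ S' ∈ Submodule.span ℂ (rankOneOps B E),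
      IsAdjoint B S S' := by
    intro S hS
    induction hS using Submodule.span_induction with
    | mem S hS =>
      obtain ⟨x, y, hS⟩ := hS
      refine ⟨rankOne B y x, Submodule.subset_span ⟨y, x, fun z => rfl⟩, fun u v => ?_⟩
      rw [hS, rankOne_apply, CStarModule.inner_op_smul_left, CStarModule.inner_op_smul_right,
        CStarModule.star_inner, mul_comm]
    | zero => exact ⟨0, zero_mem _, fun u v => by simp⟩
    | add S T _ _ hS hT =>
      obtain ⟨S', hS', h1⟩ := hS
      obtain ⟨T', hT', h2⟩ := hT
      refine ⟨S' + T', add_mem hS' hT', fun u v => ?_⟩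
      simp only [add_apply, CStarModule.inner_add_left, CStarModule.inner_add_right, h1 u v, h2 u v]
    | smul c S _ hS =>
      obtain ⟨S', hS', h1⟩ := hS
      refine ⟨star c • S', Submodule.smul_mem _ _ hS', fun u v => ?_⟩
      simp only [FunLike.coe_smul, Pi.smul_apply, CStarModule.inner_smul_left_complex,
        CStarModule.inner_smul_right_complex, h1 u v]
  refine Metric.mem_closure_iff.2 fun ε hε => ?_
  obtain ⟨S, hS, hd⟩ := Metric.mem_closure_iff.1 hK ε hε
  obtain ⟨S', hS', hadj⟩ := h1 S hS
  refine ⟨S', hS', ?_⟩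
  rw [dist_eq_norm] at hd ⊢
  have h2 : IsAdjoint B (K - S : E →L[ℂ] E) (K' - S' : E →L[ℂ] E) := fun u v => by
    simp only [sub_apply, CStarModule.inner_sub_left, CStarModule.inner_sub_right, h u v, hadj u v]
  exact (ContinuousLinearMap.opNorm_le_bound _ (norm_nonneg _)
    (h2.norm_le (norm_nonneg _) (K - S).le_opNorm)).trans_lt hd

lemma KasparovCycle.Fadj_comm (x : KasparovCycle α B) (a : A) :
    x.Fadj * x.π a - x.π a * x.Fadj ∈ compactOps B x.E := by
  have h := mem_compactOps_of_isAdjoint (K := x.F * x.π (star a) - x.π (star a) * x.F)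
    (K' := x.π a * x.Fadj - x.Fadj * x.π a) (fun u v => ?_) (x.F_comm (star a))
  · rw [← neg_sub]; exact neg_mem h
  · simp only [sub_apply, CStarModule.inner_sub_left, CStarModule.inner_sub_right,
      mul_apply_eq_comp, x.F_inner, x.π_inner, star_star]

variable (p : StrictPartition A)

/-- Write `F'` for the compression. Modulo compact operators, `cde F' F' ≡ c F de F' ≡ c F d F e ≡ c
d e`. The first two replacements are instances of `mul_compress_sub_mem`; the last one holds since
`F d F - d = [F, d] F + d (F² - 1)`. -/
lemma KasparovCycle.compress_F_sq (x : KasparovCycle α B) (c d e : A) :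
    x.ess.π (c * (d * e)) * (x.compress p x.F * x.compress p x.F - 1) ∈ compactOps B x.ess.E := by
  set G := x.compress p x.F
  have hG : IsAdjoint B G (x.compress p x.Fadj) := compress_isAdjoint p x.F_inner
  have h1 := mul_mem_compactOps_right hG (mul_compress_sub_mem p x.F_inner x.F_comm c (d * e))
  have h2 : (x.π₀ c ∘L x.F ∘L x.essIncl) ∘L (x.ess.π (d * e) * G - x.corner d x.F e) ∘L
      (1 : x.ess.E →L[ℂ] x.ess.E) ∈ compactOps B x.ess.E :=
    comp_mem_compactOps (i' := id)
      (fun b u => by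
        change x.π₀ c (x.F (x.essIncl (b • u))) = b • x.π₀ c (x.F (x.essIncl u))
        rw [x.essIncl_bsmul, x.F_isAdjoint.map_bsmul, x.π₀_bsmul]) (fun _ _ => rfl)
      (mul_compress_sub_mem p x.F_inner x.F_comm d e)
  have h3 : x.F * x.π d * x.F - x.π d ∈ compactOps B x.E := by
    have := add_mem (mul_mem_compactOps_right x.F_inner (x.F_comm d)) (x.F_sq d)
    convert this using 1
    noncomm_ring
  have h4 := x.corner_mem_compactOps c e h3
  convert add_mem (add_mem h1 h2) h4 using 1
  refine ess_ext fun v => ?_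
  simp only [map_sub, map_add, add_apply, sub_apply, mul_apply_eq_comp, one_apply_eq_self,
    ContinuousLinearMap.comp_apply, x.essIncl_corner, x.essIncl_π, x.essIncl_π₀, x.π_mul_apply, G]
  abel

lemma corner_mul_left (X : GradedBimodule α B) (c d e : A) (T : X.E →L[ℂ] X.E) :
    X.corner (c * d) T e = X.corner c (X.π d * T) e :=
  ess_ext fun v => by simp only [X.essIncl_corner, X.π_mul_apply, mul_apply_eq_comp]

/-- Both compressions are replaced by corners, after which the statement becomes the compactness of
`π(d) (F - F*)` between `π(c)` and `π(e)`. -/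
lemma KasparovCycle.compress_F_selfAdj (x : KasparovCycle α B) (c d e : A) :
    x.ess.π (c * (d * e)) * (x.compress p x.F - x.compress p x.Fadj) ∈ compactOps B x.ess.E := by
  rw [← mul_assoc]
  have h1 := mul_compress_sub_mem p x.F_inner x.F_comm (c * d) e
  have h2 := mul_compress_sub_mem p x.F_isAdjoint.symm x.Fadj_comm (c * d) e
  have h3 := x.corner_mem_compactOps c e (x.F_selfAdj d)
  rw [← corner_mul_left] at h3
  convert add_mem (sub_mem h1 h2) h3 using 1
  refine ess_ext fun v => ?_
  simp only [map_sub, map_add, add_apply, sub_apply, mul_apply_eq_comp, x.essIncl_corner,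
    x.essIncl_π]
  abel

/-- On the right, `U_g F' U_g⁻¹` is compared with `U_g F U_g⁻¹` using the coefficients translated by
`g⁻¹`, and `F'` with `F` using the original ones; the middle term is the equivariance defect of `F`.
All three terms are compact, and their dependence on `g` is explicit enough to see norm continuity.
-/
lemma KasparovCycle.compress_F_equivariant_eq (x : KasparovCycle α B) (c d e : A) (g : G) :
    x.ess.π (c * (d * e)) * (x.ess.U g * x.compress p x.F * x.ess.U g⁻¹ - x.compress p x.F) =
      x.ess.U g * (x.ess.π (α.toAut g⁻¹ (c * d) * α.toAut g⁻¹ e) * x.compress p x.F -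
        x.corner (α.toAut g⁻¹ (c * d)) x.F (α.toAut g⁻¹ e)) * x.ess.U g⁻¹ +
      x.corner c (x.π d * (x.U g * x.F * x.U g⁻¹ - x.F)) e -
      (x.ess.π ((c * d) * e) * x.compress p x.F - x.corner (c * d) x.F e) := by
  have h : ∀ a v, x.U g (x.π (α.toAut g⁻¹ a) v) = x.π a (x.U g v) := fun a v => by
    rw [x.π_equivariant, α.apply_inv]
  have h' : ∀ a v, x.U g⁻¹ (x.π a v) = x.π (α.toAut g⁻¹ a) (x.U g⁻¹ v) := fun a v => by
    rw [x.π_equivariant]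
  refine ess_ext fun v => ?_
  simp only [map_sub, map_add, add_apply, sub_apply, mul_apply_eq_comp, x.essIncl_corner,
    x.essIncl_π, x.essIncl_U, x.π_mul_apply, h, h']
  abel

variable [ContinuousInv G]

/-- The first term of the decomposition is a norm continuous family of compact operators, conjugated
by strongly continuous unitaries; compactness makes the conjugated family norm continuous. -/
lemma KasparovCycle.compress_F_continuous (x : KasparovCycle α B) (c d e : A) :
    Continuous fun g => x.ess.π (c * (d * e)) *
      (x.ess.U g * x.compress p x.F * x.ess.U g⁻¹ - x.compress p x.F) := by
  simp only [x.compress_F_equivariant_eq]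
  refine Continuous.sub (Continuous.add ?_ ?_) continuous_const
  · have hc : ∀ a, Continuous fun g => α.toAut g⁻¹ a :=
      fun a => (α.continuous_apply a).comp continuous_inv
    have hK : ∀ g, x.ess.π (α.toAut g⁻¹ (c * d) * α.toAut g⁻¹ e) * x.compress p x.F -
        x.corner (α.toAut g⁻¹ (c * d)) x.F (α.toAut g⁻¹ e) ∈ compactOps B x.ess.E :=
      fun g => mul_compress_sub_mem p x.F_inner x.F_comm _ _
    have hKc : Continuous fun g => x.ess.π (α.toAut g⁻¹ (c * d) * α.toAut g⁻¹ e) *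
        x.compress p x.F - x.corner (α.toAut g⁻¹ (c * d)) x.F (α.toAut g⁻¹ e) := by
      refine Continuous.sub ((x.ess.continuous_π.comp ((hc _).mul (hc _))).mul continuous_const) ?_
      have h1 := x.π₀L.continuous.comp (hc (c * d))
      have h2 := x.continuous_π.comp (hc e)
      exact h1.clm_comp (continuous_const.clm_comp (h2.clm_comp continuous_const))
    refine continuous_compact_mul' (B := B) (V' := fun g => x.ess.U g) (C := 1)
      (fun g => x.ess.norm_U_le _) (fun g => (x.ess.U_isAdjoint g).symm) x.ess.U_continuous
      (fun g => mul_mem_compactOps_left (x.ess.U_isAdjoint g) (hK g)) ?_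
    exact continuous_mul_compact' (B := B) (V' := fun g => x.ess.U g⁻¹) (C := 1)
      (fun g => x.ess.norm_U_le _) (fun g => x.ess.U_isAdjoint g) x.ess.U_continuous hK hKc
  · exact (x.continuous_corner c e).comp (x.F_continuous d)

lemma KasparovCycle.compress_F_equivariant (x : KasparovCycle α B) (c d e : A) (g : G) :
    x.ess.π (c * (d * e)) * (x.ess.U g * x.compress p x.F * x.ess.U g⁻¹ - x.compress p x.F) ∈
      compactOps B x.ess.E := by
  rw [x.compress_F_equivariant_eq]
  refine sub_mem (add_mem ?_ (x.corner_mem_compactOps _ _ (x.F_equivariant d g)))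
    (mul_compress_sub_mem p x.F_inner x.F_comm _ _)
  exact mul_mem_compactOps_right (x.ess.U_isAdjoint g⁻¹) (mul_mem_compactOps_left
    (x.ess.U_isAdjoint g) (mul_compress_sub_mem p x.F_inner x.F_comm _ _))

/-- The restriction of a cycle to its essential subspace. -/
def KasparovCycle.ndeg (x : KasparovCycle α B) : KasparovCycle α B :=
  KasparovCycle.ofDense x.ess (x.compress p x.F) (x.compress p x.Fadj)
    (compress_isAdjoint p x.F_inner) (compress_odd p x.F_inner x.F_odd) p.dense_span_mul_mul
    (by
      rintro _ ⟨c, d, e, rfl⟩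
      convert sub_mem (compress_mul_sub_mem p x.F_inner x.F_comm c (d * e))
        (mul_compress_sub_mem p x.F_inner x.F_comm c (d * e)) using 1
      abel)
    (by
      rintro _ ⟨c, d, e, rfl⟩
      exact x.compress_F_sq p c d e)
    (by
      rintro _ ⟨c, d, e, rfl⟩
      exact x.compress_F_selfAdj p c d e)
    (by
      rintro _ ⟨c, d, e, rfl⟩
      exact x.compress_F_equivariant p c d e)
    (by
      rintro _ ⟨c, d, e, rfl⟩
      exact x.compress_F_continuous p c d e)

/-- The representation of a bimodule is non-degenerate. -/
def GradedBimodule.NonDegenerate (X : GradedBimodule α B) : Prop :=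
  Dense (Submodule.span ℂ {v : X.E | ∃ a u, v = X.π a u} : Set X.E)

lemma GradedBimodule.ess_nonDegenerate (p : StrictPartition A) (X : GradedBimodule α B) :
    X.ess.NonDegenerate := by
  intro v
  refine mem_closure_of_tendsto (f := fun N => X.ess.π (p.u N) v) (b := Filter.atTop)
    (tendsto_ess_iff.2 (X.tendsto_u p v)) (.of_forall fun N => ?_)
  exact Submodule.subset_span ⟨p.u N, v, rfl⟩

end NondegenerateCycle

/-! ### Compression of homotopies. -/

section Evaluation

variable {A : Type*} [NonUnitalCStarAlgebra A] {G : Type*} [Group G] [TopologicalSpace G]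
  {α : CStarAction G A}

lemma KasparovCycle.IsEvaluation.exists_clm {t : I} {W : KasparovCycle α C(I, ℂ)}
    {x : KasparovCycle α ℂ} (h : W.IsEvaluation t x) :
    ∃ q : W.E →L[ℂ] x.E, DenseRange q ∧
      (∀ u v, inner ℂ (q u) (q v) = (inner C(I, ℂ) u v) t) ∧
      (∀ u, q (W.ε u) = x.ε (q u)) ∧
      (∀ g u, q (W.U g u) = x.U g (q u)) ∧
      (∀ a u, q (W.π a u) = x.π a (q u)) ∧
      (∀ u, q (W.F u) = x.F (q u)) := by
  obtain ⟨q, q0, q1, q2, q3, q4, q5⟩ := h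
  refine ⟨q.mkContinuous 1 fun u => ?_, q0, q1, q2, q3, q4, q5⟩
  refine le_of_sq_le_sq ?_ (by positivity)
  rw [norm_sq_inner ℂ, q1, one_mul, norm_sq_inner C(I, ℂ)]
  exact ContinuousMap.norm_coe_le_norm _ t

/-- The same partition is used for the homotopy and for its endpoints, and the evaluation map
intertwines the partial sums `∑ d_n F d_n` term by term, hence also their limits. No complement of
the essential submodule is needed. -/
lemma KasparovCycle.IsEvaluation.ndeg (p : StrictPartition A) [ContinuousInv G] {t : I}
    {W : KasparovCycle α C(I, ℂ)} {x : KasparovCycle α ℂ} (h : W.IsEvaluation t x) :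
    (W.ndeg p).IsEvaluation t (x.ndeg p) := by
  obtain ⟨q, q0, q1, q2, q3, q4, q5⟩ := h.exists_clm
  have hq : ∀ v : W.ess.E, q (W.essIncl v) ∈ x.essential := fun v => by
    have h1 : W.essential ≤ x.essential.comap q.toLinearMap := by
      refine Submodule.topologicalClosure_minimal _ (Submodule.span_le.2 ?_)
        (x.isClosed_essential.preimage q.continuous)
      rintro _ ⟨a, u, rfl⟩
      change q (W.π a u) ∈ x.essential
      rw [q4]
      exact x.π_mem_essential _ _
    exact h1 v.2
  let r : W.ess.E →L[ℂ] x.ess.E := (q ∘L W.essIncl).codRestrict x.essential hq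
  have hr : ∀ v, x.essIncl (r v) = q (W.essIncl v) := fun v => rfl
  refine ⟨r.toLinearMap, ?_, fun u v => q1 _ _, fun u => x.essIncl_injective (q2 _),
    fun g u => x.essIncl_injective (q3 _ _), fun a u => x.essIncl_injective (q4 _ _), fun (v : W.ess.E) => ?_⟩
  · have h1 : ∀ a u, x.π₀ a u ∈ closure (Set.range r) := fun a u => by
      refine q0.induction_on (p := fun u => x.π₀ a u ∈ closure (Set.range r)) u
        (isClosed_closure.preimage (x.π₀ a).continuous) fun w => ?_
      refine subset_closure ⟨W.π₀ a w, x.essIncl_injective ?_⟩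
      rw [hr, W.essIncl_π₀, q4, x.essIncl_π₀]
    exact fun v => isClosed_closure.mem_of_tendsto (f := fun N => x.π₀ (p.u N) (x.essIncl v))
      (b := Filter.atTop) (tendsto_ess_iff.2 (x.tendsto_u p v)) (.of_forall fun N => h1 _ _)
  · change r (W.compress p W.F v) = x.compress p x.F (r v)
    refine tendsto_nhds_unique ((r.continuous.tendsto _).comp (W.tendsto_compress p W.F_inner v))
      ((x.tendsto_compress p x.F_inner (r v)).congr fun N => x.essIncl_injective ?_)
    simp only [Function.comp_apply, hr, x.essIncl_compressSum, W.essIncl_compressSum, map_sum, q4,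
      q5]

end Evaluation

/-! ### Perturbations of the operator that are compact relative to the representation. -/

section Perturbation

variable {A : Type*} [NonUnitalCStarAlgebra A]
  {B : Type*} [CommCStarAlgebra B] [PartialOrder B] [StarOrderedRing B]
  {G : Type*} [Group G] [TopologicalSpace G] [ContinuousInv G] {α : CStarAction G A}

lemma GradedBimodule.π_mul_conj (X : GradedBimodule α B) (a : A) (g : G) (K : X.E →L[ℂ] X.E) :
    X.π a * (X.U g * K * X.U g⁻¹) = X.U g * (X.π (α.toAut g⁻¹ a) * K) * X.U g⁻¹ := by
  refine ContinuousLinearMap.ext fun v => ?_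
  simp only [mul_apply_eq_comp, X.π_equivariant, α.apply_inv]

/-- A perturbation of the operator of a cycle that is compact relative to the representation. -/
def KasparovCycle.perturb (x : KasparovCycle α B) (K K' : x.E →L[ℂ] x.E)
    (hK : IsAdjoint B K K') (hodd : ∀ u, x.ε (K u) = -K (x.ε u))
    (hl : ∀ a, x.π a * K ∈ compactOps B x.E) (hr : ∀ a, K * x.π a ∈ compactOps B x.E) :
    KasparovCycle α B where
  toGradedBimodule := x.toGradedBimodule
  F := x.F + K
  Fadj := x.Fadj + K'
  F_inner u v := by
    simp only [add_apply, CStarModule.inner_add_left, CStarModule.inner_add_right, x.F_inner,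
      hK u v]
  F_odd u := by simp only [add_apply, map_add, x.F_odd, hodd, neg_add]
  F_comm a := by
    convert add_mem (x.F_comm a) (sub_mem (hr a) (hl a)) using 1
    noncomm_ring
  F_sq a := by
    have h1 := mul_mem_compactOps_left x.F_inner (hl a)
    have h2 := mul_mem_compactOps_right hK (x.F_comm a)
    have h3 := mul_mem_compactOps_right x.F_inner (hl a)
    have h4 := mul_mem_compactOps_right hK (hl a)
    convert add_mem (add_mem (add_mem (x.F_sq a) (sub_mem h1 h2)) h3) h4 using 1
    noncomm_ring
  F_selfAdj a := by
    have h1 : x.π a * K' ∈ compactOps B x.E :=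
      mem_compactOps_of_isAdjoint (K := K * x.π (star a)) (fun u v => by
        simp only [mul_apply_eq_comp, hK _ _, x.π_inner, star_star]) (hr (star a))
    convert add_mem (x.F_selfAdj a) (sub_mem (hl a) h1) using 1
    noncomm_ring
  F_equivariant a g := by
    have h1 := mul_mem_compactOps_right (x.U_isAdjoint g⁻¹)
      (mul_mem_compactOps_left (x.U_isAdjoint g) (hl (α.toAut g⁻¹ a)))
    rw [← x.π_mul_conj] at h1
    convert add_mem (x.F_equivariant a g) (sub_mem h1 (hl a)) using 1
    noncomm_ring
  F_continuous a := by
    have hc : Continuous fun g => x.π (α.toAut g⁻¹ a) * K :=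
      (x.continuous_π.comp ((α.continuous_apply a).comp continuous_inv)).mul continuous_const
    have h1 := continuous_mul_compact' (B := B) (C := 1)
      (fun g => x.norm_U_le g) (fun g => x.U_isAdjoint g) x.U_continuous
      (fun g => hl (α.toAut g⁻¹ a)) hc
    have h2 := continuous_compact_mul' (B := B) (C := 1)
      (fun g => x.norm_U_le _) (fun g => (x.U_isAdjoint g).symm) x.U_continuous
      (fun g => mul_mem_compactOps_left (x.U_isAdjoint g) (hl (α.toAut g⁻¹ a))) h1
    refine ((x.F_continuous a).add (h2.sub (continuous_const (y := x.π a * K)))).congr fun g => ?_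
    change x.π a * (x.U g * x.F * x.U g⁻¹ - x.F) +
      (x.U g * (x.π (α.toAut g⁻¹ a) * K) * x.U g⁻¹ - x.π a * K) = _
    rw [← x.π_mul_conj]
    noncomm_ring

/-- The path `t ↦ t` in `ℂ`. -/
def idPath : C(I, ℂ) := ⟨fun t => ((t : ℝ) : ℂ), by fun_prop⟩

lemma constOp_mul_pathOp {H : Type} [NormedAddCommGroup H] [NormedSpace ℂ H] {b : Prop}
    (φ : C(I, ℂ)) (S T : H →L[ℂ] H) :
    (constOp b S * pathOp φ T : PathSpace H b →L[ℂ] PathSpace H b) = pathOp φ (S * T) :=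
  pathOp_congr fun f t => map_smul S (φ t) (T (f t))

lemma pathOp_mul_constOp {H : Type} [NormedAddCommGroup H] [NormedSpace ℂ H] {b : Prop}
    (φ : C(I, ℂ)) (S T : H →L[ℂ] H) :
    (pathOp φ T * constOp b S : PathSpace H b →L[ℂ] PathSpace H b) = pathOp φ (T * S) := rfl

lemma pathOp_odd {H : Type} [NormedAddCommGroup H] [NormedSpace ℂ H] {b : Prop}
    (φ : C(I, ℂ)) {ε K : H →L[ℂ] H} (h : ∀ u, ε (K u) = -K (ε u)) (f : PathSpace H b) :
    constOp b ε (pathOp φ K f) = -pathOp φ K (constOp b ε f) :=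
  PathSpace.ext fun t => by
    change ε (φ t • K (f t)) = -(φ t • K (ε (f t)))
    rw [map_smul, h, smul_neg]

/-- Evaluation of paths. -/
def PathSpace.eval {H : Type} [NormedAddCommGroup H] [NormedSpace ℂ H] (b : Prop) (t : I) :
    PathSpace H b →ₗ[ℂ] H where
  toFun f := f t
  map_add' _ _ := rfl
  map_smul' _ _ := rfl

lemma PathSpace.denseRange_eval {H : Type} [NormedAddCommGroup H] [NormedSpace ℂ H] (t : I) :
    DenseRange (PathSpace.eval False t : PathSpace H False →ₗ[ℂ] H) :=
  Function.Surjective.denseRange fun u =>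
    ⟨PathSpace.mk (fun _ => u) continuous_const False.elim, rfl⟩

lemma idPath_zero : idPath 0 = 0 := Complex.ofReal_zero

lemma idPath_one : idPath 1 = 1 := Complex.ofReal_one

/-- The homotopy is the straight line `F + t K`: the paths `t K` satisfy the same relative
compactness conditions over `C([0,1])`. -/
lemma KasparovCycle.homotopic_perturb (x : KasparovCycle α ℂ) (K K' : x.E →L[ℂ] x.E)
    (hK : IsAdjoint ℂ K K') (hodd : ∀ u, x.ε (K u) = -K (x.ε u))
    (hl : ∀ a, x.π a * K ∈ compactOps ℂ x.E) (hr : ∀ a, K * x.π a ∈ compactOps ℂ x.E) :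
    x.Homotopic (x.perturb K K' hK hodd hl hr) := by
  have h1 : IsAdjoint C(I, ℂ) (E := x.const.E) (E' := x.const.E) (pathOp idPath K)
      (pathOp idPath K') := fun f g => ContinuousMap.ext fun t => by
    have h2 : star (idPath t) = idPath t := Complex.conj_ofReal _
    change inner ℂ (scal (idPath t) (K (PathSpace.toMap (H := x.E) (b := False) f t)))
        (PathSpace.toMap (H := x.E) (b := False) g t) =
      inner ℂ (PathSpace.toMap (H := x.E) (b := False) f t)
        (scal (idPath t) (K' (PathSpace.toMap (H := x.E) (b := False) g t)))
    rw [inner_scal_left, inner_scal_right, hK, h2]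
  refine ⟨x.const.perturb (pathOp idPath K) (pathOp idPath K') h1 (fun f => ?_) (fun a => ?_)
    (fun a => ?_), ?_, ?_⟩
  · exact pathOp_odd idPath hodd f
  · have := pathOp_mem_compactOps idPath (hl a)
    rw [← constOp_mul_pathOp] at this
    exact this
  · have := pathOp_mem_compactOps idPath (hr a)
    rw [← pathOp_mul_constOp] at this
    exact this
  · refine ⟨PathSpace.eval (H := x.E) False 0, PathSpace.denseRange_eval (H := x.E) 0,
      fun u v => rfl, fun u => rfl, fun g u => rfl, fun a u => rfl, fun (f : PathSpace x.E False) => ?_⟩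
    change x.F (f 0) + scal (idPath 0) (K (f 0)) = x.F (f 0)
    rw [idPath_zero, scal_zero, add_zero]
  · refine ⟨PathSpace.eval (H := x.E) False 1, PathSpace.denseRange_eval (H := x.E) 1,
      fun u v => rfl, fun u => rfl, fun g u => rfl, fun a u => rfl, fun (f : PathSpace x.E False) => ?_⟩
    change (show x.E from x.F (f 1) + scal (idPath 1) (K (f 1))) = x.F (f 1) + K (f 1)
    rw [idPath_one, scal_one]

end Perturbation

/-! ### Orthogonal projections in Hilbert modules over `ℂ`. -/

section Projection

variable {H : Type} [NormedAddCommGroup H] [NormedSpace ℂ H] [inst : SMul ℂ H] [CStarModule ℂ H]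

/-- A Hilbert `ℂ`-module is an inner product space. -/
@[reducible] def innerProductSpaceOfCStarModule (H : Type) [NormedAddCommGroup H] [NormedSpace ℂ H]
    [SMul ℂ H] [CStarModule ℂ H] : InnerProductSpace ℂ H :=
  { ‹NormedSpace ℂ H› with
    inner := fun x y => inner ℂ x y
    norm_sq_eq_re_inner := fun x => by
      rw [norm_sq_inner ℂ x]
      obtain ⟨h, h'⟩ := RCLike.nonneg_iff.1 (CStarModule.inner_self_nonneg (A := ℂ) (x := x))
      exact (Complex.abs_re_eq_norm.2 h').symm.trans (abs_of_nonneg h)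
    conj_inner_symm := fun x y => CStarModule.star_inner y x
    add_left := fun x y z => CStarModule.inner_add_left
    smul_left := fun x y c => inner_scal_left c x y }

/-- The orthogonal projection onto a closed subspace of a Hilbert `ℂ`-module. -/
lemma exists_projection [CompleteSpace H] (M : Submodule ℂ H) (hM : IsClosed (M : Set H)) :
    ∃ P : H →L[ℂ] M, ∀ u (v : M), inner ℂ ((P u : M) : H) (v : H) = inner ℂ u (v : H) := by
  letI : InnerProductSpace ℂ H := innerProductSpaceOfCStarModule H
  haveI : CompleteSpace M := hM.completeSpace_coe
  exact ⟨M.orthogonalProjectionOnto, fun u v => M.inner_orthogonalProjectionOnto_eq_of_mem_right v u⟩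

end Projection

/-! ### A cycle over `ℂ` is homotopic to its compression. -/

section EssentialHomotopy

variable {A : Type*} [NonUnitalCStarAlgebra A]
  {G : Type*} [Group G] [TopologicalSpace G] {α : CStarAction G A}

lemma GradedBimodule.exists_essProj (X : GradedBimodule α ℂ) :
    ∃ P : X.E →L[ℂ] X.ess.E, IsAdjoint ℂ P X.essIncl :=
  exists_projection X.essential X.isClosed_essential

variable {X : GradedBimodule α ℂ} {P : X.E →L[ℂ] X.ess.E}

lemma essProj_essIncl (hP : IsAdjoint ℂ P X.essIncl) (v : X.ess.E) : P (X.essIncl v) = v :=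
  ext_inner (B := ℂ) fun z => by rw [← hP.symm, X.essIncl_inner]

/-- The image of `π(a*)` lies in the essential subspace, so `π(a)` vanishes on the orthogonal
complement. -/
lemma π_essProj (hP : IsAdjoint ℂ P X.essIncl) (a : A) (u : X.E) : X.π a (X.essIncl (P u)) = X.π a u :=
  ext_inner (B := ℂ) fun z => by
    have h : X.π (star a) z = X.essIncl (X.π₀ (star a) z) := rfl
    rw [← star_star a, ← X.π_inner, ← X.π_inner, h, X.essIncl_inner, hP.symm]

lemma essProj_π (hP : IsAdjoint ℂ P X.essIncl) (a : A) (u : X.E) : P (X.π a u) = X.π₀ a u := by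
  rw [← X.essIncl_π₀, essProj_essIncl hP]

lemma essProj_ε (hP : IsAdjoint ℂ P X.essIncl) (u : X.E) : P (X.ε u) = X.ess.ε (P u) :=
  ext_inner (B := ℂ) fun z => by
    rw [← hP.symm, ← X.ess.ε_inner, ← hP.symm, X.essIncl_ε, X.ε_inner]

lemma essProj_U (hP : IsAdjoint ℂ P X.essIncl) (g : G) (u : X.E) : P (X.U g u) = X.ess.U g (P u) :=
  ext_inner (B := ℂ) fun z => by
    rw [← hP.symm, ← (X.ess.U_isAdjoint g).symm, ← hP.symm, X.essIncl_U,
      ← (X.U_isAdjoint g).symm]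

variable (X) in
/-- Paths that end in the essential subspace. -/
def GradedBimodule.conePaths : Submodule ℂ (X.path False).E :=
  X.essential.comap (PathSpace.eval (H := X.E) False 1)

variable (X) in
/-- The bimodule of paths that end in the essential subspace. -/
def GradedBimodule.cone : GradedBimodule α C(I, ℂ) :=
  (X.path False).restrict X.conePaths
    (X.isClosed_essential.preimage
      ((ContinuousEvalConst.continuous_eval_const (F := C(I, X.E)) 1).comp continuous_subtype_val))
    (fun φ f hf => by
      change scal (φ 1) (PathSpace.toMap (H := X.E) (b := False) f 1) ∈ X.essential
      exact X.essential.smul_mem _ hf)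
    (fun f hf => (X.ess.ε ⟨_, hf⟩).2) (fun g f hf => (X.ess.U g ⟨_, hf⟩).2)
    (fun a f hf => (X.ess.π a ⟨_, hf⟩).2)

/-- An operator on the essential subspace as an operator on the cone. -/
def coneOp (P : X.E →L[ℂ] X.ess.E) (T : X.ess.E →L[ℂ] X.ess.E) : X.cone.E →L[ℂ] X.cone.E :=
  restrictOp X.conePaths (constOp False (X.essIncl ∘L T ∘L P)) fun f hf => (T (P _)).2

variable (X) in
/-- Evaluation of elements of the cone. -/
def coneEval (t : I) : X.cone.E →ₗ[ℂ] X.E := PathSpace.eval (H := X.E) False t ∘ₗ X.conePaths.subtype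

lemma coneEval_coneOp (T : X.ess.E →L[ℂ] X.ess.E) (f : X.cone.E) (t : I) :
    coneEval X t (coneOp P T f) = X.essIncl (T (P (coneEval X t f))) := rfl

lemma cone_ext {f g : X.cone.E} (h : ∀ t, coneEval X t f = coneEval X t g) : f = g :=
  Subtype.ext (PathSpace.ext (H := X.E) (b := False) h)

lemma coneOp_ext {S T : X.cone.E →L[ℂ] X.cone.E}
    (h : ∀ f t, coneEval X t (S f) = coneEval X t (T f)) : S = T :=
  ContinuousLinearMap.ext fun f => cone_ext (h f)

lemma coneEval_ε (f : X.cone.E) (t : I) :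
    coneEval X t (X.cone.ε f) = X.ε (coneEval X t f) := rfl

/-- `coneOp` as a linear map. -/
def coneOpLinear (P : X.E →L[ℂ] X.ess.E) :
    (X.ess.E →L[ℂ] X.ess.E) →ₗ[ℂ] (X.cone.E →L[ℂ] X.cone.E) where
  toFun := coneOp P
  map_add' S T := coneOp_ext fun f t => by simp [coneEval_coneOp]
  map_smul' c T := coneOp_ext fun f t =>
    X.essIncl.toLinearMap.map_smul c (T (P (coneEval X t f)))

lemma coneOpLinear_continuous : Continuous (coneOpLinear P) := by
  refine ((coneOpLinear P).mkContinuous ‖P‖ fun T => ?_).continuous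
  refine ContinuousLinearMap.opNorm_le_bound _ (by positivity) fun f => ?_
  refine (PathSpace.norm_le (H := X.E) (b := False) (f := (coneOp P T f).1) (by positivity)).2
    fun t => ?_
  change ‖T (P (coneEval X t f))‖ ≤ _
  calc _ ≤ ‖T‖ * (‖P‖ * ‖f‖) := by
        refine (T.le_opNorm _).trans (mul_le_mul_of_nonneg_left ?_ (norm_nonneg _))
        refine (P.le_opNorm _).trans (mul_le_mul_of_nonneg_left ?_ (norm_nonneg _))
        exact PathSpace.apply_le (H := X.E) (b := False) f.1 t
    _ = _ := by ring

/-- A rank one operator on the essential subspace goes to the rank one operator of two constant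
paths. Such constant paths end in the essential subspace and so belong to the cone. -/
lemma coneOp_mem_compactOps (hP : IsAdjoint ℂ P X.essIncl)
    {T : X.ess.E →L[ℂ] X.ess.E} (hT : T ∈ compactOps ℂ X.ess.E) :
    coneOp P T ∈ compactOps C(I, ℂ) X.cone.E := by
  refine map_mem_compactOps (coneOpLinear P) coneOpLinear_continuous ?_ hT
  rintro S ⟨x, y, hS⟩
  let c : X.ess.E → X.cone.E := fun v =>
    ⟨PathSpace.mk (H := X.E) (b := False) (fun _ => X.essIncl v) continuous_const False.elim, v.2⟩
  refine ⟨c x, c y, fun f => cone_ext fun t => ?_⟩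
  change X.essIncl (S (P (coneEval X t f))) =
    scal (inner ℂ (X.essIncl y) (coneEval X t f)) (X.essIncl x)
  rw [hS, hP.symm, ← complex_smul_eq]
  rfl

variable {p : StrictPartition A} [ContinuousInv G] {x : KasparovCycle α ℂ}
  {P : x.E →L[ℂ] x.ess.E}

/-- Write `ι` for the inclusion and `F'` for the compression. Since `π(d) ι P = π(d)`, one has
`π(cd) (ι F' P - F) = ι (π(cd) F' - π(c) F π(d)) P + π(c) [F, π(d)]`, and both summands are compact.
-/
lemma essential_perturbation_left (hP : IsAdjoint ℂ P x.essIncl) (a : A) :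
    x.π a * (x.essIncl ∘L x.compress p x.F ∘L P - x.F) ∈ compactOps ℂ x.E := by
  refine x.mul_mem_compactOps_of_dense p.dense_span_mul ?_ a
  rintro _ ⟨c, d, rfl⟩
  have h1 : x.essIncl ∘L (x.ess.π (c * d) * x.compress p x.F - x.corner c x.F d) ∘L P ∈
      compactOps ℂ x.E :=
    comp_mem_compactOps (fun _ _ => rfl) hP (mul_compress_sub_mem p x.F_inner x.F_comm c d)
  have h2 := mul_mem_compactOps_left (x.π_isAdjoint c) (x.F_comm d)
  convert add_mem h1 h2 using 1
  refine ContinuousLinearMap.ext fun u => ?_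
  simp only [mul_apply_eq_comp, sub_apply, add_apply, ContinuousLinearMap.comp_apply, map_sub,
    x.essIncl_corner, x.essIncl_π, x.π_mul_apply, π_essProj hP]
  abel

/-- The perturbation commutes with `π(a)` modulo compact operators because both the compression and
`F` do, so the left-handed statement implies this one. -/
lemma essential_perturbation_right (hP : IsAdjoint ℂ P x.essIncl) (a : A) :
    (x.essIncl ∘L x.compress p x.F ∘L P - x.F) * x.π a ∈ compactOps ℂ x.E := by
  have hcomm : ∀ a, (x.essIncl ∘L x.compress p x.F ∘L P - x.F) * x.π a -
      x.π a * (x.essIncl ∘L x.compress p x.F ∘L P - x.F) ∈ compactOps ℂ x.E := fun a => by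
    have h1 : x.essIncl ∘L (x.compress p x.F * x.ess.π a - x.ess.π a * x.compress p x.F) ∘L P ∈
        compactOps ℂ x.E :=
      comp_mem_compactOps (fun _ _ => rfl) hP ((x.ndeg p).F_comm a)
    convert sub_mem h1 (x.F_comm a) using 1
    refine ContinuousLinearMap.ext fun u => ?_
    have h2 : x.π₀ a u = x.ess.π a (P u) := x.essIncl_injective <| by
      rw [x.essIncl_π₀, x.essIncl_π, π_essProj hP]
    change x.essIncl (x.compress p x.F (P (x.π a u))) - x.F (x.π a u) -
      x.π a (x.essIncl (x.compress p x.F (P u)) - x.F u) =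
      x.essIncl (x.compress p x.F (x.ess.π a (P u)) - x.ess.π a (x.compress p x.F (P u))) -
        (x.F (x.π a u) - x.π a (x.F u))
    rw [essProj_π hP, h2]
    simp only [map_sub, x.essIncl_π]
    abel
  have h := add_mem (hcomm a) (essential_perturbation_left (p := p) hP a)
  rwa [sub_add_cancel] at h

lemma essProj_π_ess (hP : IsAdjoint ℂ P x.essIncl) (a : A) (u : x.E) :
    P (x.π a u) = x.ess.π a (P u) :=
  x.essIncl_injective <| by
    rw [essProj_π hP, x.essIncl_π₀, x.essIncl_π, π_essProj hP]

lemma coneOp_conj (hP : IsAdjoint ℂ P x.essIncl) (a : A) (g : G) :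
    x.cone.π a * (x.cone.U g * coneOp P (x.compress p x.F) * x.cone.U g⁻¹ -
      coneOp P (x.compress p x.F)) =
    coneOp P (x.ess.π a * (x.ess.U g * x.compress p x.F * x.ess.U g⁻¹ - x.compress p x.F)) := by
  refine coneOp_ext fun f t => ?_
  change x.π a (x.U g (x.essIncl (x.compress p x.F (P (x.U g⁻¹ (coneEval _ t f))))) -
      x.essIncl (x.compress p x.F (P (coneEval _ t f)))) =
    x.essIncl (x.ess.π a (x.ess.U g (x.compress p x.F (x.ess.U g⁻¹ (P (coneEval _ t f)))) -
      x.compress p x.F (P (coneEval _ t f))))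
  rw [essProj_U hP, x.essIncl_π, map_sub x.essIncl, x.essIncl_U]

/-- The homotopy from the compression of a cycle, as a cycle on the whole module, to the restriction
to the essential subspace. -/
def coneCycle (p : StrictPartition A) (x : KasparovCycle α ℂ) {P : x.E →L[ℂ] x.ess.E}
    (hP : IsAdjoint ℂ P x.essIncl) : KasparovCycle α C(I, ℂ) where
  toGradedBimodule := x.cone
  F := coneOp P (x.compress p x.F)
  Fadj := coneOp P (x.compress p x.Fadj)
  F_inner f g := ContinuousMap.ext fun t => by
    change inner ℂ (x.essIncl (x.compress p x.F (P (coneEval _ t f)))) (coneEval _ t g) =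
      inner ℂ (coneEval _ t f) (x.essIncl (x.compress p x.Fadj (P (coneEval _ t g))))
    rw [hP.symm, compress_isAdjoint p x.F_inner, ← hP]
  F_odd f := cone_ext fun t => by
    rw [map_neg, coneEval_ε, coneEval_coneOp, coneEval_coneOp, coneEval_ε, essProj_ε hP,
      ← x.essIncl_ε, ← map_neg]
    exact congrArg x.essIncl ((x.ndeg p).F_odd _)
  F_comm a := by
    convert coneOp_mem_compactOps hP ((x.ndeg p).F_comm a) using 1
    refine coneOp_ext fun f t => ?_
    change x.essIncl (x.compress p x.F (P (x.π a (coneEval _ t f)))) -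
      x.π a (x.essIncl (x.compress p x.F (P (coneEval _ t f)))) =
      x.essIncl (x.compress p x.F (x.ess.π a (P (coneEval _ t f))) -
        x.ess.π a (x.compress p x.F (P (coneEval _ t f))))
    rw [essProj_π_ess hP, map_sub, x.essIncl_π]
  F_sq a := by
    convert coneOp_mem_compactOps hP ((x.ndeg p).F_sq a) using 1
    refine coneOp_ext fun f t => ?_
    change x.π a (x.essIncl (x.compress p x.F (P (x.essIncl (x.compress p x.F
        (P (coneEval _ t f)))))) - coneEval _ t f) =
      x.essIncl (x.ess.π a (x.compress p x.F (x.compress p x.F (P (coneEval _ t f))) -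
        P (coneEval _ t f)))
    rw [essProj_essIncl hP, x.essIncl_π, map_sub, map_sub, map_sub, π_essProj hP]
  F_selfAdj a := by
    convert coneOp_mem_compactOps hP ((x.ndeg p).F_selfAdj a) using 1
    refine coneOp_ext fun f t => ?_
    change x.π a (x.essIncl (x.compress p x.F (P (coneEval _ t f))) -
        x.essIncl (x.compress p x.Fadj (P (coneEval _ t f)))) =
      x.essIncl (x.ess.π a (x.compress p x.F (P (coneEval _ t f)) -
        x.compress p x.Fadj (P (coneEval _ t f))))
    rw [x.essIncl_π, map_sub x.essIncl]
  F_equivariant a g := by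
    convert coneOp_mem_compactOps hP ((x.ndeg p).F_equivariant a g) using 1
    exact coneOp_conj hP a g
  F_continuous a :=
    ((coneOpLinear_continuous (P := P)).comp ((x.ndeg p).F_continuous a)).congr fun g =>
      (coneOp_conj hP a g).symm

lemma PathSpace.exists_affine {H : Type} [NormedAddCommGroup H] [NormedSpace ℂ H] (u : H) :
    ∃ f : PathSpace H False, f 0 = u ∧ f 1 = 0 := by
  refine ⟨PathSpace.mk (fun t => scal (1 - idPath t) u)
    (scal_continuous (1 - idPath) u) False.elim, ?_, ?_⟩
  · change scal (1 - idPath 0) u = u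
    rw [idPath_zero, sub_zero, scal_one]
  · change scal (1 - idPath 1) u = 0
    rw [idPath_one, sub_self, scal_zero]

/-- Two homotopies are joined. The first replaces `F` by `ι F' P` on the same space, a relatively
compact perturbation. The second lives on the paths that end in the essential subspace: at `0` one
sees the whole space with `ι F' P`, at `1` the essential subspace with `F'`. It satisfies the
conditions even though `ι F' P` vanishes on the complement, because the representation vanishes
there as well. -/
lemma KasparovCycle.homotopic_ndeg (p : StrictPartition A) (x : KasparovCycle α ℂ) :
    KK.mk x = KK.mk (x.ndeg p) := by
  obtain ⟨P, hP⟩ := x.exists_essProj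
  have hadj : IsAdjoint ℂ (x.essIncl ∘L x.compress p x.F ∘L P - x.F : x.E →L[ℂ] x.E)
      (x.essIncl ∘L x.compress p x.Fadj ∘L P - x.Fadj : x.E →L[ℂ] x.E) := fun u v => by
    simp only [sub_apply, ContinuousLinearMap.comp_apply, CStarModule.inner_sub_left,
      CStarModule.inner_sub_right, x.F_inner]
    rw [hP.symm, compress_isAdjoint p x.F_inner, ← hP]
  have hodd : ∀ u, x.ε ((x.essIncl ∘L x.compress p x.F ∘L P - x.F) u) =
      -(x.essIncl ∘L x.compress p x.F ∘L P - x.F) (x.ε u) := fun u => by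
    simp only [sub_apply, ContinuousLinearMap.comp_apply, map_sub, x.F_odd, ← x.essIncl_ε,
      compress_odd p x.F_inner x.F_odd, essProj_ε hP, map_neg]
    abel
  have h1 := x.homotopic_perturb _ _ hadj hodd (essential_perturbation_left hP)
    (essential_perturbation_right hP)
  refine (KK.sound h1).trans (KK.sound ⟨coneCycle p x hP, ⟨coneEval x.toGradedBimodule 0, ?_,
    fun u v => rfl, fun u => rfl, fun g u => rfl, fun a u => rfl, fun f => ?_⟩,
    ⟨(coneEval x.toGradedBimodule 1).codRestrict x.essential fun f => f.2, ?_,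
    fun u v => rfl, fun u => rfl, fun g u => rfl, fun a u => rfl, fun f => ?_⟩⟩)
  · refine Function.Surjective.denseRange fun u => ?_
    obtain ⟨f, h0, h1⟩ := PathSpace.exists_affine (H := x.E) u
    exact ⟨⟨f, (congrArg (· ∈ x.essential) h1).mpr (zero_mem _)⟩, h0⟩
  · exact (add_sub_cancel (x.F (coneEval _ 0 f)) _).symm
  · exact Function.Surjective.denseRange fun v =>
      ⟨⟨PathSpace.mk (H := x.E) (b := False) (fun _ => x.essIncl v) continuous_const False.elim,
        v.2⟩, rfl⟩
  · exact congrArg (x.compress p x.F) (essProj_essIncl hP ⟨coneEval x.toGradedBimodule 1 f, f.2⟩)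

end EssentialHomotopy

/-! ### Existence of strict partitions in separable algebras. -/

section PartitionExistence

/-- The canonical approximate unit runs along the positive elements of the open unit ball, and
eventually it dominates any given one of them; so both requirements hold eventually. -/
lemma exists_contraction_ge {A : Type*} [NonUnitalCStarAlgebra A] [PartialOrder A]
    [StarOrderedRing A] (u : A) (hu : 0 ≤ u ∧ ‖u‖ < 1) (s : Finset A) {ε : ℝ} (hε : 0 < ε) :
    ∃ v : A, (0 ≤ v ∧ ‖v‖ < 1) ∧ u ≤ v ∧ ∀ a ∈ s, ‖v * a - a‖ < ε := by
  have hb := CStarAlgebra.hasBasis_approximateUnit A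
  have h1 : ∀ᶠ v in CStarAlgebra.approximateUnit A, u ≤ v :=
    Filter.mem_of_superset (hb.mem_of_mem hu) fun v hv => hv.1
  have h2 : ∀ᶠ v in CStarAlgebra.approximateUnit A, ∀ a ∈ s, ‖v * a - a‖ < ε := by
    refine (Filter.eventually_all_finset s).2 fun a _ => ?_
    have := (CStarAlgebra.increasingApproximateUnit A).tendsto_mul_right a
    filter_upwards [Metric.tendsto_nhds.1 this ε hε] with v hv
    rwa [dist_eq_norm] at hv
  obtain ⟨v, hv, hs⟩ := hb.mem_iff.1 (h1.and h2)
  have h3 := hs ⟨le_refl v, by simpa using hv.2.le⟩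
  exact ⟨v, hv, h3.1, h3.2⟩

/-- A separable `C*`-algebra has a strict partition. -/
lemma exists_strictPartition (A : Type*) [NonUnitalCStarAlgebra A]
    [TopologicalSpace.SeparableSpace A] : Nonempty (StrictPartition A) := by
  classical
  letI : PartialOrder A := CStarAlgebra.spectralOrder A
  haveI : StarOrderedRing A := CStarAlgebra.spectralOrderedRing A
  let a := TopologicalSpace.denseSeq A
  choose step hstep hle hlt using fun (u : {u : A // 0 ≤ u ∧ ‖u‖ < 1}) (n : ℕ) =>
    exists_contraction_ge u.1 u.2 ((Finset.range (n + 1)).image a)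
      (show (0 : ℝ) < (1 / 4) ^ n by positivity)
  -- An increasing sequence is built such that `w (n + 1)` fixes the first `n + 1` members of a
  -- dense sequence up to `4⁻ⁿ`.
  let w : ℕ → {u : A // 0 ≤ u ∧ ‖u‖ < 1} := fun n =>
    Nat.rec ⟨0, le_rfl, by simp⟩ (fun n u => ⟨step u n, hstep u n⟩) n
  have hw : ∀ n, (w n).1 ≤ (w (n + 1)).1 := fun n => hle (w n) n
  have hwa : ∀ k n, k ≤ n → ‖(w (n + 1)).1 * a k - a k‖ < (1 / 4) ^ n := fun k n hk =>
    hlt (w n) n (a k) (Finset.mem_image_of_mem _ (Finset.mem_range.2 (by omega)))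
  -- Square roots of the increments: the sums of `d n * d n` telescope to `w N`, because the
  -- recursion starts at `0`.
  let d : ℕ → A := fun n => CFC.sqrt ((w (n + 1)).1 - (w n).1)
  have hd : ∀ n, d n * d n = (w (n + 1)).1 - (w n).1 := fun n =>
    CFC.sqrt_mul_sqrt_self _ (sub_nonneg.2 (hw n))
  have hsd : ∀ n, star (d n) = d n := fun n =>
    (IsSelfAdjoint.of_nonneg (CFC.sqrt_nonneg _)).star_eq
  have hsum : ∀ N, ∑ n ∈ Finset.range N, d n * d n = (w N).1 := fun N => by
    simp only [hd]
    rw [Finset.sum_range_sub (fun n => (w n).1)]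
    exact sub_zero _
  have hdense : Dense (Set.range a) := TopologicalSpace.denseRange_denseSeq A
  refine ⟨⟨d, hsd, fun N => ?_, fun b => ?_, ?_⟩⟩
  · rw [hsum]; exact (w N).2.2.le
  · simp only [hsum]
    have hc := isClosed_setOf_tendsto (T := fun N => ContinuousLinearMap.mul ℂ A (w N).1)
      (S := ContinuousLinearMap.id ℂ A) (C := 1) fun N v => by
        refine (norm_mul_le _ _).trans (mul_le_mul_of_nonneg_right (w N).2.2.le (norm_nonneg _))
    refine hc.closure_subset_iff.2 ?_ (hdense b)
    rintro _ ⟨k, rfl⟩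
    refine (Filter.tendsto_add_atTop_iff_nat (k + 1)).1 (tendsto_iff_norm_sub_tendsto_zero.2 ?_)
    refine squeeze_zero (fun n => norm_nonneg _) (fun n => (hwa k (n + k) (by omega)).le) ?_
    exact (tendsto_pow_atTop_nhds_zero_of_lt_one (by norm_num) (by norm_num)).comp
      (Filter.tendsto_add_atTop_nat k)
  · refine hdense.mono ?_
    rintro _ ⟨k, rfl⟩
    rw [Set.mem_ofPred_eq, ← summable_nat_add_iff (k + 1)]
    refine Summable.of_nonneg_of_le (fun n => norm_nonneg _) (fun n => ?_)
      ((summable_geometric_of_lt_one (r := 1 / 2) (by norm_num) (by norm_num)).mul_left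
        (Real.sqrt (5 * ‖a k‖)))
    -- By the `C*`-identity, `‖d a‖² ≤ ‖a‖ ‖d² a‖`, and `d²` is an increment of `w`. The shift by `k
    -- + 1` ensures that both ends of the increment already almost fix `a k`. The rate `4⁻ⁿ` leaves
    -- a geometric series of ratio `1/2` after taking the square root; the factor `5` is generous.
    have h1 : ‖d (n + (k + 1)) * a k‖ ^ 2 ≤ 5 * ‖a k‖ * ((1 / 2) ^ n) ^ 2 := by
      rw [sq, ← CStarRing.norm_star_mul_self, star_mul, hsd, mul_assoc, ← mul_assoc (d _), hd,
        sub_mul]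
      refine (norm_mul_le _ _).trans ?_
      rw [norm_star]
      have h2 := (hwa k (n + (k + 1)) (by omega)).le
      have h3 := (hwa k (n + k) (by omega)).le
      have h4 : ‖(w (n + (k + 1) + 1)).1 * a k - (w (n + (k + 1))).1 * a k‖ ≤
          5 * ((1 / 2) ^ n) ^ 2 := by
        have h5 : ∀ m, n ≤ m → ((1 / 4 : ℝ)) ^ m ≤ ((1 / 2) ^ n) ^ 2 := fun m hm => by
          rw [← pow_mul, mul_comm n, pow_mul]
          refine (pow_le_pow_of_le_one (by norm_num) (by norm_num) hm).trans_eq (by norm_num)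
        rw [← sub_sub_sub_cancel_right _ _ (a k)]
        refine (norm_sub_le _ _).trans ?_
        have := h2.trans (h5 _ (by omega))
        have := h3.trans (h5 _ (by omega))
        have h6 : (w (n + (k + 1))).1 = (w (n + k + 1)).1 := rfl
        rw [h6]
        have : 0 ≤ (((1 : ℝ) / 2) ^ n) ^ 2 := by positivity
        linarith
      calc ‖a k‖ * _ ≤ ‖a k‖ * (5 * ((1 / 2) ^ n) ^ 2) := by gcongr
        _ = _ := by ring
    refine le_of_sq_le_sq (h1.trans_eq ?_) (by positivity)
    rw [mul_pow, Real.sq_sqrt (by positivity)]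

end PartitionExistence

/-! ### The central circle and the projection onto the vectors of weight one. -/

section CircleProjection

variable {Γ Γτ : Type*} [Group Γ] [TopologicalSpace Γ] [DiscreteTopology Γ]
  [Group Γτ] [TopologicalSpace Γτ] (e : CircleExtension Γ Γτ)

lemma CircleExtension.proj_eq_one_iff {g : Γτ} : e.proj g = 1 ↔ ∃ z, e.incl z = g :=
  e.isSES.mulExact g

lemma CircleExtension.proj_incl (z : Circle) : e.proj (e.incl z) = 1 :=
  e.proj_eq_one_iff.2 ⟨z, rfl⟩

lemma CircleExtension.incl_injective : Function.Injective e.incl :=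
  e.isSES.isClosedEmbedding.injective

/-- The circle is the preimage of a point of the discrete group `Γ`. Together with compactness this
makes functions on the circle, extended by zero, continuous with compact support on `Γτ`. -/
lemma CircleExtension.isOpen_range : IsOpen (Set.range e.incl) := by
  have h : Set.range e.incl = e.proj ⁻¹' {1} := by
    ext g
    exact e.proj_eq_one_iff.symm
  rw [h]
  exact (isOpen_discrete _).preimage e.isSES.isOpenQuotientMap.continuous

lemma CircleExtension.isCompact_range_incl : IsCompact (Set.range e.incl) :=
  isCompact_range e.isSES.isClosedEmbedding.continuous

/-- The function `incl z ↦ z⁻¹`, extended by zero. -/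
def CircleExtension.kernel (g : Γτ) : ℂ :=
  Function.extend e.incl (fun z => ((z⁻¹ : Circle) : ℂ)) 0 g

lemma CircleExtension.kernel_incl (z : Circle) : e.kernel (e.incl z) = ((z⁻¹ : Circle) : ℂ) :=
  e.incl_injective.extend_apply _ _ _

lemma CircleExtension.kernel_eq_zero {g : Γτ} (hg : e.proj g ≠ 1) : e.kernel g = 0 :=
  Function.extend_apply' _ _ _ fun h => hg (e.proj_eq_one_iff.2 h)

lemma CircleExtension.kernel_incl_mul (z : Circle) (g : Γτ) :
    e.kernel (e.incl z * g) = ((z⁻¹ : Circle) : ℂ) * e.kernel g := by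
  by_cases hg : e.proj g = 1
  · obtain ⟨w, rfl⟩ := e.proj_eq_one_iff.1 hg
    rw [← map_mul, e.kernel_incl, e.kernel_incl, mul_inv, Circle.coe_mul]
  · rw [e.kernel_eq_zero hg, e.kernel_eq_zero, mul_zero]
    rwa [map_mul, e.proj_incl, one_mul]

lemma CircleExtension.norm_kernel (g : Γτ) :
    ‖e.kernel g‖ = (Set.range e.incl).indicator (fun _ => (1 : ℝ)) g := by
  by_cases hg : g ∈ Set.range e.incl
  · rw [Set.indicator_of_mem hg]
    obtain ⟨w, rfl⟩ := hg
    rw [e.kernel_incl, Circle.norm_coe]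
  · rw [Set.indicator_of_notMem hg, e.kernel_eq_zero (fun h => hg (e.proj_eq_one_iff.1 h)),
      norm_zero]

lemma CircleExtension.continuous_kernel : Continuous e.kernel := by
  have hemb : Topology.IsOpenEmbedding e.incl :=
    ⟨e.isSES.isClosedEmbedding.isEmbedding, e.isOpen_range⟩
  refine continuous_iff_continuousAt.2 fun g => ?_
  by_cases hg : g ∈ Set.range e.incl
  · obtain ⟨w, rfl⟩ := hg
    refine hemb.continuousAt_iff.1 ?_
    have h : e.kernel ∘ e.incl = fun z => ((z⁻¹ : Circle) : ℂ) := funext e.kernel_incl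
    rw [h]
    exact (by fun_prop : Continuous fun z : Circle => ((z⁻¹ : Circle) : ℂ)).continuousAt
  · refine continuousAt_const.congr (f := fun _ => (0 : ℂ)) ?_
    filter_upwards [e.isSES.isClosedEmbedding.isClosed_range.isOpen_compl.mem_nhds hg] with h hh
    exact (e.kernel_eq_zero fun h1 => hh (e.proj_eq_one_iff.1 h1)).symm

lemma CircleExtension.hasCompactSupport_kernel : HasCompactSupport e.kernel :=
  HasCompactSupport.intro' e.isCompact_range_incl e.isSES.isClosedEmbedding.isClosed_range fun g hg =>
    e.kernel_eq_zero fun h => hg (e.proj_eq_one_iff.1 h)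

/-- A strongly continuous representation by contractions. -/
structure ContractiveRep (G V : Type*) [Group G] [TopologicalSpace G] [NormedAddCommGroup V]
    [NormedSpace ℂ V] where
  U : G →* (V →L[ℂ] V)
  norm_le : ∀ g v, ‖U g v‖ ≤ ‖v‖
  continuous : ∀ v, Continuous fun g => U g v

variable {e} [IsTopologicalGroup Γτ] [MeasurableSpace Γτ] [BorelSpace Γτ]
  {V W : Type*} [NormedAddCommGroup V] [NormedSpace ℂ V] [NormedAddCommGroup W] [NormedSpace ℂ W]
  (μ : Measure Γτ) [μ.IsHaarMeasure]

lemma integrable_kernel_smul (γ : Γτ) {f : Γτ → V} (hf : Continuous f) :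
    Integrable (fun g => e.kernel (γ * g) • f g) μ := by
  refine ((e.continuous_kernel.comp (continuous_const_mul γ)).smul hf)
    |>.integrable_of_hasCompactSupport ?_
  exact (e.hasCompactSupport_kernel.comp_homeomorph (Homeomorph.mulLeft γ)).smul_right

variable (e) in
/-- The projection `v ↦ ∫ z⁻¹ U(z) v dz` onto the vectors of weight one. -/
def ContractiveRep.proj (R : ContractiveRep Γτ V) : V →L[ℂ] V :=
  LinearMap.mkContinuous
    { toFun := fun v => ∫ g, e.kernel g • R.U g v ∂μ
      map_add' := fun v w => by
        have h : ∀ v, Integrable (fun g => e.kernel g • R.U g v) μ := fun v => by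
          simpa using integrable_kernel_smul (e := e) μ 1 (R.continuous v)
        simp only [map_add, smul_add]
        exact integral_add (h v) (h w)
      map_smul' := fun c v => by
        simp only [map_smul, smul_comm _ c]
        exact integral_smul c _ }
    (∫ g, ‖e.kernel g‖ ∂μ) fun v => by
      have hi : Integrable (fun g => ‖e.kernel g‖) μ :=
        (e.continuous_kernel.integrable_of_hasCompactSupport e.hasCompactSupport_kernel).norm
      refine (norm_integral_le_of_norm_le (hi.mul_const ‖v‖)
        (Filter.Eventually.of_forall fun g => ?_)).trans (integral_mul_const _ _).le
      rw [norm_smul]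
      exact mul_le_mul_of_nonneg_left (R.norm_le g v) (norm_nonneg _)

lemma ContractiveRep.proj_apply (R : ContractiveRep Γτ V) (v : V) :
    R.proj e μ v = ∫ g, e.kernel g • R.U g v ∂μ := rfl

/-- Substitute `g ↦ γ g` by left invariance. The kernel lives on the circle, which is central, so
`U(γ)` can then be moved next to `v`. -/
lemma ContractiveRep.integral_kernel (R : ContractiveRep Γτ V) (γ : Γτ) (v : V) :
    ∫ g, e.kernel (γ⁻¹ * g) • R.U g v ∂μ = R.proj e μ (R.U γ v) := by
  rw [R.proj_apply μ, ← integral_mul_left_eq_self (fun g => e.kernel (γ⁻¹ * g) • R.U g v) γ]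
  congr 1 with g
  rw [inv_mul_cancel_left]
  by_cases hg : e.proj g = 1
  · obtain ⟨w, rfl⟩ := e.proj_eq_one_iff.1 hg
    rw [← e.central, map_mul, mul_apply_eq_comp]
  · rw [e.kernel_eq_zero hg, zero_smul, zero_smul]

variable {μ}

lemma integral_norm_kernel (hμ : μ (Set.range e.incl) = 1) : ∫ g, ‖e.kernel g‖ ∂μ = 1 := by
  simp only [e.norm_kernel]
  rw [integral_indicator_const _ e.isSES.isClosedEmbedding.isClosed_range.measurableSet]
  simp [Measure.real, hμ]

lemma ContractiveRep.norm_proj_le (hμ : μ (Set.range e.incl) = 1) (R : ContractiveRep Γτ V) :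
    ‖R.proj e μ‖ ≤ 1 :=
  (LinearMap.mkContinuous_norm_le _ (integral_nonneg fun _ => norm_nonneg _) _).trans_eq
    (integral_norm_kernel hμ)

/-- The kernel is supported on the circle, so a bounded operator needs to intertwine only the circle
actions in order to intertwine the projections. -/
lemma ContractiveRep.map_proj [CompleteSpace V] [CompleteSpace W] (R : ContractiveRep Γτ V)
    (R' : ContractiveRep Γτ W)
    (T : V →L[ℂ] W) (hT : ∀ z v, T (R.U (e.incl z) v) = R'.U (e.incl z) (T v)) (v : V) :
    T (R.proj e μ v) = R'.proj e μ (T v) := by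
  have h : Integrable (fun g => e.kernel g • R.U g v) μ := by
    simpa using integrable_kernel_smul (e := e) μ 1 (R.continuous v)
  rw [R.proj_apply μ, R'.proj_apply μ, ← T.integral_comp_comm h]
  congr 1 with g
  rw [map_smul]
  by_cases hg : e.proj g = 1
  · obtain ⟨w, rfl⟩ := e.proj_eq_one_iff.1 hg
    rw [hT]
  · rw [e.kernel_eq_zero hg, zero_smul, zero_smul]

lemma ContractiveRep.proj_eq_self [CompleteSpace V] (hμ : μ (Set.range e.incl) = 1)
    (R : ContractiveRep Γτ V) {v : V}
    (hv : ∀ z, R.U (e.incl z) v = (z : ℂ) • v) : R.proj e μ v = v := by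
  rw [R.proj_apply μ]
  have h : ∀ g, e.kernel g • R.U g v = (Set.range e.incl).indicator (fun _ => v) g := fun g => by
    by_cases hg : g ∈ Set.range e.incl
    · rw [Set.indicator_of_mem hg]
      obtain ⟨w, rfl⟩ := hg
      rw [hv, e.kernel_incl, smul_smul, ← Circle.coe_mul, inv_mul_cancel, Circle.coe_one, one_smul]
    · rw [Set.indicator_of_notMem hg, e.kernel_eq_zero (fun h => hg (e.proj_eq_one_iff.1 h)),
        zero_smul]
  simp only [h]
  rw [integral_indicator_const _ e.isSES.isClosedEmbedding.isClosed_range.measurableSet]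
  simp [Measure.real, hμ]

lemma ContractiveRep.U_comm (R : ContractiveRep Γτ V) (γ : Γτ) (z : Circle) (v : V) :
    R.U γ (R.U (e.incl z) v) = R.U (e.incl z) (R.U γ v) := by
  rw [← mul_apply_eq_comp, ← map_mul, ← e.central, map_mul, mul_apply_eq_comp]

lemma ContractiveRep.U_proj [CompleteSpace V] (R : ContractiveRep Γτ V) (γ : Γτ) (v : V) :
    R.U γ (R.proj e μ v) = R.proj e μ (R.U γ v) :=
  R.map_proj R _ (R.U_comm γ) v

/-- By invariance of the measure, applying `U(z)` to the average amounts to translating the kernel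
by `z⁻¹`, and this multiplies the kernel by `z`. -/
lemma ContractiveRep.U_incl_proj [CompleteSpace V] (R : ContractiveRep Γτ V) (z : Circle) (v : V) :
    R.U (e.incl z) (R.proj e μ v) = (z : ℂ) • R.proj e μ v := by
  rw [R.U_proj, ← R.integral_kernel μ, R.proj_apply μ, ← integral_smul]
  congr 1 with g
  rw [← map_inv, e.kernel_incl_mul, inv_inv, mul_smul]

lemma ContractiveRep.proj_proj [CompleteSpace V] (hμ : μ (Set.range e.incl) = 1)
    (R : ContractiveRep Γτ V) (v : V) : R.proj e μ (R.proj e μ v) = R.proj e μ v :=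
  R.proj_eq_self hμ fun z => R.U_incl_proj z v

/-- Only the composite `T U(z) v` has to have weight one. This applies to the inner product with a
fixed vector of weight one, and `v` may be arbitrary. -/
lemma ContractiveRep.apply_proj_eq [CompleteSpace V] (hμ : μ (Set.range e.incl) = 1)
    [CompleteSpace W] (R : ContractiveRep Γτ V) (T : V →L[ℂ] W) (v : V)
    (h : ∀ z, T (R.U (e.incl z) v) = (z : ℂ) • T v) : T (R.proj e μ v) = T v := by
  have h1 : Integrable (fun g => e.kernel g • R.U g v) μ := by
    simpa using integrable_kernel_smul (e := e) μ 1 (R.continuous v)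
  rw [R.proj_apply μ, ← T.integral_comp_comm h1]
  have h : ∀ g, T (e.kernel g • R.U g v) =
      (Set.range e.incl).indicator (fun _ => T v) g := fun g => by
    by_cases hg : g ∈ Set.range e.incl
    · rw [Set.indicator_of_mem hg]
      obtain ⟨w, rfl⟩ := hg
      rw [map_smul, h, e.kernel_incl, smul_smul, ← Circle.coe_mul, inv_mul_cancel, Circle.coe_one,
        one_smul]
    · rw [Set.indicator_of_notMem hg, e.kernel_eq_zero (fun h => hg (e.proj_eq_one_iff.1 h)),
        zero_smul, map_zero]
  simp only [h]
  rw [integral_indicator_const _ e.isSES.isClosedEmbedding.isClosed_range.measurableSet]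
  simp [Measure.real, hμ]

/-- The projection is self-adjoint if the representation is unitary. -/
lemma ContractiveRep.proj_inner {B : Type*} [CommCStarAlgebra B] [PartialOrder B]
    [StarOrderedRing B] [SMul B V] [CStarModule B V] [CompleteSpace V]
    (hμ : μ (Set.range e.incl) = 1) (R : ContractiveRep Γτ V)
    (hR : ∀ g u v, inner B (R.U g u) (R.U g v) = inner B u v) :
    IsAdjoint B (R.proj e μ) (R.proj e μ) := by
  -- By unitarity, pairing with a vector of weight one sees only the weight one part of `v`.
  -- Symmetry then gives self-adjointness.
  have h1 : ∀ u v, inner B (R.proj e μ u) (R.proj e μ v) = inner B (R.proj e μ u) v := fun u v => by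
    refine R.apply_proj_eq hμ (CStarModule.innerSL (A := B) (R.proj e μ u)) v fun z => ?_
    change inner B (R.proj e μ u) (R.U (e.incl z) v) = (z : ℂ) • inner B (R.proj e μ u) v
    have h2 : R.proj e μ u = R.U (e.incl z) (((z⁻¹ : Circle) : ℂ) • R.proj e μ u) := by
      rw [map_smul, R.U_incl_proj, smul_smul, ← Circle.coe_mul, inv_mul_cancel, Circle.coe_one,
        one_smul]
    conv_lhs => rw [h2]
    rw [hR, CStarModule.inner_smul_left_complex, Circle.coe_inv_eq_conj]
    exact congrArg (· • _) (Complex.conj_conj _)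
  intro u v
  rw [← h1, ← CStarModule.star_inner, h1, CStarModule.star_inner]

end CircleProjection

/-! ### Generators and relations of the twisted crossed product. -/

section Delta

variable {Γ Γτ A : Type*} [Group Γ] [TopologicalSpace Γ] [DiscreteTopology Γ]
  [Group Γτ] [TopologicalSpace Γτ] [IsTopologicalGroup Γτ] [MeasurableSpace Γτ] [BorelSpace Γτ]
  [NonUnitalCStarAlgebra A] (μ : Measure Γτ) [μ.IsHaarMeasure] (e : CircleExtension Γ Γτ)
  (α : CStarAction Γ A)

/-- The homogeneous function with value `a` at `γ` that is supported on the coset of `γ`. -/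
def CircleExtension.single (γ : Γτ) (a : A) : e.Functions A :=
  ⟨{ toFun := fun g => e.kernel (γ⁻¹ * g) • a
     continuous_toFun := (e.continuous_kernel.comp (continuous_const_mul _)).smul continuous_const
     hasCompactSupport' :=
      (e.hasCompactSupport_kernel.comp_homeomorph (Homeomorph.mulLeft γ⁻¹)).smul_right },
    fun z g => by
      change e.kernel (γ⁻¹ * (e.incl z⁻¹ * g)) • a = ((z : ℂ) ^ (1 : ℤ)) • e.kernel (γ⁻¹ * g) • a
      rw [← mul_assoc, ← e.central, mul_assoc, e.kernel_incl_mul, inv_inv, mul_smul, zpow_one]⟩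

lemma CircleExtension.single_apply (γ : Γτ) (a : A) (g : Γτ) :
    (e.single γ a).1 g = e.kernel (γ⁻¹ * g) • a := rfl

/-- The unitary representation that is part of a covariant representation. -/
def CovariantRep.contractive {G : Type*} [Group G] [TopologicalSpace G] {α : CStarAction G A}
    (ρ : CovariantRep α) : ContractiveRep G ρ.H where
  U := (unitary (ρ.H →L[ℂ] ρ.H)).subtype.comp ρ.U
  norm_le g v := (ρ.norm_U g v).le
  continuous := ρ.U_continuous

lemma CovariantRep.contractive_inner {G : Type*} [Group G] [TopologicalSpace G]
    {α : CStarAction G A} (ρ : CovariantRep α) (g : G) (u v : ρ.H) :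
    inner ℂ (ρ.contractive.U g u) (ρ.contractive.U g v) = inner ℂ u v := by
  change inner ℂ ((ρ.U g : ρ.H →L[ℂ] ρ.H) u) ((ρ.U g : ρ.H →L[ℂ] ρ.H) v) = _
  rw [← ContinuousLinearMap.adjoint_inner_right, ← ContinuousLinearMap.star_eq_adjoint,
    ← mul_apply_eq_comp, Unitary.coe_star_mul_self]
  rfl

lemma CovariantRep.U_rep {G : Type*} [Group G] [TopologicalSpace G] {α : CStarAction G A}
    (ρ : CovariantRep α) (g : G) (a : A) (v : ρ.H) :
    ρ.contractive.U g (ρ.rep a v) = ρ.rep (α.toAut g a) (ρ.contractive.U g v) := by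
  rw [← ρ.covariant]
  change (ρ.U g : ρ.H →L[ℂ] ρ.H) (ρ.rep a v) = (ρ.U g : ρ.H →L[ℂ] ρ.H)
    (ρ.rep a ((star (ρ.U g : ρ.H →L[ℂ] ρ.H) * (ρ.U g : ρ.H →L[ℂ] ρ.H)) v))
  rw [Unitary.coe_star_mul_self]
  rfl

variable {e α}

lemma CovariantRep.rep_proj (ρ : CovariantRep (e.pullback α)) (a : A) (v : ρ.H) :
    ρ.rep a (ρ.contractive.proj e μ v) = ρ.contractive.proj e μ (ρ.rep a v) := by
  refine ρ.contractive.map_proj ρ.contractive (ρ.rep a) (fun z v => ?_) v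
  rw [ρ.U_rep]
  change _ = ρ.rep (α.toAut (e.proj (e.incl z)) a) _
  rw [e.proj_incl, map_one]
  rfl

/-- The function is `a` times the circle kernel translated by `γ`, so `rep a` comes out of the
integral and what remains is the average `P` of `U(γ) v`. -/
lemma CovariantRep.integratedForm_single (ρ : CovariantRep (e.pullback α)) (γ : Γτ) (a : A)
    (v : ρ.H) : ρ.integratedForm μ (e.single γ a).1 v =
      ρ.rep a (ρ.contractive.U γ (ρ.contractive.proj e μ v)) := by
  rw [ρ.contractive.U_proj, ← ρ.contractive.integral_kernel μ, ← (ρ.rep a).integral_comp_comm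
    (integrable_kernel_smul μ γ⁻¹ (ρ.contractive.continuous v))]
  change ∫ g, ρ.rep ((e.single γ a).1 g) (ρ.contractive.U g v) ∂μ = _
  congr 1 with g
  rw [e.single_apply, map_smul, map_smul]
  rfl

/-- Evaluation of the twisted crossed product in a covariant representation. -/
def TwistedCrossedProduct.eval (ρ : CovariantRep (e.pullback α)) :
    TwistedCrossedProduct μ e α →⋆ₙₐ[ℂ] (ρ.H →L[ℂ] ρ.H) where
  toFun T := T.1 ρ
  map_smul' c T := rfl
  map_zero' := rfl
  map_add' T T' := rfl
  map_mul' T T' := rfl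
  map_star' T := rfl

variable {μ}

lemma TwistedCrossedProduct.ext_eval {T T' : TwistedCrossedProduct μ e α}
    (h : ∀ ρ : CovariantRep (e.pullback α), ∀ v, eval μ ρ T v = eval μ ρ T' v) : T = T' :=
  Subtype.ext (lp.ext (funext fun ρ => ContinuousLinearMap.ext (h ρ)))

lemma TwistedCrossedProduct.norm_le {T : TwistedCrossedProduct μ e α} {C : ℝ} (hC : 0 ≤ C)
    (h : ∀ ρ : CovariantRep (e.pullback α), ∀ v, ‖eval μ ρ T v‖ ≤ C * ‖v‖) : ‖T‖ ≤ C :=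
  lp.norm_le_of_forall_le hC fun ρ => ContinuousLinearMap.opNorm_le_bound _ hC (h ρ)

lemma TwistedCrossedProduct.norm_eval_le (ρ : CovariantRep (e.pullback α))
    (T : TwistedCrossedProduct μ e α) : ‖eval μ ρ T‖ ≤ ‖T‖ :=
  lp.norm_apply_le_norm ENNReal.top_ne_zero T.1 ρ

variable (μ e α) in
/-- The element of the twisted crossed product given by the function `e.single γ a`. -/
def TwistedCrossedProduct.delta (γ : Γτ) (a : A) : TwistedCrossedProduct μ e α :=
  of μ e α (e.single γ a)

open TwistedCrossedProduct

lemma eval_delta (ρ : CovariantRep (e.pullback α)) (γ : Γτ) (a : A) (v : ρ.H) :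
    eval μ ρ (delta μ e α γ a) v =
      ρ.rep a (ρ.contractive.U γ (ρ.contractive.proj e μ v)) :=
  ρ.integratedForm_single μ γ a v

lemma delta_add (γ : Γτ) (a b : A) :
    delta μ e α γ (a + b) = delta μ e α γ a + delta μ e α γ b :=
  ext_eval fun ρ v => by simp only [map_add, add_apply, eval_delta]

lemma delta_smul (γ : Γτ) (c : ℂ) (a : A) :
    delta μ e α γ (c • a) = c • delta μ e α γ a :=
  ext_eval fun ρ v => by simp only [map_smul, FunLike.coe_smul, Pi.smul_apply, eval_delta]

lemma delta_incl_mul (z : Circle) (γ : Γτ) (a : A) :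
    delta μ e α (e.incl z * γ) a = (z : ℂ) • delta μ e α γ a :=
  ext_eval fun ρ v => by
    rw [map_smul, FunLike.coe_smul, Pi.smul_apply, eval_delta, eval_delta, e.central, map_mul,
      mul_apply_eq_comp, ρ.contractive.U_incl_proj, map_smul, map_smul]

lemma norm_delta_le (hμ : μ (Set.range e.incl) = 1) (γ : Γτ) (a : A) :
    ‖delta μ e α γ a‖ ≤ ‖a‖ := by
  refine TwistedCrossedProduct.norm_le (norm_nonneg _) fun ρ v => ?_
  rw [eval_delta]
  refine (ρ.norm_rep_le _ _).trans (mul_le_mul_of_nonneg_left ?_ (norm_nonneg _))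
  refine (ρ.contractive.norm_le _ _).trans
    (((ρ.contractive.proj e μ).le_opNorm v).trans ?_)
  exact mul_le_of_le_one_left (norm_nonneg _) (ρ.contractive.norm_proj_le hμ)

/-- In every covariant representation, `P` is idempotent and commutes with `A` and `Γτ`, so `a U(γ)
P b U(γ') P = a γ(b) U(γγ') P`. An element of the completion is determined by its values in these
representations. -/
lemma delta_mul (hμ : μ (Set.range e.incl) = 1) (γ γ' : Γτ) (a b : A) :
    delta μ e α γ a * delta μ e α γ' b =
      delta μ e α (γ * γ') (a * α.toAut (e.proj γ) b) :=
  ext_eval fun ρ v => by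
    rw [map_mul, mul_apply_eq_comp, eval_delta, eval_delta, eval_delta, ← ρ.rep_proj μ,
      ← ρ.contractive.U_proj, ρ.contractive.proj_proj hμ, ρ.U_rep, map_mul, map_mul,
      mul_apply_eq_comp, mul_apply_eq_comp]
    rfl

lemma star_delta (hμ : μ (Set.range e.incl) = 1) (γ : Γτ) (a : A) :
    star (delta μ e α γ a) =
      delta μ e α γ⁻¹ (α.toAut (e.proj γ)⁻¹ (star a)) :=
  ext_eval fun ρ v => by
    have hP := ρ.contractive.proj_inner (B := ℂ) hμ ρ.contractive_inner
    rw [map_star]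
    refine ext_inner_left ℂ fun w => ?_
    rw [ContinuousLinearMap.star_eq_adjoint, ContinuousLinearMap.adjoint_inner_right, eval_delta,
      eval_delta, ← ContinuousLinearMap.adjoint_inner_right,
      ← ContinuousLinearMap.star_eq_adjoint, ← map_star]
    -- By covariance `U(γ)` is pulled out to the left, so that it cancels against the one in the
    -- other slot of the inner product.
    have h1 : ρ.rep (star a) v = ρ.contractive.U γ
        (ρ.rep (α.toAut (e.proj γ)⁻¹ (star a)) (ρ.contractive.U γ⁻¹ v)) := by
      rw [ρ.U_rep, ← mul_apply_eq_comp (ρ.contractive.U γ), ← map_mul, mul_inv_cancel, map_one]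
      change _ = ρ.rep (α.toAut (e.proj γ) _) v
      rw [α.apply_inv]
    rw [h1, ρ.contractive_inner]
    refine (hP _ _).trans ?_
    rw [← ρ.rep_proj μ, ← ρ.contractive.U_proj]

variable (μ e α) in
/-- `delta γ` as a continuous linear map. -/
def deltaL (hμ : μ (Set.range e.incl) = 1) (γ : Γτ) : A →L[ℂ] TwistedCrossedProduct μ e α :=
  LinearMap.mkContinuous
    { toFun := delta μ e α γ
      map_add' := delta_add γ
      map_smul' := delta_smul γ } 1 fun a => by
    rw [one_mul]
    exact norm_delta_le hμ γ a

lemma CircleExtension.exists_finset (e : CircleExtension Γ Γτ) (f : e.Functions A) :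
    ∃ T : Finset Γ, ∀ g, f.1 g ≠ 0 → e.proj g ∈ T := by
  have h : (e.proj '' tsupport f.1).Finite :=
    (f.1.hasCompactSupport.image e.isSES.isOpenQuotientMap.continuous).finite_of_discrete
  exact ⟨h.toFinset, fun g hg => h.mem_toFinset.2 ⟨g, subset_closure hg, rfl⟩⟩

/-- Homogeneity determines `f` on a coset of the circle from its value at the chosen representative,
and at a given `g` at most the term of the coset of `g` is non-zero. -/
lemma CircleExtension.apply_eq_sum (e : CircleExtension Γ Γτ) (f : e.Functions A) {r : Γ → Γτ}
    (hr : ∀ q, e.proj (r q) = q) {T : Finset Γ} (hT : ∀ g, f.1 g ≠ 0 → e.proj g ∈ T) (g : Γτ) :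
    f.1 g = ∑ q ∈ T, e.kernel ((r q)⁻¹ * g) • f.1 (r q) := by
  have h : ∀ q ≠ e.proj g, e.kernel ((r q)⁻¹ * g) • f.1 (r q) = 0 := fun q hq => by
    rw [e.kernel_eq_zero, zero_smul]
    rw [map_mul, map_inv, hr]
    exact fun h => hq (inv_mul_eq_one.1 h)
  have h1 : e.kernel ((r (e.proj g))⁻¹ * g) • f.1 (r (e.proj g)) = f.1 g := by
    have h2 : e.proj ((r (e.proj g))⁻¹ * g) = 1 := by rw [map_mul, map_inv, hr, inv_mul_cancel]
    obtain ⟨z, hz⟩ := e.proj_eq_one_iff.1 h2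
    have h3 : r (e.proj g) = e.incl z⁻¹ * g := by
      rw [map_inv, eq_inv_mul_iff_mul_eq, e.central, hz, mul_inv_cancel_left]
    rw [← hz, e.kernel_incl, h3, f.2, zpow_one, smul_smul, ← Circle.coe_mul, inv_mul_cancel,
      Circle.coe_one, one_smul]
  by_cases hg : e.proj g ∈ T
  · rw [Finset.sum_eq_single_of_mem _ hg fun q _ => h q, h1]
  · rw [Finset.sum_eq_zero fun q hq => h q fun h => hg (h ▸ hq)]
    by_contra h
    exact hg (hT g h)

/-- Expanding `f` along a section leaves, for each coset, the integral of a translated circle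
kernel. Only linearity of `π` in the coefficient is used, so this serves both Hilbert space
representations and bimodules. -/
lemma ContractiveRep.integral_homogeneous {V : Type*} [NormedAddCommGroup V] [NormedSpace ℂ V]
    [CompleteSpace V] (R : ContractiveRep Γτ V) (π : A →ₗ[ℂ] (V →L[ℂ] V))
    (f : e.Functions A) {r : Γ → Γτ}
    (hr : ∀ q, e.proj (r q) = q) {T : Finset Γ} (hT : ∀ g, f.1 g ≠ 0 → e.proj g ∈ T) (v : V) :
    ∫ g, π (f.1 g) (R.U g v) ∂μ =
      ∑ q ∈ T, π (f.1 (r q)) (R.U (r q) (R.proj e μ v)) := by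
  have h1 : ∀ g, π (f.1 g) (R.U g v) =
      ∑ q ∈ T, π (f.1 (r q)) (e.kernel ((r q)⁻¹ * g) • R.U g v) := fun g => by
    conv_lhs => rw [e.apply_eq_sum f hr hT]
    simp only [map_sum, map_smul, sum_apply, FunLike.coe_smul, Pi.smul_apply]
  simp only [h1]
  have h2 : ∀ q, Integrable (fun g => e.kernel ((r q)⁻¹ * g) • R.U g v) μ := fun q =>
    integrable_kernel_smul μ _ (R.continuous v)
  rw [integral_finsetSum _ fun q _ => (π (f.1 (r q))).integrable_comp (h2 q)]
  refine Finset.sum_congr rfl fun q _ => ?_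
  rw [(π (f.1 (r q))).integral_comp_comm (h2 q), R.integral_kernel μ, R.U_proj]

lemma of_eq_sum (f : e.Functions A) {r : Γ → Γτ} (hr : ∀ q, e.proj (r q) = q) {T : Finset Γ}
    (hT : ∀ g, f.1 g ≠ 0 → e.proj g ∈ T) :
    of μ e α f = ∑ q ∈ T, delta μ e α (r q) (f.1 (r q)) :=
  ext_eval fun ρ v => by
    rw [map_sum, sum_apply]
    simp only [eval_delta]
    exact ρ.contractive.integral_homogeneous
      ⟨⟨ρ.rep, map_add ρ.rep⟩, map_smul ρ.rep⟩ f hr hT v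

lemma CircleExtension.exists_section (e : CircleExtension Γ Γτ) :
    ∃ r : Γ → Γτ, ∀ q, e.proj (r q) = q :=
  e.isSES.isOpenQuotientMap.surjective.hasRightInverse

variable (μ e α) in
/-- The generators of the twisted crossed product. -/
def deltaSet : Set (TwistedCrossedProduct μ e α) := {T | ∃ γ a, T = delta μ e α γ a}

lemma of_mem_span_deltaSet (f : e.Functions A) :
    of μ e α f ∈ Submodule.span ℂ (deltaSet μ e α) := by
  obtain ⟨r, hr⟩ := e.exists_section
  obtain ⟨T, hT⟩ := e.exists_finset f
  rw [of_eq_sum f hr hT]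
  exact Submodule.sum_mem _ fun q _ => Submodule.subset_span ⟨_, _, rfl⟩

lemma mul_mem_span_deltaSet (hμ : μ (Set.range e.incl) = 1) {T T' : TwistedCrossedProduct μ e α}
    (hT : T ∈ Submodule.span ℂ (deltaSet μ e α)) (hT' : T' ∈ Submodule.span ℂ (deltaSet μ e α)) :
    T * T' ∈ Submodule.span ℂ (deltaSet μ e α) := by
  refine Submodule.span_induction₂ (p := fun T T' _ _ => T * T' ∈ Submodule.span ℂ (deltaSet μ e α))
    ?_ ?_ ?_ ?_ ?_ ?_ ?_ hT hT'
  · rintro _ _ ⟨γ, a, rfl⟩ ⟨γ', b, rfl⟩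
    rw [delta_mul hμ]
    exact Submodule.subset_span ⟨_, _, rfl⟩
  · intro T _; rw [zero_mul]; exact zero_mem _
  · intro T _; rw [mul_zero]; exact zero_mem _
  · intro _ _ _ _ _ _ h h'; rw [add_mul]; exact add_mem h h'
  · intro _ _ _ _ _ _ h h'; rw [mul_add]; exact add_mem h h'
  · intro c _ _ _ _ h; rw [smul_mul_assoc]; exact Submodule.smul_mem _ c h
  · intro c _ _ _ _ h; rw [mul_smul_comm]; exact Submodule.smul_mem _ c h

lemma star_mem_span_deltaSet (hμ : μ (Set.range e.incl) = 1) {T : TwistedCrossedProduct μ e α}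
    (hT : T ∈ Submodule.span ℂ (deltaSet μ e α)) :
    star T ∈ Submodule.span ℂ (deltaSet μ e α) := by
  induction hT using Submodule.span_induction with
  | mem T hT =>
    obtain ⟨γ, a, rfl⟩ := hT
    rw [star_delta hμ]
    exact Submodule.subset_span ⟨_, _, rfl⟩
  | zero => rw [star_zero]; exact zero_mem _
  | add T T' _ _ h h' => rw [star_add]; exact add_mem h h'
  | smul c T _ h => rw [star_smul]; exact Submodule.smul_mem _ _ h

/-- The span is closed under products and adjoints and contains all homogeneous functions, so it is
the whole `*`-algebra generated by them. -/
lemma dense_span_deltaSet (hμ : μ (Set.range e.incl) = 1) :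
    Dense (Submodule.span ℂ (deltaSet μ e α) : Set (TwistedCrossedProduct μ e α)) := by
  have h1 : ∀ T ∈ NonUnitalStarAlgebra.adjoin ℂ
      {b | ∃ f : e.Functions A, b = universalRep (e.pullback α) μ f.1},
      ∃ T' ∈ Submodule.span ℂ (deltaSet μ e α), T'.1 = T := by
    intro T hT
    induction hT using NonUnitalStarAlgebra.adjoin_induction with
    | mem T hT =>
      obtain ⟨f, rfl⟩ := hT
      exact ⟨_, of_mem_span_deltaSet f, rfl⟩
    | zero => exact ⟨0, zero_mem _, rfl⟩
    | add T T' _ _ h h' =>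
      obtain ⟨x, hx, rfl⟩ := h
      obtain ⟨y, hy, rfl⟩ := h'
      exact ⟨x + y, add_mem hx hy, rfl⟩
    | smul c T _ h =>
      obtain ⟨x, hx, rfl⟩ := h
      exact ⟨c • x, Submodule.smul_mem _ c hx, rfl⟩
    | mul T T' _ _ h h' =>
      obtain ⟨x, hx, rfl⟩ := h
      obtain ⟨y, hy, rfl⟩ := h'
      exact ⟨x * y, mul_mem_span_deltaSet hμ hx hy, rfl⟩
    | star T _ h =>
      obtain ⟨x, hx, rfl⟩ := h
      exact ⟨star x, star_mem_span_deltaSet hμ hx, rfl⟩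
  intro T
  refine Metric.mem_closure_iff.2 fun ε hε => ?_
  obtain ⟨T', hT', h⟩ := Metric.mem_closure_iff.1 T.2 ε hε
  obtain ⟨x, hx, rfl⟩ := h1 T' hT'
  exact ⟨x, hx, h⟩

end Delta

/-! ### The action of `S` on the twisted crossed product. -/

section TwistedAction

variable {Γ Γτ S A : Type*} [Group Γ] [TopologicalSpace Γ] [DiscreteTopology Γ]
  [Group Γτ] [TopologicalSpace Γτ] [IsTopologicalGroup Γτ] [MeasurableSpace Γτ] [BorelSpace Γτ]
  [Group S] [TopologicalSpace S] [NonUnitalCStarAlgebra A]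
  {μ : Measure Γτ} [μ.IsHaarMeasure] {e : CircleExtension Γ Γτ}

open TwistedCrossedProduct

/-- Since `Γ` is discrete, `g z` stays in the coset of `g z₀` for `z` near `z₀`. There it differs
from `g z₀` by a circle element, and `delta` changes by that scalar, which is the conjugate of the
kernel. -/
lemma continuous_delta (hμ : μ (Set.range e.incl) = 1) {α : CStarAction Γ A} {Z : Type*}
    [TopologicalSpace Z] {g : Z → Γτ} (hg : Continuous g) {a : Z → A} (ha : Continuous a) :
    Continuous fun z => delta μ e α (g z) (a z) := by
  refine continuous_iff_continuousAt.2 fun z₀ => ?_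
  have h1 : Continuous fun z =>
      star (e.kernel ((g z₀)⁻¹ * g z)) • delta μ e α (g z₀) (a z) :=
    (continuous_star.comp (e.continuous_kernel.comp (hg.const_mul _))).smul
      ((deltaL μ e α hμ (g z₀)).continuous.comp ha)
  refine h1.continuousAt.congr ?_
  have h2 : IsOpen (e.proj ⁻¹' {e.proj (g z₀)}) :=
    (isOpen_discrete _).preimage e.isSES.isOpenQuotientMap.continuous
  filter_upwards [(h2.preimage hg).mem_nhds rfl] with z hz
  have hz' : e.proj (g z) = e.proj (g z₀) := hz
  have h3 : e.proj ((g z₀)⁻¹ * g z) = 1 := by rw [map_mul, map_inv, hz', inv_mul_cancel]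
  obtain ⟨w, hw⟩ := e.proj_eq_one_iff.1 h3
  have h4 : g z = e.incl w * g z₀ := by rw [e.central, hw, mul_inv_cancel_left]
  rw [← hw, e.kernel_incl, h4, delta_incl_mul, Circle.coe_inv_eq_conj]
  exact congrArg (· • _) (Complex.conj_conj _)

lemma twisted_ext (hμ : μ (Set.range e.incl) = 1) {α : CStarAction Γ A} {V : Type*}
    [NormedAddCommGroup V] [NormedSpace ℂ V] {f g : TwistedCrossedProduct μ e α →L[ℂ] V}
    (h : ∀ γ a, f (delta μ e α γ a) = g (delta μ e α γ a)) : f = g := by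
  refine ContinuousLinearMap.ext_on (dense_span_deltaSet hμ) ?_
  rintro _ ⟨γ, a, rfl⟩
  exact h γ a

variable {φ : S →* MulAut Γ} (ℓ : LiftedAction φ e) (α : CStarAction (Γ ⋊[φ] S) A)

lemma CStarAction.inl_inr (α : CStarAction (Γ ⋊[φ] S) A) (s : S) (q : Γ) (a : A) :
    α.toAut (SemidirectProduct.inl (φ s q)) (α.toAut (SemidirectProduct.inr s) a) =
      α.toAut (SemidirectProduct.inr s) (α.toAut (SemidirectProduct.inl q) a) := by
  rw [← α.apply_mul, ← α.apply_mul, SemidirectProduct.inl_aut, map_inv, inv_mul_cancel_right]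

lemma LiftedAction.continuous_act (ℓ : LiftedAction φ e) (s : S) :
    Continuous fun γ => ℓ.act s γ :=
  ℓ.continuous.comp (continuous_const.prodMk continuous_id)

variable {α} in
/-- The composition of a covariant representation with the action of `s`. -/
def CovariantRep.twist (ρ : CovariantRep (e.pullback α.restrict)) (s : S) :
    CovariantRep (e.pullback α.restrict) where
  H := ρ.H
  rep := ρ.rep.comp (α.toAut (SemidirectProduct.inr s) : A →⋆ₙₐ[ℂ] A)
  U := ρ.U.comp (ℓ.act s).toMonoidHom
  U_continuous ξ := (ρ.U_continuous ξ).comp (ℓ.continuous_act s)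
  covariant γ a := by
    refine (ρ.covariant (ℓ.act s γ) (α.toAut (SemidirectProduct.inr s) a)).trans ?_
    change ρ.rep (α.toAut (SemidirectProduct.inl (e.proj (ℓ.act s γ))) _) =
      ρ.rep (α.toAut (SemidirectProduct.inr s) (α.toAut (SemidirectProduct.inl (e.proj γ)) a))
    rw [ℓ.proj_apply, α.inl_inr]

variable (μ) in
-- The lifted action fixes the circle pointwise, so the twist does not change the circle action that
-- defines the projection.
lemma CovariantRep.twist_proj (ρ : CovariantRep (e.pullback α.restrict)) (s : S) (v : ρ.H) :
    (ρ.twist ℓ s).contractive.proj e μ v = ρ.contractive.proj e μ v := by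
  let R : ContractiveRep Γτ ρ.H := (ρ.twist ℓ s).contractive
  refine R.map_proj ρ.contractive (ContinuousLinearMap.id ℂ ρ.H) (fun z v => ?_) v
  change ρ.contractive.U (ℓ.act s (e.incl z)) v = ρ.contractive.U (e.incl z) v
  rw [ℓ.incl_apply]

/-- The action of `s` on the universal representation. -/
def universalShift (s : S) :
    UniversalAlgebra (e.pullback α.restrict) →L[ℂ] UniversalAlgebra (e.pullback α.restrict) :=
  LinearMap.mkContinuous
    -- An automorphism of the covariant system only reindexes the covariant representations, so it
    -- cannot increase the supremum norm.
    { toFun := fun T => ⟨fun ρ => T (ρ.twist ℓ s), memℓp_infty ⟨‖T‖, by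
        rintro _ ⟨ρ, rfl⟩
        exact lp.norm_apply_le_norm ENNReal.top_ne_zero T (ρ.twist ℓ s)⟩⟩
      map_add' := fun T T' => rfl
      map_smul' := fun c T => rfl } 1 fun T => by
    rw [one_mul]
    exact lp.norm_le_of_forall_le (norm_nonneg _) fun ρ =>
      lp.norm_apply_le_norm ENNReal.top_ne_zero T (ρ.twist ℓ s)

lemma universalShift_delta (s : S) (γ : Γτ) (a : A) :
    universalShift ℓ α s (delta μ e α.restrict γ a).1 =
      (delta μ e α.restrict (ℓ.act s γ) (α.toAut (SemidirectProduct.inr s) a)).1 := by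
  refine lp.ext (funext fun ρ => ContinuousLinearMap.ext fun v => ?_)
  refine (eval_delta (ρ.twist ℓ s) γ a v).trans (Eq.trans ?_ (eval_delta ρ _ _ v).symm)
  rw [CovariantRep.twist_proj]
  rfl

lemma universalShift_mem (hμ : μ (Set.range e.incl) = 1) (s : S)
    (T : TwistedCrossedProduct μ e α.restrict) :
    universalShift ℓ α s T.1 ∈ twistedSubalgebra μ e α.restrict := by
  let L : TwistedCrossedProduct μ e α.restrict →L[ℂ] UniversalAlgebra (e.pullback α.restrict) :=
    LinearMap.mkContinuous
      { toFun := fun T => universalShift ℓ α s T.1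
        map_add' := fun T T' => rfl
        map_smul' := fun c T => rfl } ‖universalShift ℓ α s‖ fun T =>
      (universalShift ℓ α s).le_opNorm T.1
  refine clm_mem_of_dense_span (dense_span_deltaSet hμ)
    (P := (twistedSubalgebra μ e α.restrict).toSubmodule)
    (NonUnitalStarSubalgebra.isClosed_topologicalClosure _) L ?_ T
  rintro _ ⟨γ, a, rfl⟩
  change universalShift ℓ α s (delta μ e α.restrict γ a).1 ∈ _
  rw [universalShift_delta]
  exact (delta μ e α.restrict _ _).2

/-- The action of `s` on the twisted crossed product. -/
def twistedShift (hμ : μ (Set.range e.incl) = 1) (s : S) :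
    TwistedCrossedProduct μ e α.restrict →⋆ₙₐ[ℂ] TwistedCrossedProduct μ e α.restrict where
  toFun T := ⟨universalShift ℓ α s T.1, universalShift_mem ℓ α hμ s T⟩
  map_smul' c T := rfl
  map_zero' := rfl
  map_add' T T' := rfl
  map_mul' T T' := rfl
  map_star' T := rfl

lemma twistedShift_delta (hμ : μ (Set.range e.incl) = 1) (s : S) (γ : Γτ) (a : A) :
    twistedShift ℓ α hμ s (delta μ e α.restrict γ a) =
      delta μ e α.restrict (ℓ.act s γ) (α.toAut (SemidirectProduct.inr s) a) :=
  Subtype.ext (universalShift_delta ℓ α s γ a)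

/-- A homomorphism of `C*`-algebras as a bounded operator. -/
def starHomCLM {D D' : Type*} [NonUnitalCStarAlgebra D] [NonUnitalCStarAlgebra D']
    (f : D →⋆ₙₐ[ℂ] D') : D →L[ℂ] D' :=
  LinearMap.mkContinuous
    { toFun := f
      map_add' := map_add f
      map_smul' := map_smul f } 1 fun T => by
    rw [one_mul]
    exact NonUnitalStarAlgHom.norm_apply_le f T

lemma twistedShift_mul (hμ : μ (Set.range e.incl) = 1) (s t : S)
    (T : TwistedCrossedProduct μ e α.restrict) :
    twistedShift ℓ α hμ (s * t) T = twistedShift ℓ α hμ s (twistedShift ℓ α hμ t T) := by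
  refine DFunLike.congr_fun (twisted_ext hμ (f := starHomCLM (twistedShift ℓ α hμ (s * t)))
    (g := starHomCLM (twistedShift ℓ α hμ s) ∘L starHomCLM (twistedShift ℓ α hμ t))
    fun γ a => ?_) T
  change twistedShift ℓ α hμ (s * t) _ = twistedShift ℓ α hμ s (twistedShift ℓ α hμ t _)
  rw [twistedShift_delta, twistedShift_delta, twistedShift_delta, map_mul, map_mul, α.apply_mul]
  rfl

lemma twistedShift_one (hμ : μ (Set.range e.incl) = 1)
    (T : TwistedCrossedProduct μ e α.restrict) : twistedShift ℓ α hμ 1 T = T := by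
  refine DFunLike.congr_fun (twisted_ext hμ (f := starHomCLM (twistedShift ℓ α hμ 1))
    (g := ContinuousLinearMap.id ℂ _) fun γ a => ?_) T
  change twistedShift ℓ α hμ 1 _ = _
  rw [twistedShift_delta, map_one, map_one, map_one]
  rfl

/-- The automorphism of the twisted crossed product given by `s`. -/
def twistedAut (hμ : μ (Set.range e.incl) = 1) (s : S) :
    TwistedCrossedProduct μ e α.restrict ≃⋆ₐ[ℂ] TwistedCrossedProduct μ e α.restrict where
  toFun := twistedShift ℓ α hμ s
  invFun := twistedShift ℓ α hμ s⁻¹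
  left_inv T := by rw [← twistedShift_mul, inv_mul_cancel, twistedShift_one]
  right_inv T := by rw [← twistedShift_mul, mul_inv_cancel, twistedShift_one]
  map_mul' := map_mul _
  map_add' := map_add _
  map_star' := map_star _
  map_smul' := map_smul _

/-- The action of `S` on the twisted crossed product. -/
def twistedAction (hμ : μ (Set.range e.incl) = 1) :
    CStarAction S (TwistedCrossedProduct μ e α.restrict) where
  toAut := MonoidHom.mk' (twistedAut ℓ α hμ) fun s t =>
    StarAlgEquiv.ext fun T => twistedShift_mul ℓ α hμ s t T
  continuous_apply := by
    let P : Submodule ℂ (TwistedCrossedProduct μ e α.restrict) :=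
      { carrier := {T | Continuous fun s => twistedShift ℓ α hμ s T}
        add_mem' := fun {T T'} hT hT' => by
          simp only [Set.mem_ofPred_eq, map_add] at hT hT' ⊢
          exact hT.add hT'
        zero_mem' := by
          simp only [Set.mem_ofPred_eq, map_zero]
          exact continuous_const
        smul_mem' := fun c T hT => by
          simp only [Set.mem_ofPred_eq, map_smul] at hT ⊢
          exact hT.const_smul c }
    refine fun T => mem_of_dense_span (dense_span_deltaSet hμ) (P := P) ?_ ?_ T
    · refine isClosed_setOf_continuous (fun T s => twistedShift ℓ α hμ s T) 1 fun T T' s => ?_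
      rw [dist_eq_norm, dist_eq_norm, ← map_sub, one_mul]
      exact NonUnitalStarAlgHom.norm_apply_le _ _
    · rintro _ ⟨γ, a, rfl⟩
      change Continuous fun s => twistedShift ℓ α hμ s (delta μ e α.restrict γ a)
      simp only [twistedShift_delta]
      refine continuous_delta hμ (ℓ.continuous.comp (continuous_id.prodMk continuous_const)) ?_
      refine (α.continuous_apply a).comp (continuous_induced_rng.2 ?_)
      exact continuous_const.prodMk continuous_id

lemma twistedAction_delta (hμ : μ (Set.range e.incl) = 1) (s : S) (γ : Γτ) (a : A) :
    (twistedAction ℓ α hμ).toAut s (delta μ e α.restrict γ a) =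
      delta μ e α.restrict (ℓ.act s γ) (α.toAut (SemidirectProduct.inr s) a) :=
  twistedShift_delta ℓ α hμ s γ a

/-- Expand `f` along a section `r`, and its translate along the transported section `q ↦ s r(s⁻¹
q)`. The two finite sums then agree term by term. -/
lemma twistedAction_of (hμ : μ (Set.range e.incl) = 1) (s : S) (f : e.Functions A) :
    (twistedAction ℓ α hμ).toAut s (of μ e α.restrict f) =
      of μ e α.restrict (ℓ.translate α s f) := by
  obtain ⟨r, hr⟩ := e.exists_section
  obtain ⟨T, hT⟩ := e.exists_finset f
  have hinv : ∀ γ, ℓ.act s⁻¹ (ℓ.act s γ) = γ := fun γ => by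
    rw [map_inv]; exact MulAut.inv_apply_self _ _ _
  have hinv' : ∀ γ, ℓ.act s (ℓ.act s⁻¹ γ) = γ := fun γ => by
    rw [map_inv]; exact MulAut.apply_inv_self _ _ _
  have hφ : ∀ q, φ s⁻¹ (φ s q) = q := fun q => by
    rw [map_inv]; exact MulAut.inv_apply_self _ _ _
  have hφ' : ∀ q, φ s (φ s⁻¹ q) = q := fun q => by
    rw [map_inv]; exact MulAut.apply_inv_self _ _ _
  have hr' : ∀ q, e.proj (ℓ.act s (r (φ s⁻¹ q))) = q := fun q => by
    rw [ℓ.proj_apply, hr, hφ']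
  have hT' : ∀ g, (ℓ.translate α s f).1 g ≠ 0 → e.proj g ∈ T.map (φ s).toEquiv.toEmbedding := by
    intro g hg
    refine Finset.mem_map.2 ⟨e.proj (ℓ.act s⁻¹ g), hT _ fun h => hg ?_, ?_⟩
    · change α.toAut _ (f.1 (ℓ.act s⁻¹ g)) = 0
      rw [h, map_zero]
    · change φ s (e.proj (ℓ.act s⁻¹ g)) = _
      rw [← ℓ.proj_apply, hinv']
  rw [of_eq_sum f hr hT, of_eq_sum _ hr' hT', map_sum, Finset.sum_map]
  refine Finset.sum_congr rfl fun q _ => ?_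
  change _ = delta μ e α.restrict (ℓ.act s (r (φ s⁻¹ (φ s q))))
    (α.toAut _ (f.1 (ℓ.act s⁻¹ (ℓ.act s (r (φ s⁻¹ (φ s q)))))))
  rw [hφ, hinv, twistedAction_delta]

end TwistedAction

/-! ### The integrated form of an equivariant bimodule. -/

section Integration

variable {Γ Γτ S A : Type*} [Group Γ] [TopologicalSpace Γ] [DiscreteTopology Γ]
  [Group Γτ] [TopologicalSpace Γτ] [IsTopologicalGroup Γτ] [MeasurableSpace Γτ] [BorelSpace Γτ]
  [Group S] [TopologicalSpace S] [NonUnitalCStarAlgebra A]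
  {μ : Measure Γτ} [μ.IsHaarMeasure] {e : CircleExtension Γ Γτ}
  {φ : S →* MulAut Γ} {ℓ : LiftedAction φ e} {α : CStarAction (Γ ⋊[φ] S) A}
  {B : Type*} [CommCStarAlgebra B] [PartialOrder B] [StarOrderedRing B]

open TwistedCrossedProduct

lemma continuous_inr {N G : Type*} [Group N] [Group G] [TopologicalSpace N] [TopologicalSpace G]
    (φ : G →* MulAut N) : Continuous (SemidirectProduct.inr : G →* N ⋊[φ] G) :=
  continuous_induced_rng.2 (continuous_const.prodMk continuous_id)

lemma LiftedAction.pullback_inl (γ : Γτ) (a : A) :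
    (ℓ.pullback α).toAut (SemidirectProduct.inl γ) a = (e.pullback α.restrict).toAut γ a := by
  change α.toAut (ℓ.projHom (SemidirectProduct.inl γ)) a =
    α.toAut (SemidirectProduct.inl (e.proj γ)) a
  rw [LiftedAction.projHom, SemidirectProduct.map_inl]

lemma LiftedAction.pullback_inr (s : S) (a : A) :
    (ℓ.pullback α).toAut (SemidirectProduct.inr s) a = α.toAut (SemidirectProduct.inr s) a := by
  change α.toAut (ℓ.projHom (SemidirectProduct.inr s)) a = _
  rw [LiftedAction.projHom, SemidirectProduct.map_inr]
  rfl

lemma LiftedAction.circle_comm (z : Circle) (g : Γτ ⋊[ℓ.act] S) :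
    ℓ.circle z * g = g * ℓ.circle z := by
  refine SemidirectProduct.ext ?_ ?_
  · change e.incl z * ℓ.act 1 g.left = g.left * ℓ.act g.right (e.incl z)
    rw [ℓ.incl_apply, map_one, e.central]
    rfl
  · change 1 * g.right = g.right * 1
    rw [one_mul, mul_one]

lemma LiftedAction.pullback_circle (z : Circle) (a : A) :
    (ℓ.pullback α).toAut (ℓ.circle z) a = a := by
  refine (LiftedAction.pullback_inl (e.incl z) a).trans ?_
  change α.toAut (SemidirectProduct.inl (e.proj (e.incl z))) a = a
  rw [e.proj_incl, map_one, map_one]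
  rfl

/-- The restriction to `Γτ` of a covariant representation. -/
def CovariantRep.restrictInl (ρ : CovariantRep (ℓ.pullback α)) :
    CovariantRep (e.pullback α.restrict) where
  H := ρ.H
  rep := ρ.rep
  U := ρ.U.comp SemidirectProduct.inl
  U_continuous ξ := (ρ.U_continuous ξ).comp (continuous_inl _)
  covariant γ a := by
    rw [← LiftedAction.pullback_inl]
    exact ρ.covariant _ _

/-- The representation of `Γτ` on an equivariant bimodule. -/
def GradedBimodule.contractive (X : GradedBimodule (ℓ.pullback α) B) : ContractiveRep Γτ X.E where
  U := X.U.comp SemidirectProduct.inl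
  norm_le g v := (X.U_norm _ v).le
  continuous v := (X.U_continuous v).comp (continuous_inl _)

variable (μ) in
/-- The projection onto the vectors on which the circle acts with weight one. -/
def GradedBimodule.circleProj (X : GradedBimodule (ℓ.pullback α) B) : X.E →L[ℂ] X.E :=
  X.contractive.proj e μ

variable (X : GradedBimodule (ℓ.pullback α) B)

lemma GradedBimodule.circleProj_π (a : A) (v : X.E) :
    X.circleProj μ (X.π a v) = X.π a (X.circleProj μ v) := by
  refine (X.contractive.map_proj X.contractive (X.π a) (fun z v => ?_) v).symm
  change X.π a (X.U (ℓ.circle z) v) = X.U (ℓ.circle z) (X.π a v)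
  rw [X.π_equivariant, LiftedAction.pullback_circle]

lemma GradedBimodule.circleProj_U (g : Γτ ⋊[ℓ.act] S) (v : X.E) :
    X.circleProj μ (X.U g v) = X.U g (X.circleProj μ v) := by
  refine (X.contractive.map_proj X.contractive (X.U g) (fun z v => ?_) v).symm
  change X.U g (X.U (ℓ.circle z) v) = X.U (ℓ.circle z) (X.U g v)
  rw [← mul_apply_eq_comp, ← mul_apply_eq_comp, ← map_mul, ← map_mul, ℓ.circle_comm]

lemma GradedBimodule.circleProj_ε (v : X.E) :
    X.circleProj μ (X.ε v) = X.ε (X.circleProj μ v) :=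
  (X.contractive.map_proj X.contractive X.ε (fun z v => X.U_even _ _) v).symm

lemma GradedBimodule.circleProj_isAdjoint (hμ : μ (Set.range e.incl) = 1) :
    IsAdjoint B (X.circleProj μ) (X.circleProj μ) :=
  X.contractive.proj_inner hμ fun g u v => X.U_inner _ u v

variable (μ) in
/-- The operator of the integrated form that corresponds to `delta γ a`. -/
def GradedBimodule.deltaOp (γ : Γτ) (a : A) : X.E →L[ℂ] X.E :=
  X.π a * (X.U (SemidirectProduct.inl γ) * X.circleProj μ)

lemma GradedBimodule.deltaOp_apply (γ : Γτ) (a : A) (v : X.E) :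
    X.deltaOp μ γ a v = X.π a (X.U (SemidirectProduct.inl γ) (X.circleProj μ v)) := rfl

/-- The localization at `χ`, as a map into a covariant representation of `Γτ`. -/
def GradedBimodule.loc (χ : B →⋆ₐ[ℂ] ℂ) : X.E →L[ℂ] (X.localization χ).restrictInl.H :=
  localizationMap χ

lemma GradedBimodule.loc_π (χ : B →⋆ₐ[ℂ] ℂ) (a : A) (v : X.E) :
    X.loc χ (X.π a v) = (X.localization χ).restrictInl.rep a (X.loc χ v) :=
  (X.localization_rep χ a v).symm

lemma GradedBimodule.loc_U (χ : B →⋆ₐ[ℂ] ℂ) (γ : Γτ) (v : X.E) :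
    X.loc χ (X.U (SemidirectProduct.inl γ) v) =
      (X.localization χ).restrictInl.contractive.U γ (X.loc χ v) :=
  (X.localization_U χ _ v).symm

lemma GradedBimodule.norm_loc_le (χ : B →⋆ₐ[ℂ] ℂ) (v : X.E) : ‖X.loc χ v‖ ≤ ‖v‖ := by
  refine le_of_sq_le_sq ((localizationMap_norm_sq χ v).trans_le ?_) (norm_nonneg _)
  rw [norm_sq_inner B]
  exact NonUnitalStarAlgHom.norm_apply_le χ _

lemma GradedBimodule.U_mul (X : GradedBimodule (ℓ.pullback α) B) (g h : Γτ ⋊[ℓ.act] S)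
    (v : X.E) : X.U (g * h) v = X.U g (X.U h v) := by rw [map_mul, mul_apply_eq_comp]

/-- The operator `Q` on `X.E` represents the element `T` of the twisted crossed product. -/
def GradedBimodule.Represents (T : TwistedCrossedProduct μ e α.restrict) (Q : X.E →L[ℂ] X.E) :
    Prop :=
  ∀ (χ : B →⋆ₐ[ℂ] ℂ) (v : X.E), X.loc χ (Q v) =
    eval μ (X.localization χ).restrictInl T (X.loc χ v)

variable {X}

/-- Every localization of the module is one of the covariant representations over which the maximal
norm is taken, and the localizations determine the norm of `Q`. -/
lemma GradedBimodule.Represents.norm_le {T : TwistedCrossedProduct μ e α.restrict}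
    {Q : X.E →L[ℂ] X.E} (h : X.Represents T Q) : ‖Q‖ ≤ ‖T‖ := by
  refine ContinuousLinearMap.opNorm_le_bound _ (norm_nonneg _) fun v => ?_
  refine exists_localization_norm (B := B) _ (by positivity) fun χ => ?_
  change ‖X.loc χ (Q v)‖ ≤ _
  rw [h]
  exact (ContinuousLinearMap.le_opNorm _ _).trans (mul_le_mul (norm_eval_le _ T)
    (X.norm_loc_le χ v) (norm_nonneg _) (norm_nonneg _))

lemma GradedBimodule.Represents.add {T T' : TwistedCrossedProduct μ e α.restrict}
    {Q Q' : X.E →L[ℂ] X.E} (h : X.Represents T Q) (h' : X.Represents T' Q') :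
    X.Represents (T + T') (Q + Q') := fun χ v => by
  simp only [add_apply, map_add, h χ v, h' χ v]

lemma GradedBimodule.Represents.smul {T : TwistedCrossedProduct μ e α.restrict}
    {Q : X.E →L[ℂ] X.E} (c : ℂ) (h : X.Represents T Q) : X.Represents (c • T) (c • Q) :=
  fun χ v => by simp only [FunLike.coe_smul, Pi.smul_apply, map_smul, h χ v]

lemma GradedBimodule.Represents.sub {T T' : TwistedCrossedProduct μ e α.restrict}
    {Q Q' : X.E →L[ℂ] X.E} (h : X.Represents T Q) (h' : X.Represents T' Q') :
    X.Represents (T - T') (Q - Q') := fun χ v => by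
  simp only [sub_apply, map_sub, h χ v, h' χ v]

lemma GradedBimodule.Represents.mul {T T' : TwistedCrossedProduct μ e α.restrict}
    {Q Q' : X.E →L[ℂ] X.E} (h : X.Represents T Q) (h' : X.Represents T' Q') :
    X.Represents (T * T') (Q * Q') := fun χ v => by
  simp only [mul_apply_eq_comp, map_mul, h χ _, h' χ v]

lemma GradedBimodule.represents_zero :
    X.Represents (0 : TwistedCrossedProduct μ e α.restrict) 0 := fun χ v => by
  simp only [zero_apply, map_zero]

lemma GradedBimodule.Represents.unique {T : TwistedCrossedProduct μ e α.restrict}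
    {Q Q' : X.E →L[ℂ] X.E} (h : X.Represents T Q) (h' : X.Represents T Q') : Q = Q' := by
  have h1 := (h.sub h').norm_le
  rw [sub_self, norm_zero] at h1
  exact sub_eq_zero.1 (norm_le_zero_iff.1 h1)

variable (X) in
lemma GradedBimodule.represents_delta (γ : Γτ) (a : A) :
    X.Represents (delta μ e α.restrict γ a) (X.deltaOp μ γ a) := fun χ v => by
  have h := X.contractive.map_proj (e := e) (μ := μ) (X.localization χ).restrictInl.contractive
    (X.loc χ) (fun z v => X.loc_U χ _ v) v
  rw [X.deltaOp_apply, X.loc_π, X.loc_U, eval_delta]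
  exact congrArg (fun w => (X.localization χ).restrictInl.rep a
    ((X.localization χ).restrictInl.contractive.U γ w)) h

variable (X) in
-- The elements represented by some operator form a subspace containing the generators. It is
-- closed: the estimate `‖Q‖ ≤ ‖T‖` makes operators representing a convergent sequence a Cauchy
-- sequence, and their limit represents the limit.
lemma GradedBimodule.exists_represents (hμ : μ (Set.range e.incl) = 1)
    (T : TwistedCrossedProduct μ e α.restrict) : ∃ Q, X.Represents T Q := by
  let P : Submodule ℂ (TwistedCrossedProduct μ e α.restrict) :=
    { carrier := {T | ∃ Q, X.Represents T Q}
      add_mem' := fun ⟨Q, h⟩ ⟨Q', h'⟩ => ⟨Q + Q', h.add h'⟩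
      zero_mem' := ⟨0, GradedBimodule.represents_zero⟩
      smul_mem' := fun c T ⟨Q, h⟩ => ⟨c • Q, h.smul c⟩ }
  refine mem_of_dense_span (dense_span_deltaSet hμ) (P := P)
    (isClosed_of_closure_subset fun T hT => ?_) ?_ T
  · obtain ⟨t, ht, hlim⟩ := mem_closure_iff_seq_limit.1 hT
    choose Q hQ using ht
    have hc : CauchySeq Q := by
      refine Metric.cauchySeq_iff.2 fun ε hε => ?_
      obtain ⟨N, hN⟩ := Metric.cauchySeq_iff.1 hlim.cauchySeq ε hε
      refine ⟨N, fun m hm n hn => lt_of_le_of_lt ?_ (hN m hm n hn)⟩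
      rw [dist_eq_norm, dist_eq_norm]
      exact ((hQ m).sub (hQ n)).norm_le
    obtain ⟨Q', hQ'⟩ := cauchySeq_tendsto_of_complete hc
    refine ⟨Q', fun χ v => ?_⟩
    have h1 : Filter.Tendsto (fun n => X.loc χ (Q n v)) Filter.atTop
        (nhds (X.loc χ (Q' v))) :=
      ((X.loc χ).continuous.tendsto _).comp
        ((ContinuousLinearMap.apply ℂ X.E v).continuous.tendsto _ |>.comp hQ')
    have h2 : Filter.Tendsto (fun n => eval μ (X.localization χ).restrictInl (t n)
        (X.loc χ v)) Filter.atTop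
        (nhds (eval μ (X.localization χ).restrictInl T (X.loc χ v))) := by
      have h3 := (starHomCLM (eval μ (X.localization χ).restrictInl)).continuous.tendsto T
      exact ((ContinuousLinearMap.apply ℂ _ (X.loc χ v)).continuous.tendsto _).comp
        (h3.comp hlim)
    exact tendsto_nhds_unique h1 (h2.congr fun n => (hQ n χ v).symm)
  · rintro _ ⟨γ, a, rfl⟩
    exact ⟨_, X.represents_delta γ a⟩

variable (X) in
/-- The integrated form of an equivariant bimodule. -/
def GradedBimodule.integrated (hμ : μ (Set.range e.incl) = 1) :
    TwistedCrossedProduct μ e α.restrict →ₙₐ[ℂ] (X.E →L[ℂ] X.E) where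
  toFun T := (X.exists_represents hμ T).choose
  map_smul' c T := (X.exists_represents hμ _).choose_spec.unique
    ((X.exists_represents hμ T).choose_spec.smul c)
  map_zero' := (X.exists_represents hμ _).choose_spec.unique GradedBimodule.represents_zero
  map_add' T T' := (X.exists_represents hμ _).choose_spec.unique
    ((X.exists_represents hμ T).choose_spec.add (X.exists_represents hμ T').choose_spec)
  map_mul' T T' := (X.exists_represents hμ _).choose_spec.unique
    ((X.exists_represents hμ T).choose_spec.mul (X.exists_represents hμ T').choose_spec)

variable (hμ : μ (Set.range e.incl) = 1)

lemma GradedBimodule.integrated_delta (γ : Γτ) (a : A) :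
    X.integrated hμ (delta μ e α.restrict γ a) = X.deltaOp μ γ a :=
  (X.exists_represents hμ _).choose_spec.unique (X.represents_delta γ a)

lemma GradedBimodule.norm_integrated_le (T : TwistedCrossedProduct μ e α.restrict) :
    ‖X.integrated hμ T‖ ≤ ‖T‖ :=
  (X.exists_represents hμ T).choose_spec.norm_le

variable (X) in
/-- The integrated form as a bounded operator. -/
def GradedBimodule.integratedL :
    TwistedCrossedProduct μ e α.restrict →L[ℂ] (X.E →L[ℂ] X.E) :=
  LinearMap.mkContinuous
    { toFun := X.integrated hμ
      map_add' := map_add _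
      map_smul' := map_smul _ } 1 fun T => by
    rw [one_mul]
    exact X.norm_integrated_le hμ T

lemma GradedBimodule.U_deltaOp (s : S) (γ : Γτ) (a : A) (u : X.E) :
    X.U (SemidirectProduct.inr s) (X.deltaOp μ γ a u) =
      X.deltaOp μ (ℓ.act s γ) (α.toAut (SemidirectProduct.inr s) a)
        (X.U (SemidirectProduct.inr s) u) := by
  rw [X.deltaOp_apply, X.deltaOp_apply, X.circleProj_U, X.π_equivariant,
    LiftedAction.pullback_inr, ← X.U_mul, ← X.U_mul, SemidirectProduct.inl_aut, map_inv,
    inv_mul_cancel_right]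

lemma GradedBimodule.deltaOp_inner (γ : Γτ) (a : A) :
    IsAdjoint B (X.deltaOp μ γ a) (X.integrated hμ (star (delta μ e α.restrict γ a))) := by
  intro u v
  rw [star_delta hμ, X.integrated_delta, X.deltaOp_apply, X.deltaOp_apply, X.π_inner,
    X.U_isAdjoint, X.circleProj_isAdjoint hμ, X.π_equivariant, X.circleProj_π, X.circleProj_U,
    ← map_inv, LiftedAction.pullback_inl]
  change _ = inner B u (X.π (α.toAut (SemidirectProduct.inl (e.proj γ)⁻¹) (star a)) _)
  rw [← map_inv e.proj]
  rfl

/-- The bimodule over the twisted crossed product given by an equivariant bimodule. -/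
def GradedBimodule.int (X : GradedBimodule (ℓ.pullback α) B) (hμ : μ (Set.range e.incl) = 1) :
    GradedBimodule (twistedAction ℓ α hμ) B where
  E := X.E
  ε := X.ε
  U := X.U.comp SemidirectProduct.inr
  π := X.integrated hμ
  ε_sq := X.ε_sq
  ε_inner := X.ε_inner
  U_inner s := X.U_inner _
  U_continuous v := (X.U_continuous v).comp (continuous_inr _)
  U_even s := X.U_even _
  π_inner T := by
    let P : Submodule ℂ (TwistedCrossedProduct μ e α.restrict) :=
      { carrier := {T | IsAdjoint B (X.integrated hμ T) (X.integrated hμ (star T))}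
        add_mem' := fun {T T'} h h' u v => by
          simp only [map_add, star_add, add_apply, CStarModule.inner_add_left,
            CStarModule.inner_add_right, h u v, h' u v]
        zero_mem' := fun u v => by
          simp only [map_zero, star_zero, zero_apply, CStarModule.inner_zero_left,
            CStarModule.inner_zero_right]
        smul_mem' := fun c T h u v => by
          simp only [map_smul, star_smul, FunLike.coe_smul, Pi.smul_apply,
            CStarModule.inner_smul_left_complex, CStarModule.inner_smul_right_complex, h u v] }
    refine mem_of_dense_span (dense_span_deltaSet hμ) (P := P) ?_ ?_ T
    · have h1 : IsClosed {T | ∀ u v, inner B (X.integratedL hμ T u) v =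
          inner B u (X.integratedL hμ (star T) v)} := by
        simp only [Set.ofPred_forall]
        refine isClosed_iInter fun u => isClosed_iInter fun v => isClosed_eq ?_ ?_
        · exact CStarModule.continuous_inner.comp
            (((X.integratedL hμ).continuous.clm_apply continuous_const).prodMk continuous_const)
        · exact CStarModule.continuous_inner.comp (continuous_const.prodMk
            (((X.integratedL hμ).continuous.comp continuous_star).clm_apply continuous_const))
      exact h1
    · rintro _ ⟨γ, a, rfl⟩
      change IsAdjoint B (X.integrated hμ _) _
      rw [X.integrated_delta]
      exact X.deltaOp_inner hμ γ a
  π_even T u := by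
    refine DFunLike.congr_fun (DFunLike.congr_fun (twisted_ext hμ
      (f := ContinuousLinearMap.mul ℂ (X.E →L[ℂ] X.E) X.ε ∘L X.integratedL hμ)
      (g := (ContinuousLinearMap.mul ℂ (X.E →L[ℂ] X.E)).flip X.ε ∘L X.integratedL hμ)
      fun γ a => ContinuousLinearMap.ext fun u => ?_) T) u
    change X.ε (X.integrated hμ _ u) = X.integrated hμ _ (X.ε u)
    rw [X.integrated_delta, X.deltaOp_apply, X.deltaOp_apply, X.circleProj_ε, X.π_even, X.U_even]
  π_equivariant s T u := by
    refine DFunLike.congr_fun (DFunLike.congr_fun (twisted_ext hμ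
      (f := ContinuousLinearMap.mul ℂ (X.E →L[ℂ] X.E) (X.U (SemidirectProduct.inr s)) ∘L
        X.integratedL hμ)
      (g := (ContinuousLinearMap.mul ℂ (X.E →L[ℂ] X.E)).flip (X.U (SemidirectProduct.inr s)) ∘L
        X.integratedL hμ ∘L starHomCLM (twistedShift ℓ α hμ s))
      fun γ a => ContinuousLinearMap.ext fun u => ?_) T) u
    change X.U _ (X.integrated hμ _ u) = X.integrated hμ (twistedShift ℓ α hμ s _) (X.U _ u)
    rw [twistedShift_delta, X.integrated_delta, X.integrated_delta, X.U_deltaOp]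

end Integration

/-! ### Integration of cycles and of homotopies. -/

section IntegratedCycle

variable {Γ Γτ S A : Type*} [Group Γ] [TopologicalSpace Γ] [DiscreteTopology Γ]
  [Group Γτ] [TopologicalSpace Γτ] [IsTopologicalGroup Γτ] [MeasurableSpace Γτ] [BorelSpace Γτ]
  [Group S] [TopologicalSpace S] [NonUnitalCStarAlgebra A]
  {μ : Measure Γτ} [μ.IsHaarMeasure] {e : CircleExtension Γ Γτ}
  {φ : S →* MulAut Γ} {ℓ : LiftedAction φ e} {α : CStarAction (Γ ⋊[φ] S) A}
  {B : Type*} [CommCStarAlgebra B] [PartialOrder B] [StarOrderedRing B]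

open TwistedCrossedProduct

/-- An intertwiner of equivariant bimodules intertwines the integrated forms. -/
lemma GradedBimodule.map_integrated {B' : Type*} [CommCStarAlgebra B'] [PartialOrder B']
    [StarOrderedRing B'] {X : GradedBimodule (ℓ.pullback α) B}
    {Y : GradedBimodule (ℓ.pullback α) B'} (hμ : μ (Set.range e.incl) = 1) (q : X.E →L[ℂ] Y.E)
    (hU : ∀ g u, q (X.U g u) = Y.U g (q u)) (hπ : ∀ a u, q (X.π a u) = Y.π a (q u))
    (T : TwistedCrossedProduct μ e α.restrict) (u : X.E) :
    q (X.integrated hμ T u) = Y.integrated hμ T (q u) := by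
  refine DFunLike.congr_fun (DFunLike.congr_fun (twisted_ext hμ
    (f := ContinuousLinearMap.compL ℂ X.E X.E Y.E q ∘L X.integratedL hμ)
    (g := (ContinuousLinearMap.compL ℂ X.E Y.E Y.E).flip q ∘L Y.integratedL hμ)
    fun γ a => ContinuousLinearMap.ext fun u => ?_) T) u
  change q (X.integrated hμ _ u) = Y.integrated hμ _ (q u)
  have h : q (X.circleProj μ u) = Y.circleProj μ (q u) :=
    X.contractive.map_proj Y.contractive q (fun z v => hU _ v) u
  rw [X.integrated_delta, Y.integrated_delta, X.deltaOp_apply, Y.deltaOp_apply, hπ, hU, h]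

lemma integral_mem_submodule {Z V : Type*} [TopologicalSpace Z] [MeasurableSpace Z]
    [BorelSpace Z] {ν : Measure Z} [IsFiniteMeasureOnCompacts ν]
    [NormedAddCommGroup V] [NormedSpace ℂ V] [CompleteSpace V] (M : Submodule ℂ V)
    (hM : IsClosed (M : Set V)) {f : Z → V} (hf : Continuous f) (hs : HasCompactSupport f)
    (h : ∀ z, f z ∈ M) : ∫ z, f z ∂ν ∈ M := by
  haveI : CompleteSpace M := hM.completeSpace_coe
  let f' : Z → M := fun z => ⟨f z, h z⟩
  have hi : Integrable f' ν := by
    refine (hf.subtype_mk h).integrable_of_hasCompactSupport ?_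
    exact hs.mono fun z hz h => hz (Subtype.ext h)
  have h2 : ∫ z, f z ∂ν = M.subtypeL (∫ z, f' z ∂ν) := M.subtypeL.integral_comp_comm hi
  rw [h2]
  exact (∫ z, f' z ∂ν).2

variable (x : KasparovCycle (ℓ.pullback α) B)

/-- The commutator of `F` with `U g` is the equivariance defect times `U g`, up to sign. This is how
equivariance of a cycle becomes a commutator condition after integration. -/
lemma KasparovCycle.π_mul_comm_U (b : A) (g : Γτ ⋊[ℓ.act] S) :
    x.π b * (x.F * x.U g - x.U g * x.F) = -(x.π b * (x.U g * x.F * x.U g⁻¹ - x.F) * x.U g) :=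
  ContinuousLinearMap.ext fun v => by
    simp only [mul_apply_eq_comp, sub_apply, neg_apply, map_sub, x.U_inv', neg_sub]

lemma KasparovCycle.continuous_π_mul_comm_U (b : A) :
    Continuous fun γ : Γτ => x.π b * (x.F * x.U (SemidirectProduct.inl γ) -
      x.U (SemidirectProduct.inl γ) * x.F) := by
  simp only [x.π_mul_comm_U]
  refine (continuous_compact_mul' (B := B) (C := 1)
    (V' := fun γ : Γτ => x.U (SemidirectProduct.inl γ)⁻¹)
    (fun γ => x.norm_U_le _) (fun γ => x.U_isAdjoint _) (fun v => ?_)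
    (fun γ => x.F_equivariant b _) ((x.F_continuous b).comp (continuous_inl _))).neg
  simp only [← map_inv]
  exact (x.U_continuous v).comp ((continuous_inl _).comp continuous_inv)

lemma KasparovCycle.integral_π_mul_comm_U (b : A) (v : x.E) :
    ∫ γ : Γτ, (e.kernel γ • (x.π b * (x.F * x.U (SemidirectProduct.inl γ) -
      x.U (SemidirectProduct.inl γ) * x.F))) v ∂μ =
    (x.π b * (x.F * x.circleProj μ - x.circleProj μ * x.F)) v := by
  have h2 : ∀ v, Integrable (fun γ => e.kernel γ • x.U (SemidirectProduct.inl γ) v) μ :=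
    fun v => by
      have h := integrable_kernel_smul (e := e) μ 1 (x.contractive.continuous v)
      simp only [one_mul] at h
      exact h
  have h3 : ∀ v, x.circleProj μ v = ∫ γ, e.kernel γ • x.U (SemidirectProduct.inl γ) v ∂μ :=
    fun v => rfl
  simp only [mul_apply_eq_comp, sub_apply, FunLike.coe_smul, Pi.smul_apply]
  rw [h3, h3, ← x.F.integral_comp_comm (h2 v), ← integral_sub (x.F.integrable_comp (h2 v)) (h2 _)]
  refine Eq.trans ?_
    ((x.π b).integral_comp_comm ((x.F.integrable_comp (h2 v)).sub (h2 (x.F v))))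
  refine integral_congr_ae (.of_forall fun γ => ?_)
  simp only [map_sub, map_smul, smul_sub]

/-- The operator is the average over the circle of the compact operators `π(b) [F, U(z)]`, weighted
by the kernel. These depend norm continuously on `z`, so the integral may be taken in norm and stays
in the closed subspace of compact operators. -/
lemma KasparovCycle.π_mul_comm_circleProj_mem (b : A) :
    x.π b * (x.F * x.circleProj μ - x.circleProj μ * x.F) ∈ compactOps B x.E := by
  have hc : Continuous fun γ : Γτ => e.kernel γ • (x.π b * (x.F * x.U (SemidirectProduct.inl γ) -
      x.U (SemidirectProduct.inl γ) * x.F)) :=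
    e.continuous_kernel.smul (x.continuous_π_mul_comm_U b)
  have hs : HasCompactSupport fun γ : Γτ => e.kernel γ • (x.π b *
      (x.F * x.U (SemidirectProduct.inl γ) - x.U (SemidirectProduct.inl γ) * x.F)) :=
    e.hasCompactSupport_kernel.smul_right
  have h1 := integral_mem_submodule (ν := μ) (compactOps B x.E) isClosed_compactOps hc hs
    fun γ => by
      rw [x.π_mul_comm_U]
      exact Submodule.smul_mem _ _ (neg_mem (mul_mem_compactOps_right (x.U_isAdjoint _)
        (x.F_equivariant b _)))
  convert h1 using 1
  refine ContinuousLinearMap.ext fun v => ?_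
  rw [ContinuousLinearMap.integral_apply (hc.integrable_of_hasCompactSupport hs),
    x.integral_π_mul_comm_U]

/-- With the coefficient moved to the right end, a condition of the form "`π(a) T` is compact for
all `a`" transfers at once to products `δ_γ(a) T`. -/
lemma GradedBimodule.deltaOp_eq (X : GradedBimodule (ℓ.pullback α) B) (γ : Γτ) (a : A) :
    X.deltaOp μ γ a = X.U (SemidirectProduct.inl γ) * X.circleProj μ *
      X.π ((ℓ.pullback α).toAut (SemidirectProduct.inl γ)⁻¹ a) :=
  ContinuousLinearMap.ext fun v => by
    rw [X.deltaOp_apply, mul_apply_eq_comp, mul_apply_eq_comp, X.circleProj_π, X.π_equivariant,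
      CStarAction.apply_inv]

lemma KasparovCycle.deltaOp_mul_mem (hμ : μ (Set.range e.incl) = 1) {T : x.E →L[ℂ] x.E}
    (hT : ∀ a, x.π a * T ∈ compactOps B x.E) (γ : Γτ) (a : A) :
    x.deltaOp μ γ a * T ∈ compactOps B x.E := by
  rw [x.deltaOp_eq, mul_assoc, mul_assoc]
  exact mul_mem_compactOps_left (x.U_isAdjoint _)
    (mul_mem_compactOps_left (x.circleProj_isAdjoint hμ) (hT _))

/-- By the Leibniz rule, `[F, a U P] = [F, a] U P + a [F, U] P + a U [F, P]`. In the last term `a U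
= U (γ⁻¹ a)`, so that a coefficient stands directly in front of `[F, P]`. -/
lemma KasparovCycle.deltaOp_comm_mem (hμ : μ (Set.range e.incl) = 1) (γ : Γτ) (a : A) :
    x.F * x.deltaOp μ γ a - x.deltaOp μ γ a * x.F ∈ compactOps B x.E := by
  have hP := x.circleProj_isAdjoint hμ
  have h1 := mul_mem_compactOps_right hP (mul_mem_compactOps_right
    (x.U_isAdjoint (SemidirectProduct.inl γ)) (x.F_comm a))
  have h2 : x.π a * (x.F * x.U (SemidirectProduct.inl γ) - x.U (SemidirectProduct.inl γ) * x.F) ∈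
      compactOps B x.E := by
    rw [x.π_mul_comm_U]
    exact neg_mem (mul_mem_compactOps_right (x.U_isAdjoint _) (x.F_equivariant a _))
  have h3 := mul_mem_compactOps_right hP h2
  have h4 := mul_mem_compactOps_left (x.U_isAdjoint (SemidirectProduct.inl γ))
    (x.π_mul_comm_circleProj_mem (μ := μ)
      ((ℓ.pullback α).toAut (SemidirectProduct.inl γ)⁻¹ a))
  convert add_mem (add_mem h1 h3) h4 using 1
  refine ContinuousLinearMap.ext fun v => ?_
  simp only [mul_apply_eq_comp, sub_apply, add_apply, x.deltaOp_apply, map_sub, x.π_equivariant,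
    CStarAction.apply_inv]
  abel

/-- The integrated form of an equivariant cycle. -/
def KasparovCycle.int (x : KasparovCycle (ℓ.pullback α) B) (hμ : μ (Set.range e.incl) = 1) :
    KasparovCycle (twistedAction ℓ α hμ) B :=
  KasparovCycle.ofDense (x.toGradedBimodule.int hμ) x.F x.Fadj x.F_inner x.F_odd
    (dense_span_deltaSet hμ)
    (by
      rintro _ ⟨γ, a, rfl⟩
      have h := x.deltaOp_comm_mem hμ γ a
      rw [← x.integrated_delta hμ] at h
      exact h)
    (by
      rintro _ ⟨γ, a, rfl⟩
      have h := x.deltaOp_mul_mem hμ x.F_sq γ a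
      rw [← x.integrated_delta hμ] at h
      exact h)
    (by
      rintro _ ⟨γ, a, rfl⟩
      have h := x.deltaOp_mul_mem hμ x.F_selfAdj γ a
      rw [← x.integrated_delta hμ] at h
      exact h)
    (by
      rintro _ ⟨γ, a, rfl⟩ s
      have h := x.deltaOp_mul_mem hμ
        (fun a => x.F_equivariant a (SemidirectProduct.inr s)) γ a
      rw [← x.integrated_delta hμ, ← map_inv] at h
      exact h)
    (by
      rintro _ ⟨γ, a, rfl⟩
      have h1 : Continuous fun s : S => x.π ((ℓ.pullback α).toAut (SemidirectProduct.inl γ)⁻¹ a) *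
          (x.U (SemidirectProduct.inr s) * x.F * x.U (SemidirectProduct.inr s⁻¹) - x.F) :=
        ((x.F_continuous _).comp (continuous_inr ℓ.act)).congr fun s => by
          rw [Function.comp_apply, map_inv SemidirectProduct.inr]
      refine ((continuous_const_mul (x.U (SemidirectProduct.inl γ) * x.circleProj μ)).comp
        h1).congr fun s => ?_
      refine Eq.trans ?_ (congrArg (· * (x.U (SemidirectProduct.inr s) * x.F *
        x.U (SemidirectProduct.inr s⁻¹) - x.F)) (x.integrated_delta hμ γ a).symm)
      rw [x.deltaOp_eq, mul_assoc _ (x.π _)]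
      rfl)

lemma KasparovCycle.IsEvaluation.int (hμ : μ (Set.range e.incl) = 1) {t : I}
    {W : KasparovCycle (ℓ.pullback α) C(I, ℂ)} {x : KasparovCycle (ℓ.pullback α) ℂ}
    (h : W.IsEvaluation t x) : (W.int hμ).IsEvaluation t (x.int hμ) := by
  obtain ⟨q, q0, q1, q2, q3, q4, q5⟩ := h.exists_clm
  exact ⟨q.toLinearMap, q0, q1, q2, fun s u => q3 _ u,
    fun T u => GradedBimodule.map_integrated hμ q q3 q4 T u, q5⟩

lemma KasparovCycle.Homotopic.int (hμ : μ (Set.range e.incl) = 1)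
    {x y : KasparovCycle (ℓ.pullback α) ℂ} (h : x.Homotopic y) :
    (x.int hμ).Homotopic (y.int hμ) := by
  obtain ⟨W, h0, h1⟩ := h
  exact ⟨W.int hμ, h0.int hμ, h1.int hμ⟩

lemma KasparovCycle.int_sum (hμ : μ (Set.range e.incl) = 1)
    (x y : KasparovCycle (ℓ.pullback α) ℂ) :
    ((x.sum y).int hμ).UnitaryEquiv ((x.int hμ).sum (y.int hμ)) := by
  let q1 : (x.sum y).E →L[ℂ] x.E :=
    ContinuousLinearMap.fst ℂ x.E y.E ∘L (sumEquiv ℂ x.E y.E).toContinuousLinearMap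
  let q2 : (x.sum y).E →L[ℂ] y.E :=
    ContinuousLinearMap.snd ℂ x.E y.E ∘L (sumEquiv ℂ x.E y.E).toContinuousLinearMap
  refine ⟨LinearEquiv.refl ℂ (x.sum y).E, fun u v => rfl, fun u => rfl, fun s u => rfl,
    fun T u => sum_ext (B := ℂ) ?_ ?_, fun u => rfl⟩
  · exact GradedBimodule.map_integrated (X := (x.sum y).toGradedBimodule)
      (Y := x.toGradedBimodule) hμ q1 (fun g u => rfl) (fun a u => rfl) T u
  · exact GradedBimodule.map_integrated (X := (x.sum y).toGradedBimodule)
      (Y := y.toGradedBimodule) hμ q2 (fun g u => rfl) (fun a u => rfl) T u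

/-- The map on `KK`-groups induced by integration. -/
def intHom (hμ : μ (Set.range e.incl) = 1) : KK (ℓ.pullback α) →+ KK (twistedAction ℓ α hμ) :=
  AddMonoidHom.mk' (Quot.map (fun x => x.int hμ) fun _ _ h => h.int hμ) (by
    rintro ⟨x⟩ ⟨y⟩
    exact KK.sound (.of_unitaryEquiv (KasparovCycle.int_sum hμ x y)))

end IntegratedCycle

/-! ### Reconstruction of the covariant pair from a non-degenerate representation. -/

section Disintegration

variable {Γ Γτ S A : Type*} [Group Γ] [TopologicalSpace Γ] [DiscreteTopology Γ]
  [Group Γτ] [TopologicalSpace Γτ] [IsTopologicalGroup Γτ] [MeasurableSpace Γτ] [BorelSpace Γτ]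
  [Group S] [TopologicalSpace S] [NonUnitalCStarAlgebra A] [TopologicalSpace.SeparableSpace A]
  {μ : Measure Γτ} [μ.IsHaarMeasure] {e : CircleExtension Γ Γτ}
  {φ : S →* MulAut Γ} {ℓ : LiftedAction φ e} {α : CStarAction (Γ ⋊[φ] S) A}
  {B : Type*} [CommCStarAlgebra B] [PartialOrder B] [StarOrderedRing B]
  {hμ : μ (Set.range e.incl) = 1}

open TwistedCrossedProduct

/-- The action of `Γτ` on the coefficients. -/
def CStarAction.lift (α : CStarAction (Γ ⋊[φ] S) A) (e : CircleExtension Γ Γτ) :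
    Γτ →* (A ≃⋆ₐ[ℂ] A) :=
  α.restrict.toAut.comp e.proj

lemma CStarAction.lift_incl (z : Circle) (a : A) : α.lift e (e.incl z) a = a := by
  change α.restrict.toAut (e.proj (e.incl z)) a = a
  rw [e.proj_incl, map_one]
  rfl

lemma CStarAction.lift_one (a : A) : α.lift e 1 a = a := by
  rw [map_one]
  rfl

lemma CStarAction.lift_mul (γ γ' : Γτ) (a : A) :
    α.lift e (γ * γ') a = α.lift e γ (α.lift e γ' a) := by
  rw [map_mul]
  rfl

lemma CStarAction.lift_act (s : S) (γ : Γτ) (a : A) :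
    α.lift e (ℓ.act s γ) (α.toAut (SemidirectProduct.inr s) a) =
      α.toAut (SemidirectProduct.inr s) (α.lift e γ a) := by
  refine Eq.trans ?_ (α.inl_inr s (e.proj γ) a)
  rw [← ℓ.proj_apply]
  rfl

lemma delta_mul_delta (hμ : μ (Set.range e.incl) = 1) (γ γ' : Γτ) (a b : A) :
    delta μ e α.restrict γ a * delta μ e α.restrict γ' b =
      delta μ e α.restrict (γ * γ') (a * α.lift e γ b) :=
  delta_mul hμ γ γ' a b

lemma star_delta' (hμ : μ (Set.range e.incl) = 1) (γ : Γτ) (a : A) :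
    star (delta μ e α.restrict γ a) =
      delta μ e α.restrict γ⁻¹ (α.lift e γ⁻¹ (star a)) := by
  rw [star_delta hμ, ← map_inv e.proj]
  rfl

/-- The partition of the twisted crossed product defined by a partition of the coefficients. -/
def StrictPartition.twisted (p : StrictPartition A) (hμ : μ (Set.range e.incl) = 1)
    (α : CStarAction (Γ ⋊[φ] S) A) :
    StrictPartition (TwistedCrossedProduct μ e α.restrict) := by
  -- The elements `δ_1(a)` are a copy of the coefficients acting on generators through the
  -- coefficient alone, so a partition of `A` is transported by `δ_1`.
  have h1 : ∀ a (γ : Γτ) b, delta μ e α.restrict 1 a * delta μ e α.restrict γ b =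
      delta μ e α.restrict γ (a * b) := fun a γ b => by
    rw [delta_mul_delta hμ, one_mul, CStarAction.lift_one]
  have h2 : ∀ N, ∑ n ∈ Finset.range N, delta μ e α.restrict 1 (p.d n) *
      delta μ e α.restrict 1 (p.d n) = delta μ e α.restrict 1 (p.u N) := fun N => by
    rw [StrictPartition.u]
    refine Eq.trans (Finset.sum_congr rfl fun n _ => h1 _ _ _) ?_
    exact (map_sum (deltaL μ e α.restrict hμ 1) _ _).symm
  have h3 : ∀ N, ‖delta μ e α.restrict 1 (p.u N)‖ ≤ 1 := fun N =>
    (norm_delta_le hμ _ _).trans (p.norm_sum_le N)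
  exact
  { d := fun n => delta μ e α.restrict 1 (p.d n)
    star_d := fun n => by
      rw [star_delta' hμ, p.star_d, inv_one, CStarAction.lift_one]
    norm_sum_le := fun N => by
      rw [h2]
      exact h3 N
    tendsto := fun T => by
      simp only [h2]
      let P : Submodule ℂ (TwistedCrossedProduct μ e α.restrict) :=
        { carrier := {T | Filter.Tendsto (fun N => ContinuousLinearMap.mul ℂ _
            (delta μ e α.restrict 1 (p.u N)) T) Filter.atTop
            (nhds (ContinuousLinearMap.id ℂ _ T))}
          add_mem' := fun {a b} ha hb => by
            simp only [Set.mem_ofPred_eq, map_add] at ha hb ⊢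
            exact ha.add hb
          zero_mem' := by simp
          smul_mem' := fun c a ha => by
            simp only [Set.mem_ofPred_eq, map_smul] at ha ⊢
            exact ha.const_smul c }
      refine mem_of_dense_span (dense_span_deltaSet hμ) (P := P)
        (isClosed_setOf_tendsto (C := 1) fun N T => (norm_mul_le _ _).trans
          (mul_le_mul_of_nonneg_right (h3 N) (norm_nonneg _))) ?_ T
      rintro _ ⟨γ, a, rfl⟩
      change Filter.Tendsto (fun N => delta μ e α.restrict 1 (p.u N) * delta μ e α.restrict γ a)
        Filter.atTop (nhds (delta μ e α.restrict γ a))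
      simp only [h1]
      exact ((deltaL μ e α.restrict hμ γ).continuous.tendsto a).comp (p.tendsto a)
    dense := by
      let M : Submodule ℂ (TwistedCrossedProduct μ e α.restrict) :=
        { carrier := {T | Summable fun n => ‖delta μ e α.restrict 1 (p.d n) * T‖}
          add_mem' := fun {a b} ha hb => by
            refine Summable.of_nonneg_of_le (fun n => norm_nonneg _) (fun n => ?_) (ha.add hb)
            rw [mul_add]
            exact norm_add_le _ _
          zero_mem' := by simp
          smul_mem' := fun c a ha => by
            simp only [Set.mem_ofPred_eq, mul_smul_comm, norm_smul] at ha ⊢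
            exact ha.mul_left _ }
      have hM : ∀ T, T ∈ M.topologicalClosure := by
        refine mem_of_dense_span (dense_span_deltaSet hμ) (Submodule.isClosed_topologicalClosure _) ?_
        rintro _ ⟨γ, a, rfl⟩
        refine map_mem_closure (deltaL μ e α.restrict hμ γ).continuous (p.dense a) fun b hb => ?_
        refine Summable.of_nonneg_of_le (fun n => norm_nonneg _) (fun n => ?_) hb
        rw [h1]
        exact norm_delta_le hμ _ _
      exact hM }

namespace GradedBimodule

variable {Y : GradedBimodule (twistedAction ℓ α hμ) B}

lemma NonDegenerate.dense_delta (hY : Y.NonDegenerate) : Dense (Submodule.span ℂ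
    {v : Y.E | ∃ γ b u, v = Y.π (delta μ e α.restrict γ b) u} : Set Y.E) := by
  intro v
  refine mem_of_dense_span hY (P := (Submodule.span ℂ {v : Y.E | ∃ γ b u,
    v = Y.π (delta μ e α.restrict γ b) u}).topologicalClosure)
    (Submodule.isClosed_topologicalClosure _) ?_ v
  rintro _ ⟨T, u, rfl⟩
  refine clm_mem_of_dense_span (dense_span_deltaSet hμ)
    (Submodule.isClosed_topologicalClosure _)
    ((ContinuousLinearMap.apply ℂ Y.E u) ∘L Y.πL) ?_ T
  rintro _ ⟨γ, b, rfl⟩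
  exact Submodule.le_topologicalClosure _ (Submodule.subset_span ⟨γ, b, u, rfl⟩)

lemma NonDegenerate.clm_ext (hY : Y.NonDegenerate) {V : Type*} [NormedAddCommGroup V] [NormedSpace ℂ V]
    {f g : Y.E →L[ℂ] V} (h : ∀ γ b u, f (Y.π (delta μ e α.restrict γ b) u) =
      g (Y.π (delta μ e α.restrict γ b) u)) : f = g := by
  refine ContinuousLinearMap.ext_on hY.dense_delta ?_
  rintro _ ⟨γ, b, u, rfl⟩
  exact h γ b u

/-- With `u_N` the approximate unit of a strict partition, `δ_γ(u_N) δ_γ'(b) = δ_{γγ'}(u_N γ(b))`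
converges to `δ_{γγ'}(γ(b))`. So the contractions `π(δ_γ(u_N))` converge on a dense subspace, hence
strongly, and the limit is independent of the choices because its values on generators are. -/
lemma NonDegenerate.exists_implements (hY : Y.NonDegenerate) (γ : Γτ) : ∃ T : Y.E →L[ℂ] Y.E,
    (∀ γ' b u, T (Y.π (delta μ e α.restrict γ' b) u) =
      Y.π (delta μ e α.restrict (γ * γ') (α.lift e γ b)) u) ∧ ∀ v, ‖T v‖ ≤ ‖v‖ := by
  obtain ⟨p⟩ := exists_strictPartition A
  have key : ∀ γ' b u, Filter.Tendsto (fun N => Y.π (delta μ e α.restrict γ (p.u N))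
      (Y.π (delta μ e α.restrict γ' b) u)) Filter.atTop
      (nhds (Y.π (delta μ e α.restrict (γ * γ') (α.lift e γ b)) u)) := fun γ' b u => by
    have h1 := ((deltaL μ e α.restrict hμ (γ * γ')).continuous.tendsto _).comp
      (p.tendsto (α.lift e γ b))
    have h2 := ((ContinuousLinearMap.apply ℂ Y.E u).continuous.tendsto _).comp
      ((Y.continuous_π.tendsto _).comp h1)
    refine h2.congr fun N => ?_
    rw [← mul_apply_eq_comp, ← map_mul, delta_mul_delta hμ]
    rfl
  obtain ⟨T, hT, hb⟩ := exists_strong_limit (zero_le_one' ℝ)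
    (T := fun N => Y.π (delta μ e α.restrict γ (p.u N))) (fun N v => by
      refine (Y.norm_π_apply_le _ _).trans (mul_le_mul_of_nonneg_right ?_ (norm_nonneg _))
      exact (norm_delta_le hμ _ _).trans (p.norm_sum_le N)) hY.dense_delta (by
      rintro _ ⟨γ', b, u, rfl⟩
      exact ⟨_, key γ' b u⟩)
  exact ⟨T, fun γ' b u => tendsto_nhds_unique (hT _) (key γ' b u),
    fun v => (hb v).trans_eq (one_mul _)⟩

/-- The unitary that implements `γ` on a non-degenerate bimodule over the twisted crossed
product. -/
def NonDegenerate.implement (hY : Y.NonDegenerate) (γ : Γτ) : Y.E →L[ℂ] Y.E := (hY.exists_implements γ).choose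

lemma NonDegenerate.implement_delta (hY : Y.NonDegenerate) (γ γ' : Γτ) (b : A) (u : Y.E) :
    hY.implement γ (Y.π (delta μ e α.restrict γ' b) u) =
      Y.π (delta μ e α.restrict (γ * γ') (α.lift e γ b)) u :=
  (hY.exists_implements γ).choose_spec.1 γ' b u

lemma NonDegenerate.norm_implement_le (hY : Y.NonDegenerate) (γ : Γτ) (v : Y.E) : ‖hY.implement γ v‖ ≤ ‖v‖ :=
  (hY.exists_implements γ).choose_spec.2 v

attribute [irreducible] NonDegenerate.implement

lemma NonDegenerate.implement_one (hY : Y.NonDegenerate) : hY.implement 1 = 1 := by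
  refine hY.clm_ext fun γ b u => ?_
  rw [hY.implement_delta, one_mul, CStarAction.lift_one]
  rfl

lemma NonDegenerate.implement_mul (hY : Y.NonDegenerate) (γ γ' : Γτ) :
    hY.implement (γ * γ') = hY.implement γ * hY.implement γ' := by
  refine hY.clm_ext fun γ₁ b u => ?_
  rw [mul_apply_eq_comp, hY.implement_delta, hY.implement_delta, hY.implement_delta, mul_assoc,
    CStarAction.lift_mul]

lemma NonDegenerate.implement_incl (hY : Y.NonDegenerate) (z : Circle) :
    hY.implement (e.incl z) = (z : ℂ) • (1 : Y.E →L[ℂ] Y.E) := by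
  refine hY.clm_ext fun γ b u => ?_
  rw [hY.implement_delta, delta_incl_mul, CStarAction.lift_incl, map_smul]
  rfl

lemma NonDegenerate.U_implement (hY : Y.NonDegenerate) (s : S) (γ : Γτ) (v : Y.E) :
    Y.U s (hY.implement γ v) = hY.implement (ℓ.act s γ) (Y.U s v) := by
  refine DFunLike.congr_fun (hY.clm_ext (f := Y.U s * hY.implement γ)
    (g := hY.implement (ℓ.act s γ) * Y.U s) fun γ' b u => ?_) v
  rw [mul_apply_eq_comp, mul_apply_eq_comp, hY.implement_delta, Y.π_equivariant, Y.π_equivariant,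
    twistedAction_delta, twistedAction_delta, hY.implement_delta, map_mul, CStarAction.lift_act]

lemma NonDegenerate.ε_implement (hY : Y.NonDegenerate) (γ : Γτ) (v : Y.E) :
    Y.ε (hY.implement γ v) = hY.implement γ (Y.ε v) := by
  refine DFunLike.congr_fun (hY.clm_ext (f := Y.ε * hY.implement γ)
    (g := hY.implement γ * Y.ε) fun γ' b u => ?_) v
  rw [mul_apply_eq_comp, mul_apply_eq_comp, hY.implement_delta, Y.π_even, Y.π_even,
    hY.implement_delta]

/-- On generators this is the identity `δ_γ(a) δ_{γ'γ₁}(γ'(b)) = δ_{γγ'}(a) δ_γ₁(b)`. -/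
lemma NonDegenerate.π_delta_implement (hY : Y.NonDegenerate) (γ γ' : Γτ) (a : A) (v : Y.E) :
    Y.π (delta μ e α.restrict γ a) (hY.implement γ' v) =
      Y.π (delta μ e α.restrict (γ * γ') a) v := by
  refine DFunLike.congr_fun (hY.clm_ext
    (f := Y.π (delta μ e α.restrict γ a) * hY.implement γ')
    (g := Y.π (delta μ e α.restrict (γ * γ') a)) fun γ₁ b u => ?_) v
  rw [mul_apply_eq_comp, hY.implement_delta, ← mul_apply_eq_comp, ← mul_apply_eq_comp, ← map_mul,
    ← map_mul, delta_mul_delta hμ, delta_mul_delta hμ, mul_assoc, CStarAction.lift_mul]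

lemma NonDegenerate.implement_π_one (hY : Y.NonDegenerate) (γ : Γτ) (a : A) (v : Y.E) :
    hY.implement γ (Y.π (delta μ e α.restrict 1 a) v) =
      Y.π (delta μ e α.restrict 1 (α.lift e γ a)) (hY.implement γ v) := by
  rw [hY.implement_delta, hY.π_delta_implement, mul_one, one_mul]

/-- On generators the claim reduces to `δ_{γγ₁}(γ(b₁))* δ_γ₂(b₂) = δ_γ₁(b₁)* δ_{γ⁻¹γ₂}(γ⁻¹(b₂))`,
which follows from the relations. Density is then used in one variable after the other. -/
lemma NonDegenerate.implement_isAdjoint (hY : Y.NonDegenerate) (γ : Γτ) :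
    IsAdjoint B (hY.implement γ) (hY.implement γ⁻¹) := by
  have h1 : ∀ γ₁ b₁ u₁ γ₂ b₂ u₂,
      inner B (hY.implement γ (Y.π (delta μ e α.restrict γ₁ b₁) u₁))
        (Y.π (delta μ e α.restrict γ₂ b₂) u₂) =
      inner B (Y.π (delta μ e α.restrict γ₁ b₁) u₁)
        (hY.implement γ⁻¹ (Y.π (delta μ e α.restrict γ₂ b₂) u₂)) := by
    intro γ₁ b₁ u₁ γ₂ b₂ u₂
    rw [hY.implement_delta, hY.implement_delta, Y.π_inner, Y.π_inner, ← mul_apply_eq_comp,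
      ← mul_apply_eq_comp, ← map_mul, ← map_mul, star_delta' hμ, star_delta' hμ,
      delta_mul_delta hμ, delta_mul_delta hμ, mul_inv_rev, mul_assoc, CStarAction.lift_mul,
      CStarAction.lift_mul, ← map_star (α.lift e γ), ← CStarAction.lift_mul γ⁻¹ γ,
      inv_mul_cancel, CStarAction.lift_one]
  have h2 : ∀ γ₁ b₁ u₁ v,
      inner B (hY.implement γ (Y.π (delta μ e α.restrict γ₁ b₁) u₁)) v =
      inner B (Y.π (delta μ e α.restrict γ₁ b₁) u₁) (hY.implement γ⁻¹ v) := by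
    intro γ₁ b₁ u₁ v
    let P : Submodule ℂ Y.E :=
      { carrier := {v | inner B (hY.implement γ (Y.π (delta μ e α.restrict γ₁ b₁) u₁)) v =
          inner B (Y.π (delta μ e α.restrict γ₁ b₁) u₁) (hY.implement γ⁻¹ v)}
        add_mem' := fun {a b} ha hb => by
          simp only [Set.mem_ofPred_eq, map_add, CStarModule.inner_add_right] at ha hb ⊢
          rw [ha, hb]
        zero_mem' := by simp
        smul_mem' := fun c a ha => by
          simp only [Set.mem_ofPred_eq, map_smul, CStarModule.inner_smul_right_complex] at ha ⊢
          rw [ha] }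
    refine mem_of_dense_span hY.dense_delta (P := P) (isClosed_eq ?_ ?_) ?_ v
    · exact CStarModule.continuous_inner.comp (continuous_const.prodMk continuous_id)
    · exact CStarModule.continuous_inner.comp
        (continuous_const.prodMk (hY.implement γ⁻¹).continuous)
    · rintro _ ⟨γ₂, b₂, u₂, rfl⟩
      exact h1 _ _ _ _ _ _
  intro u v
  let P : Submodule ℂ Y.E :=
    { carrier := {u | inner B (hY.implement γ u) v = inner B u (hY.implement γ⁻¹ v)}
      add_mem' := fun {a b} ha hb => by
        simp only [Set.mem_ofPred_eq, map_add, CStarModule.inner_add_left] at ha hb ⊢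
        rw [ha, hb]
      zero_mem' := by simp
      smul_mem' := fun c a ha => by
        simp only [Set.mem_ofPred_eq, map_smul, CStarModule.inner_smul_left_complex] at ha ⊢
        rw [ha] }
  refine mem_of_dense_span hY.dense_delta (P := P) (isClosed_eq ?_ ?_) ?_ u
  · exact CStarModule.continuous_inner.comp
      ((hY.implement γ).continuous.prodMk continuous_const)
  · exact CStarModule.continuous_inner.comp (continuous_id.prodMk continuous_const)
  · rintro _ ⟨γ₁, b₁, u₁, rfl⟩
    exact h2 _ _ _ _

lemma NonDegenerate.continuous_implement (hY : Y.NonDegenerate) (v : Y.E) : Continuous fun γ => hY.implement γ v := by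
  have hρ : ∀ b, Continuous fun γ : Γτ => α.lift e γ b := fun b =>
    (e.pullback α.restrict).continuous_apply b
  let P : Submodule ℂ Y.E :=
    { carrier := {v | Continuous fun γ => hY.implement γ v}
      add_mem' := fun {a b} ha hb => by
        simp only [Set.mem_ofPred_eq, map_add] at ha hb ⊢
        exact ha.add hb
      zero_mem' := by
        simp only [Set.mem_ofPred_eq, map_zero]
        exact continuous_const
      smul_mem' := fun c a ha => by
        simp only [Set.mem_ofPred_eq, map_smul] at ha ⊢
        exact ha.const_smul c }
  refine mem_of_dense_span hY.dense_delta (P := P)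
    (isClosed_setOf_continuous (fun v γ => hY.implement γ v) 1 fun v w γ => ?_) ?_ v
  · rw [dist_eq_norm, dist_eq_norm, ← map_sub, one_mul]
    exact hY.norm_implement_le _ _
  · rintro _ ⟨γ', b, u, rfl⟩
    change Continuous fun γ => hY.implement γ _
    simp only [hY.implement_delta]
    exact (Y.continuous_π.comp (continuous_delta hμ (continuous_id.mul continuous_const)
      (hρ b))).clm_apply continuous_const

lemma NonDegenerate.continuous_implement_prod (hY : Y.NonDegenerate) (v : Y.E) :
    Continuous fun q : Γτ × S => hY.implement q.1 (Y.U q.2 v) := by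
  have h : Continuous fun q : Y.E × Γτ => hY.implement q.2 q.1 :=
    continuous_prod_of_continuous_lipschitzWith _ 1 (fun v => hY.continuous_implement v)
      fun γ => LipschitzWith.of_dist_le_mul fun v w => by
        rw [dist_eq_norm, dist_eq_norm, ← map_sub, NNReal.coe_one, one_mul]
        exact hY.norm_implement_le _ _
  have h2 : Continuous fun q : Γτ × S => (Y.U q.2 v, q.1) :=
    ((Y.U_continuous v).comp continuous_snd).prodMk continuous_fst
  exact h.comp h2

/-- The equivariant bimodule whose integrated form is a given non-degenerate bimodule. -/
def NonDegenerate.dis (hY : Y.NonDegenerate) : GradedBimodule (ℓ.pullback α) B where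
  E := Y.E
  ε := Y.ε
  U :=
    { toFun := fun g => hY.implement g.left * Y.U g.right
      map_one' := by
        rw [SemidirectProduct.one_left, SemidirectProduct.one_right, hY.implement_one, map_one,
          one_mul]
      map_mul' := fun g h => ContinuousLinearMap.ext fun v => by
        simp only [SemidirectProduct.mul_left, SemidirectProduct.mul_right, hY.implement_mul,
          map_mul, mul_apply_eq_comp, hY.U_implement] }
  π :=
    { toFun := fun a => Y.π (delta μ e α.restrict 1 a)
      map_smul' := fun c a => by rw [delta_smul, map_smul]; rfl
      map_zero' := by
        have h : delta μ e α.restrict 1 (0 : A) = 0 := map_zero (deltaL μ e α.restrict hμ 1)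
        rw [h, map_zero]
      map_add' := fun a b => by rw [delta_add, map_add]
      map_mul' := fun a b => by
        rw [← map_mul, delta_mul_delta hμ, one_mul, CStarAction.lift_one] }
  ε_sq := Y.ε_sq
  ε_inner := Y.ε_inner
  U_inner g u v := by
    change inner B (hY.implement g.left (Y.U g.right u)) (hY.implement g.left (Y.U g.right v)) =
      inner B u v
    rw [hY.implement_isAdjoint, ← mul_apply_eq_comp, ← hY.implement_mul, inv_mul_cancel,
      hY.implement_one, one_apply_eq_self, Y.U_inner]
  U_continuous v := by
    have h : Continuous fun g : Γτ ⋊[ℓ.act] S => SemidirectProduct.equivProd g :=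
      continuous_induced_dom
    exact (hY.continuous_implement_prod v).comp h
  U_even g u := by
    change Y.ε (hY.implement g.left (Y.U g.right u)) = hY.implement g.left (Y.U g.right (Y.ε u))
    rw [hY.ε_implement, Y.U_even]
  π_inner a u v := by
    refine (Y.π_inner _ u v).trans ?_
    rw [star_delta' hμ, inv_one, CStarAction.lift_one]
    rfl
  π_even a u := Y.π_even _ u
  π_equivariant g a u := by
    change hY.implement g.left (Y.U g.right (Y.π (delta μ e α.restrict 1 a) u)) =
      Y.π (delta μ e α.restrict 1 _) (hY.implement g.left (Y.U g.right u))
    rw [Y.π_equivariant, twistedAction_delta, map_one, hY.implement_π_one]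
    have h : (ℓ.pullback α).toAut g a =
        α.lift e g.left (α.toAut (SemidirectProduct.inr g.right) a) := by
      conv_lhs => rw [← SemidirectProduct.inl_left_mul_inr_right g]
      rw [CStarAction.apply_mul, LiftedAction.pullback_inl, LiftedAction.pullback_inr]
      rfl
    rw [h]

end GradedBimodule

end Disintegration

/-! ### Disintegration of cycles, and its inverse relation to integration. -/

section DisintegratedCycle

variable {Γ Γτ S A : Type*} [Group Γ] [TopologicalSpace Γ] [DiscreteTopology Γ]
  [Group Γτ] [TopologicalSpace Γτ] [IsTopologicalGroup Γτ] [MeasurableSpace Γτ] [BorelSpace Γτ]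
  [Group S] [TopologicalSpace S] [NonUnitalCStarAlgebra A] [TopologicalSpace.SeparableSpace A]
  {μ : Measure Γτ} [μ.IsHaarMeasure] {e : CircleExtension Γ Γτ}
  {φ : S →* MulAut Γ} {ℓ : LiftedAction φ e} {α : CStarAction (Γ ⋊[φ] S) A}
  {B : Type*} [CommCStarAlgebra B] [PartialOrder B] [StarOrderedRing B]
  {hμ : μ (Set.range e.incl) = 1}

open TwistedCrossedProduct

namespace GradedBimodule

lemma NonDegenerate.map_implement {B' : Type*} [CommCStarAlgebra B'] [PartialOrder B']
    [StarOrderedRing B'] {Y : GradedBimodule (twistedAction ℓ α hμ) B}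
    {Y' : GradedBimodule (twistedAction ℓ α hμ) B'} (hY : Y.NonDegenerate)
    (hY' : Y'.NonDegenerate) (q : Y.E →L[ℂ] Y'.E) (hq : ∀ T u, q (Y.π T u) = Y'.π T (q u))
    (γ : Γτ) (v : Y.E) : q (hY.implement γ v) = hY'.implement γ (q v) := by
  refine DFunLike.congr_fun (hY.clm_ext (f := q ∘L hY.implement γ)
    (g := hY'.implement γ ∘L q) fun γ' b u => ?_) v
  rw [ContinuousLinearMap.comp_apply, ContinuousLinearMap.comp_apply, hY.implement_delta, hq, hq,
    hY'.implement_delta]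

variable {Y : GradedBimodule (twistedAction ℓ α hμ) B}

lemma NonDegenerate.dis_weight (hY : Y.NonDegenerate) (z : Circle) :
    hY.dis.U (ℓ.circle z) = (z : ℂ) • (1 : Y.E →L[ℂ] Y.E) := by
  change hY.implement (e.incl z) * Y.U 1 = _
  rw [map_one, mul_one, hY.implement_incl]

lemma circleProj_eq_self {X : GradedBimodule (ℓ.pullback α) B} (hμ : μ (Set.range e.incl) = 1)
    (hX : ∀ z, X.U (ℓ.circle z) = (z : ℂ) • (1 : X.E →L[ℂ] X.E)) (v : X.E) :
    X.circleProj μ v = v :=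
  X.contractive.proj_eq_self hμ fun z => by
    change X.U (ℓ.circle z) v = _
    rw [hX]
    rfl

/-- The circle acts with weight one, so the projection `P` is the identity and `δ_γ(a)` goes to
`π(δ_1(a)) U(γ) = π(δ_γ(a))`. -/
lemma NonDegenerate.dis_integrated (hY : Y.NonDegenerate)
    (T : TwistedCrossedProduct μ e α.restrict) :
    hY.dis.integrated hμ T = Y.π T := by
  refine DFunLike.congr_fun (twisted_ext hμ (f := hY.dis.integratedL hμ) (g := Y.πL)
    fun γ a => ?_) T
  change hY.dis.integrated hμ _ = Y.π _
  rw [integrated_delta]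
  refine ContinuousLinearMap.ext fun v => ?_
  rw [hY.dis.deltaOp_apply, circleProj_eq_self hμ hY.dis_weight]
  change Y.π (delta μ e α.restrict 1 a) (hY.implement γ (Y.U 1 v)) = _
  rw [hY.π_delta_implement, one_mul, map_one]
  rfl

end GradedBimodule

namespace KasparovCycle

variable (y : KasparovCycle (twistedAction ℓ α hμ) B) (hY : y.NonDegenerate)

/-- The compact part of the failure of equivariance of the disintegrated cycle. -/
def disDefect (a : A) (q : Γτ × S) : y.E →L[ℂ] y.E :=
  y.π (delta μ e α.restrict q.1 a) * (y.U q.2 * y.F * y.U q.2⁻¹ - y.F) -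
    (y.F * y.π (delta μ e α.restrict q.1 a) - y.π (delta μ e α.restrict q.1 a) * y.F)

lemma disDefect_mem (a : A) (q : Γτ × S) : y.disDefect a q ∈ compactOps B y.E :=
  sub_mem (y.F_equivariant _ _) (y.F_comm _)

/-- The operator `π(T) (U_s F U_s⁻¹ - F)` is Lipschitz in `T` with the constant `2 ‖F‖` for all `s`.
So continuity in `s` for fixed `T` is joint continuity, and the continuous family `T = δ_γ(a)` may
be substituted. -/
lemma continuous_disDefect (a : A) : Continuous (y.disDefect a) := by
  have h0 : Continuous fun q : Γτ × S => delta μ e α.restrict q.1 a :=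
    continuous_delta hμ continuous_fst continuous_const
  have h1 := y.continuous_π.comp h0
  let C : NNReal := ⟨2 * ‖y.F‖, by positivity⟩
  have hC : ∀ s, ‖y.U s * y.F * y.U s⁻¹ - y.F‖ ≤ C := fun s => by
    change _ ≤ 2 * ‖y.F‖
    have h2 : ‖y.U s * y.F * y.U s⁻¹‖ ≤ ‖y.F‖ := by
      refine (norm_mul_le _ _).trans ?_
      refine (mul_le_mul ((norm_mul_le _ _).trans (mul_le_mul (y.norm_U_le s) le_rfl
        (norm_nonneg _) zero_le_one)) (y.norm_U_le _) (norm_nonneg _) (by positivity)).trans_eq ?_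
      ring
    refine (norm_sub_le _ _).trans ?_
    linarith
  have h2 : Continuous fun q : TwistedCrossedProduct μ e α.restrict × S =>
      y.π q.1 * (y.U q.2 * y.F * y.U q.2⁻¹ - y.F) :=
    continuous_prod_of_continuous_lipschitzWith _ C (fun T => y.F_continuous T)
      fun s => LipschitzWith.of_dist_le_mul fun T T' => by
        rw [dist_eq_norm, dist_eq_norm, ← sub_mul, ← map_sub, mul_comm (C : ℝ)]
        exact (norm_mul_le _ _).trans
          (mul_le_mul (y.norm_π_le _) (hC s) (norm_nonneg _) (norm_nonneg _))
  have h3 : Continuous fun q : Γτ × S => (delta μ e α.restrict q.1 a, q.2) :=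
    h0.prodMk continuous_snd
  exact (h2.comp h3).sub ((continuous_const.mul h1).sub (h1.mul continuous_const))

/-- Absorb the unitary of `γ = g.left` by `δ_1(a) U(γ) = δ_γ(a)`, and use `δ_γ(a) U(γ)⁻¹ = δ_1(a)`.
The defect for `g` becomes the defect for its component in `S`, with coefficient `δ_γ(a)`, together
with commutators of `F` with `δ_γ(a)` and `δ_1(a)`. All of these are known to be compact. -/
lemma dis_equivariant_eq (a : A) (g : Γτ ⋊[ℓ.act] S) :
    y.π (delta μ e α.restrict 1 a) * (hY.implement g.left * y.U g.right * y.F *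
        (hY.implement g⁻¹.left * y.U g⁻¹.right) - y.F) =
      y.disDefect a (SemidirectProduct.equivProd g) * hY.implement g.left⁻¹ +
      (y.F * y.π (delta μ e α.restrict 1 a) - y.π (delta μ e α.restrict 1 a) * y.F) := by
  refine ContinuousLinearMap.ext fun v => ?_
  have h1 : hY.implement g⁻¹.left (y.U g⁻¹.right v) = y.U g.right⁻¹ (hY.implement g.left⁻¹ v) := by
    rw [hY.U_implement]
    rfl
  have h2 : y.π (delta μ e α.restrict g.left a) (hY.implement g.left⁻¹ v) =
      y.π (delta μ e α.restrict 1 a) v := by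
    rw [hY.π_delta_implement, mul_inv_cancel]
  change y.π (delta μ e α.restrict 1 a)
      (hY.implement g.left (y.U g.right (y.F (hY.implement g⁻¹.left (y.U g⁻¹.right v)))) - y.F v) =
    y.π (delta μ e α.restrict g.left a) (y.U g.right (y.F (y.U g.right⁻¹ (hY.implement g.left⁻¹ v)))
        - y.F (hY.implement g.left⁻¹ v)) -
      (y.F (y.π (delta μ e α.restrict g.left a) (hY.implement g.left⁻¹ v)) -
        y.π (delta μ e α.restrict g.left a) (y.F (hY.implement g.left⁻¹ v))) +
      (y.F (y.π (delta μ e α.restrict 1 a) v) - y.π (delta μ e α.restrict 1 a) (y.F v))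
  rw [h1, h2, map_sub, map_sub, hY.π_delta_implement, one_mul]
  abel

/-- The equivariant cycle whose integrated form is a given non-degenerate cycle. -/
def dis : KasparovCycle (ℓ.pullback α) B where
  toGradedBimodule := hY.dis
  F := y.F
  Fadj := y.Fadj
  F_inner := y.F_inner
  F_odd := y.F_odd
  F_comm a := y.F_comm _
  F_sq a := y.F_sq _
  F_selfAdj a := y.F_selfAdj _
  F_equivariant a g := by
    have h := add_mem (mul_mem_compactOps_right (hY.implement_isAdjoint g.left⁻¹)
      (y.disDefect_mem a (SemidirectProduct.equivProd g)))
      (y.F_comm (delta μ e α.restrict 1 a))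
    rw [← y.dis_equivariant_eq hY] at h
    exact h
  F_continuous a := by
    have hi : Continuous fun g : Γτ ⋊[ℓ.act] S => SemidirectProduct.equivProd g :=
      continuous_induced_dom
    have hl : Continuous fun g : Γτ ⋊[ℓ.act] S => g.left := continuous_fst.comp hi
    have h : Continuous fun g : Γτ ⋊[ℓ.act] S =>
        y.disDefect a (SemidirectProduct.equivProd g) * hY.implement g.left⁻¹ :=
      continuous_compact_mul' (B := B) (C := 1) (V' := fun g : Γτ ⋊[ℓ.act] S => hY.implement g.left)
        (fun g => ContinuousLinearMap.opNorm_le_bound _ zero_le_one fun v =>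
          (hY.norm_implement_le _ v).trans_eq (one_mul _).symm)
        (fun g => by
          have := hY.implement_isAdjoint g.left⁻¹
          rwa [inv_inv] at this)
        (fun v => (hY.continuous_implement v).comp hl)
        (fun g => y.disDefect_mem a _) ((y.continuous_disDefect a).comp hi)
    have h2 := h.add (continuous_const (y := y.F * y.π (delta μ e α.restrict 1 a) -
      y.π (delta μ e α.restrict 1 a) * y.F))
    exact h2.congr fun g => (y.dis_equivariant_eq hY a g).symm

lemma dis_weight (y : KasparovCycle (twistedAction ℓ α hμ) ℂ) (hY : y.NonDegenerate) :
    (y.dis hY).HasWeight ℓ.circle 1 := fun z => by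
  rw [zpow_one]
  exact hY.dis_weight z

lemma dis_int (y : KasparovCycle (twistedAction ℓ α hμ) ℂ) (hY : y.NonDegenerate) :
    ((y.dis hY).int hμ).UnitaryEquiv y := by
  refine ⟨LinearEquiv.refl ℂ y.E, fun u v => rfl, fun u => rfl, fun s u => ?_,
    fun T u => DFunLike.congr_fun (hY.dis_integrated T) u, fun u => rfl⟩
  change hY.implement 1 (y.U s u) = y.U s u
  rw [hY.implement_one]
  rfl

lemma IsEvaluation.dis {t : I} {W : KasparovCycle (twistedAction ℓ α hμ) C(I, ℂ)}
    {y : KasparovCycle (twistedAction ℓ α hμ) ℂ} (hW : W.NonDegenerate) (hY : y.NonDegenerate)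
    (h : W.IsEvaluation t y) : (W.dis hW).IsEvaluation t (y.dis hY) := by
  obtain ⟨q, q0, q1, q2, q3, q4, q5⟩ := h.exists_clm
  refine ⟨q.toLinearMap, q0, q1, q2, fun g (u : W.E) => ?_, fun a u => q4 _ u, q5⟩
  change q (hW.implement g.left (W.U g.right u)) = hY.implement g.left (y.U g.right (q u))
  rw [hW.map_implement hY q q4, q3]

lemma weight_eq {x : KasparovCycle (ℓ.pullback α) ℂ} (hx : x.HasWeight ℓ.circle 1) (z : Circle) :
    x.U (ℓ.circle z) = (z : ℂ) • (1 : x.E →L[ℂ] x.E) := by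
  rw [hx z, zpow_one]

lemma integrated_delta_of_weight {x : KasparovCycle (ℓ.pullback α) ℂ}
    (hμ : μ (Set.range e.incl) = 1) (hx : x.HasWeight ℓ.circle 1) (γ : Γτ) (a : A) (v : x.E) :
    x.integrated hμ (delta μ e α.restrict γ a) v = x.π a (x.U (SemidirectProduct.inl γ) v) := by
  rw [GradedBimodule.integrated_delta, x.deltaOp_apply,
    GradedBimodule.circleProj_eq_self hμ (weight_eq hx)]

/-- A cycle of weight one is determined by its integrated form. -/
lemma UnitaryEquiv.dis {x : KasparovCycle (ℓ.pullback α) ℂ} (hx : x.HasWeight ℓ.circle 1)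
    {y : KasparovCycle (twistedAction ℓ α hμ) ℂ} (hY : y.NonDegenerate)
    (h : (x.int hμ).UnitaryEquiv y) (hX : (x.int hμ).NonDegenerate) :
    x.UnitaryEquiv (y.dis hY) := by
  obtain ⟨w, w1, w2, w3, w4, w5⟩ := h
  let q : x.E →L[ℂ] y.E := w.toLinearMap.mkContinuous 1 fun u => by
    refine le_of_sq_le_sq ?_ (by positivity)
    rw [norm_sq_inner ℂ, one_mul, norm_sq_inner ℂ]
    exact (congrArg norm (w1 u u)).le
  -- Both operators satisfy the same formula on the vectors `δ_γ'(b) u`, which span a dense subspace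
  -- as the integrated form is non-degenerate.
  have hq : ∀ (γ : Γτ) (v : x.E), q (x.U (SemidirectProduct.inl γ) v) = hY.implement γ (q v) := by
    intro γ v
    refine DFunLike.congr_fun (hX.clm_ext (f := q ∘L x.U (SemidirectProduct.inl γ))
      (g := hY.implement γ ∘L q) fun γ' b (u : x.E) => ?_) v
    have h1 : x.U (SemidirectProduct.inl γ) (x.integrated hμ (delta μ e α.restrict γ' b) u) =
        x.integrated hμ (delta μ e α.restrict (γ * γ') (α.lift e γ b)) u := by
      rw [integrated_delta_of_weight hμ hx, integrated_delta_of_weight hμ hx, x.π_equivariant,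
        LiftedAction.pullback_inl, map_mul, x.U_mul]
      rfl
    have h2 : ∀ T (u : x.E), q (x.integrated hμ T u) = y.π T (q u) := w4
    change q (x.U (SemidirectProduct.inl γ) (x.integrated hμ (delta μ e α.restrict γ' b) u)) =
      hY.implement γ (q (x.integrated hμ (delta μ e α.restrict γ' b) u))
    rw [h1, h2, h2, hY.implement_delta]
  refine ⟨w, w1, w2, fun g u => ?_, fun a u => ?_, w5⟩
  · have h1 : x.U g u = x.U (SemidirectProduct.inl g.left) (x.U (SemidirectProduct.inr g.right) u) := by
      rw [← x.U_mul, SemidirectProduct.inl_left_mul_inr_right]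
    rw [h1]
    exact (hq _ _).trans (congrArg (hY.implement g.left) (w3 g.right u))
  · refine Eq.trans (congrArg w ?_) (w4 (delta μ e α.restrict 1 a) u)
    refine Eq.trans ?_ (integrated_delta_of_weight hμ hx 1 a u).symm
    rw [map_one, map_one]
    rfl

end KasparovCycle

end DisintegratedCycle

/-! ### The isomorphism between the weight one part and the twisted crossed product. -/

section GreenJulgIsomorphism

variable {Γ Γτ S A : Type*} [Group Γ] [TopologicalSpace Γ] [DiscreteTopology Γ]
  [Group Γτ] [TopologicalSpace Γτ] [IsTopologicalGroup Γτ] [MeasurableSpace Γτ] [BorelSpace Γτ]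
  [Group S] [TopologicalSpace S] [IsTopologicalGroup S]
  [NonUnitalCStarAlgebra A] [TopologicalSpace.SeparableSpace A]
  {μ : Measure Γτ} [μ.IsHaarMeasure] {e : CircleExtension Γ Γτ}
  {φ : S →* MulAut Γ} {ℓ : LiftedAction φ e} {α : CStarAction (Γ ⋊[φ] S) A}

open TwistedCrossedProduct

lemma LiftedAction.continuousInv (ℓ : LiftedAction φ e) : ContinuousInv (Γτ ⋊[ℓ.act] S) where
  continuous_inv := by
    have h : Continuous fun g : Γτ ⋊[ℓ.act] S => SemidirectProduct.equivProd g :=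
      continuous_induced_dom
    have hl : Continuous fun g : Γτ ⋊[ℓ.act] S => g.left := continuous_fst.comp h
    have hr : Continuous fun g : Γτ ⋊[ℓ.act] S => g.right := continuous_snd.comp h
    refine continuous_induced_rng.2 ?_
    exact (ℓ.continuous.comp (hr.inv.prodMk hl.inv)).prodMk hr.inv

namespace KasparovCycle

section Weight

variable {G C : Type*} [Group G] [TopologicalSpace G] [NonUnitalCStarAlgebra C]
  {β : CStarAction G C} {j : Circle →* G} {n : ℤ} {x y : KasparovCycle β ℂ}

lemma HasWeight.sum (hx : x.HasWeight j n) (hy : y.HasWeight j n) : (x.sum y).HasWeight j n :=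
  fun z => ContinuousLinearMap.ext fun u => sum_ext (B := ℂ)
    (DFunLike.congr_fun (hx z) u.1) (DFunLike.congr_fun (hy z) u.2)

lemma HasWeight.neg (hx : x.HasWeight j n) : x.neg.HasWeight j n := hx

lemma hasWeight_zero : (KasparovCycle.zero β ℂ).HasWeight j n := fun _ =>
  ContinuousLinearMap.ext fun _ => (rfl : PUnit.unit = PUnit.unit)

lemma HasWeight.ndeg [ContinuousInv G] (p : StrictPartition C) (hx : x.HasWeight j n) :
    (x.ndeg p).HasWeight j n := fun z => ContinuousLinearMap.ext fun u =>
  x.essIncl_injective (DFunLike.congr_fun (hx z) (x.essIncl u))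

/-- Cycles of a fixed weight are stable under direct sums and under reversal of the grading, so
their classes already form a subgroup. -/
lemma exists_mk_eq_of_mem_KKweight {ξ : KK β} (hξ : ξ ∈ KKweight β j n) :
    ∃ x : KasparovCycle β ℂ, x.HasWeight j n ∧ KK.mk x = ξ := by
  induction hξ using AddSubgroup.closure_induction with
  | mem ξ h => exact h
  | zero => exact ⟨_, hasWeight_zero, rfl⟩
  | add ξ η _ _ h1 h2 =>
    obtain ⟨x, hx, rfl⟩ := h1
    obtain ⟨y, hy, rfl⟩ := h2
    exact ⟨_, hx.sum hy, rfl⟩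
  | neg ξ _ h =>
    obtain ⟨x, hx, rfl⟩ := h
    exact ⟨_, hx.neg, rfl⟩

end Weight

/-- Expanding `f` along a section turns both sides into the same finite sum of operators `π(a) U(γ)
P`. -/
lemma integrated_of_weight {x : KasparovCycle (ℓ.pullback α) ℂ}
    (hμ : μ (Set.range e.incl) = 1) (hx : x.HasWeight ℓ.circle 1) (f : e.Functions A) (v : x.E) :
    x.integrated hμ (TwistedCrossedProduct.of μ e α.restrict f) v =
      ∫ γ, x.π (f.1 γ) (x.U (SemidirectProduct.inl γ) v) ∂μ := by
  obtain ⟨r, hr⟩ := e.exists_section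
  obtain ⟨T, hT⟩ := e.exists_finset f
  have h := x.contractive.integral_homogeneous (μ := μ)
    (⟨⟨x.π, map_add x.π⟩, map_smul x.π⟩ : A →ₗ[ℂ] (x.E →L[ℂ] x.E)) f hr hT v
  refine Eq.trans ?_ h.symm
  rw [of_eq_sum f hr hT, map_sum, sum_apply]
  simp only [GradedBimodule.integrated_delta]
  rfl

/-- Correspondence prescribes the representation on homogeneous functions only; these include the
generators, so by density and continuity it prescribes the whole representation. -/
lemma corresponds_iff {x : KasparovCycle (ℓ.pullback α) ℂ} {hμ : μ (Set.range e.incl) = 1}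
    (hx : x.HasWeight ℓ.circle 1) (y : KasparovCycle (twistedAction ℓ α hμ) ℂ) :
    Corresponds μ ℓ α x y ↔ (x.int hμ).UnitaryEquiv y := by
  constructor
  · rintro ⟨w, w1, w2, w3, w4, w5⟩
    refine ⟨w, w1, w2, w4, fun T (u : x.E) => ?_, w3⟩
    let q : x.E →L[ℂ] y.E := w.toLinearMap.mkContinuous 1 fun u => by
      refine le_of_sq_le_sq ?_ (by positivity)
      rw [norm_sq_inner ℂ, one_mul, norm_sq_inner ℂ]
      exact (congrArg norm (w1 u u)).le
    refine DFunLike.congr_fun (DFunLike.congr_fun (twisted_ext hμ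
      (f := ContinuousLinearMap.compL ℂ x.E x.E y.E q ∘L x.integratedL hμ)
      (g := (ContinuousLinearMap.compL ℂ x.E y.E y.E).flip q ∘L y.πL)
      fun γ a => ContinuousLinearMap.ext fun u => ?_) T) u
    change w (x.integrated hμ (TwistedCrossedProduct.of μ e α.restrict (e.single γ a)) u) =
      y.π (TwistedCrossedProduct.of μ e α.restrict (e.single γ a)) (w u)
    rw [integrated_of_weight hμ hx, w5]
  · rintro ⟨w, w1, w2, w3, w4, w5⟩
    refine ⟨w, w1, w2, w5, w3, fun f u => ?_⟩
    rw [← integrated_of_weight hμ hx]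
    exact w4 _ u

lemma int_π_one {x : KasparovCycle (ℓ.pullback α) ℂ} (hμ : μ (Set.range e.incl) = 1)
    (hx : x.HasWeight ℓ.circle 1) (a : A) (u : x.E) :
    (x.int hμ).π (delta μ e α.restrict 1 a) u = x.π a u := by
  refine (integrated_delta_of_weight hμ hx 1 a u).trans ?_
  rw [map_one, map_one]
  rfl

/-- On a module of weight one `δ_γ(a)` acts as `π(a) U(γ)`, whose range lies in that of `π(a)`, and
`δ_1(a)` acts as `π(a)`. -/
lemma int_essential {x : KasparovCycle (ℓ.pullback α) ℂ} (hμ : μ (Set.range e.incl) = 1)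
    (hx : x.HasWeight ℓ.circle 1) : (x.int hμ).essential = x.essential := by
  refine le_antisymm (Submodule.topologicalClosure_minimal _ (Submodule.span_le.2 ?_)
    x.isClosed_essential) (Submodule.topologicalClosure_minimal _ (Submodule.span_le.2 ?_)
    (x.int hμ).isClosed_essential)
  · rintro _ ⟨T, u, rfl⟩
    refine clm_mem_of_dense_span (dense_span_deltaSet hμ) x.isClosed_essential
      ((ContinuousLinearMap.apply ℂ x.E u) ∘L x.integratedL hμ) ?_ T
    rintro _ ⟨γ, a, rfl⟩
    have h := integrated_delta_of_weight hμ hx γ a u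
    exact h ▸ x.π_mem_essential _ _
  · rintro _ ⟨a, u, rfl⟩
    have h := (x.int hμ).π_mem_essential (delta μ e α.restrict 1 a) u
    exact int_π_one hμ hx a u ▸ h

lemma int_nonDegenerate {x : KasparovCycle (ℓ.pullback α) ℂ} (hμ : μ (Set.range e.incl) = 1)
    (hx : x.HasWeight ℓ.circle 1) (h : x.NonDegenerate) : (x.int hμ).NonDegenerate := by
  have h1 : x.essential = ⊤ := Submodule.dense_iff_topologicalClosure_eq_top.1 h
  exact Submodule.dense_iff_topologicalClosure_eq_top.2 ((int_essential hμ hx).trans h1)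

/-- Integration commutes with the restriction to the essential subspace. -/
lemma ndeg_int [ContinuousInv (Γτ ⋊[ℓ.act] S)] (p : StrictPartition A)
    {x : KasparovCycle (ℓ.pullback α) ℂ} (hμ : μ (Set.range e.incl) = 1)
    (hx : x.HasWeight ℓ.circle 1) :
    ((x.ndeg p).int hμ).UnitaryEquiv ((x.int hμ).ndeg (p.twisted hμ α)) := by
  let w : x.ess.E ≃ₗ[ℂ] (x.int hμ).ess.E := LinearEquiv.ofEq _ _ (int_essential hμ hx).symm
  have hw : ∀ u, (x.int hμ).essIncl (w u) = x.essIncl u := fun u => rfl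
  refine ⟨w, fun u v => rfl, fun u => rfl, fun s u => rfl, fun T (u : x.ess.E) => ?_,
    fun (u : x.ess.E) => ?_⟩
  · refine (x.int hμ).essIncl_injective ?_
    refine Eq.trans ?_ ((x.int hμ).essIncl_π T (w u)).symm
    exact GradedBimodule.map_integrated (X := x.ess) (Y := x.toGradedBimodule) hμ x.essIncl
      (fun g u => rfl) (fun a u => rfl) T u
  · refine (x.int hμ).essIncl_injective ?_
    change x.essIncl (x.compress p x.F u) =
      (x.int hμ).essIncl ((x.int hμ).compress (p.twisted hμ α) (x.int hμ).F (w u))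
    refine tendsto_nhds_unique ((x.essIncl.continuous.tendsto _).comp
      (x.tendsto_compress p x.F_inner u)) ?_
    refine (((x.int hμ).essIncl.continuous.tendsto _).comp
      ((x.int hμ).tendsto_compress (p.twisted hμ α) (x.int hμ).F_inner (w u))).congr fun N => ?_
    refine ((x.int hμ).essIncl_compressSum _ _ _ _).trans
      (Eq.trans ?_ (x.essIncl_compressSum p x.F N u).symm)
    -- The transported partition consists of the elements `δ_1(d_n)`, which act as `π(d_n)`, so the
    -- partial sums of the two compressions are equal.
    refine Finset.sum_congr rfl fun n _ => ?_
    refine (int_π_one hμ hx _ _).trans ?_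
    exact congrArg (fun v => x.π (p.d n) (x.F v)) (int_π_one hμ hx _ _)

end KasparovCycle

/-- The inverse of integration. -/
def disMap (hμ : μ (Set.range e.incl) = 1) (p : StrictPartition A) :
    KK (twistedAction ℓ α hμ) → KK (ℓ.pullback α) :=
  Quot.lift (fun y => KK.mk ((y.ndeg (p.twisted hμ α)).dis
      (y.ess_nonDegenerate (p.twisted hμ α)))) fun y y' ⟨W, h0, h1⟩ =>
    KK.sound ⟨(W.ndeg (p.twisted hμ α)).dis (W.ess_nonDegenerate (p.twisted hμ α)),
      (h0.ndeg _).dis _ _, (h1.ndeg _).dis _ _⟩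

/-- Integration commutes with compression on weight one cycles, and such a cycle is recovered from
its non-degenerate integrated form. So the result is the compression of `x`, which is homotopic to
`x`. -/
lemma disMap_intHom (hμ : μ (Set.range e.incl) = 1) (p : StrictPartition A)
    {x : KasparovCycle (ℓ.pullback α) ℂ} (hx : x.HasWeight ℓ.circle 1) :
    disMap hμ p (intHom hμ (KK.mk x)) = KK.mk x := by
  haveI := ℓ.continuousInv
  refine Eq.trans ?_ (x.homotopic_ndeg p).symm
  have hz := KasparovCycle.int_nonDegenerate hμ (hx.ndeg p) (x.ess_nonDegenerate p)
  exact (KK.sound (.of_unitaryEquiv (KasparovCycle.UnitaryEquiv.dis (hx.ndeg p)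
    ((x.int hμ).ess_nonDegenerate (p.twisted hμ α)) (KasparovCycle.ndeg_int p hμ hx) hz))).symm

variable (ℓ α) in
/-- Integration, as an isomorphism of the weight one part of the equivariant `KK`-group with the
`KK`-group of the twisted crossed product. -/
def intEquiv (hμ : μ (Set.range e.incl) = 1) :
    KKweight (ℓ.pullback α) ℓ.circle 1 ≃+ KK (twistedAction ℓ α hμ) :=
  AddEquiv.ofBijective ((intHom hμ).comp (KKweight (ℓ.pullback α) ℓ.circle 1).subtype) <| by
    obtain ⟨p⟩ := exists_strictPartition A
    constructor
    · rintro ⟨ξ, hξ⟩ ⟨η, hη⟩ h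
      obtain ⟨x, hx, rfl⟩ := KasparovCycle.exists_mk_eq_of_mem_KKweight hξ
      obtain ⟨y, hy, rfl⟩ := KasparovCycle.exists_mk_eq_of_mem_KKweight hη
      refine Subtype.ext ?_
      change KK.mk x = KK.mk y
      -- Injectivity: each class in the weight one subgroup has a representative of weight one, and
      -- on such classes integration has a left inverse. The homotopies involved need not have
      -- weight one.
      rw [← disMap_intHom hμ p hx, ← disMap_intHom hμ p hy]
      exact congrArg (disMap hμ p) h
    · rintro ⟨y⟩
      -- Surjectivity: `y` is homotopic to its compression, which is the integrated form of its
      -- disintegration.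
      have hY := y.ess_nonDegenerate (p.twisted hμ α)
      refine ⟨KKweight.mk _ ((y.ndeg (p.twisted hμ α)).dis_weight hY), ?_⟩
      exact (KK.sound (.of_unitaryEquiv (KasparovCycle.dis_int _ hY))).trans
        (y.homotopic_ndeg (p.twisted hμ α)).symm

end GreenJulgIsomorphism

end GreenJulg

end

theorem mainTheorem8 {S Γ Γτ A : Type*}
    [Group S] [TopologicalSpace S] [IsTopologicalGroup S] [T2Space S] [LocallyCompactSpace S]
    [SecondCountableTopology S]
    [Group Γ] [TopologicalSpace Γ] [DiscreteTopology Γ] [Countable Γ]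
    [Group Γτ] [TopologicalSpace Γτ] [IsTopologicalGroup Γτ] [MeasurableSpace Γτ] [BorelSpace Γτ]
    [NonUnitalCStarAlgebra A] [TopologicalSpace.SeparableSpace A]
    (φ : S →* MulAut Γ) (hφ : Continuous fun p : S × Γ => φ p.1 p.2)
    (e : CircleExtension Γ Γτ) (ℓ : LiftedAction φ e)
    (μ : Measure Γτ) [μ.IsHaarMeasure] (hμ : μ (Set.range e.incl) = 1)
    (α : CStarAction (Γ ⋊[φ] S) A) :
    ∃ β : CStarAction S (TwistedCrossedProduct μ e α.restrict),
      (∀ (s : S) (f : e.Functions A),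
        β.toAut s (TwistedCrossedProduct.of μ e α.restrict f) =
          TwistedCrossedProduct.of μ e α.restrict (ℓ.translate α s f)) ∧
      ∃ Φ : KKweight (ℓ.pullback α) ℓ.circle 1 ≃+ KK β,
        (∀ x : KasparovCycle (ℓ.pullback α) ℂ, x.HasWeight ℓ.circle 1 →
          ∃ y : KasparovCycle β ℂ, Corresponds μ ℓ α x y) ∧
        (∀ y : KasparovCycle β ℂ, y.IsNondegenerate →
          ∃ x : KasparovCycle (ℓ.pullback α) ℂ,
            x.HasWeight ℓ.circle 1 ∧ Corresponds μ ℓ α x y) ∧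
        (∀ η : KK β, ∃ y : KasparovCycle β ℂ, y.IsNondegenerate ∧ KK.mk y = η) ∧
        (∀ (x : KasparovCycle (ℓ.pullback α) ℂ) (hx : x.HasWeight ℓ.circle 1)
          (y : KasparovCycle β ℂ), Corresponds μ ℓ α x y → Φ (KKweight.mk x hx) = KK.mk y) := by
  obtain ⟨p⟩ := exists_strictPartition A
  refine ⟨twistedAction ℓ α hμ, twistedAction_of ℓ α hμ, intEquiv ℓ α hμ, fun x hx => ?_,
    fun y hy => ?_, ?_, fun x hx y h => ?_⟩
  · exact ⟨x.int hμ, (KasparovCycle.corresponds_iff hx _).2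
      ⟨LinearEquiv.refl ℂ x.E, fun _ _ => rfl, fun _ => rfl, fun _ _ => rfl, fun _ _ => rfl,
        fun _ => rfl⟩⟩
  · exact ⟨y.dis hy, y.dis_weight hy,
      (KasparovCycle.corresponds_iff (y.dis_weight hy) y).2 (y.dis_int hy)⟩
  · rintro ⟨y⟩
    exact ⟨y.ndeg (p.twisted hμ α), y.ess_nonDegenerate (p.twisted hμ α),
      (y.homotopic_ndeg (p.twisted hμ α)).symm⟩
  -- The isomorphism sends the class of `x` to that of its integrated form, and a cycle
  -- corresponding to `x` is unitarily equivalent to this integrated form.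
  · exact KK.sound (.of_unitaryEquiv ((KasparovCycle.corresponds_iff hx y).1 h))
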